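/- Let $K=\mathbb{Q}(q)$ and let $O_q(M(n))$ be the associative unital $K$-algebra generated by $Z_{ij}$, $1\le i,j\le n$, with the relations $$Z_{ij}Z_{ik}=q^2Z_{ik}Z_{ij}\ (j<k),\qquad Z_{ij}Z_{kj}=q^2Z_{kj}Z_{ij}\ (i<k),$$ $$Z_{ij}Z_{st}=Z_{st}Z_{ij}\ (i>s,\ j<t),\qquad Z_{ij}Z_{st}=Z_{st}Z_{ij}+(q^2-q^{-2})Z_{it}Z_{sj}\ (i<s,\ j<t).$$ Let $\bar{\ }$ be the anti-automorphism of the ring $O_q(M(n))$ with $\bar q=q^{-1}$, $\overline{Z_{ij}}=Z_{ij}$, and let $\sigma$ be the $K$-algebra automorphism with $\sigma(Z_{ij})=Z_{ji}$. For an $n\times n$ matrix $A=(a_{ij})$ of non-negative integers let $Z^A=\prod_{i,j}Z_{ij}^{a_{ij}}$, with the factors in the lexicographic order of $(i,j)$, and put $$Z(A)=q^{-\sum_i\sum_{j>k}a_{ij}a_{ik}-\sum_i\sum_{j>k}a_{ji}a_{ki}}\,Z^A .$$ There is a unique family $B^*=\{b(A)\}$, the dual canonical basis, indexed by the $n\times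 n$ matrices of non-negative integers, such that for every $A$: $\overline{b(A)}=b(A)$, and $b(A)=Z(A)+\sum_{B<A}h_B(A)Z(B)$, a finite sum with $h_B(A)\in q\mathbb{Z}[q]$, over matrices $B$ that have the same row sums and the same column sums as $A$ and that are smaller than $A$ in the lexicographic order of the entries (read row by row). For $1\le t\le n$ let $$\det\nolimits_q(t)=\sum_{s\in S_t}(-q^2)^{\ell(s)}Z_{1,\,n-t+s(1)}Z_{2,\,n-t+s(2)}\cdots Z_{t,\,n-t+s(t)},$$ the quantum minor with rows $1,\dots,t$ and columns $n-t+1,\dots,n$. Write $x\sim y$ if $y=q^mx$ for some $m\in\mathbb{Z}$. Let $a_1,\dots,a_n$, $b_2,\dots,b_n$, $c_2,\dots,c_n$ be non-negative integers and let $A$ be the $n\times n$ matrix with diagonal entries $A_{ii}=a_i$, with $A_{ij}=b_{j-i+1}$ for $i<j$, and with $A_{ij}=c_{i-j+1}$ for $i>j$. Then $$b(A)\sim\Bigl(\prod_{t=1}^{n-1}\det\nolimits_q(t)^{b_{n-t+1}}\,\sigma(\det\nolimits_q(t))^{c_{n-t+1}}\Bigr)\,b(\operatorname{diag}(a_1,\dots,a_n)),$$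 where the factors of the product over $t$ may be taken in any order of the indices $t$. -/

import Mathlib

noncomputable section

namespace QMat

/-- The base field `K = ℚ(q)`. -/
abbrev K : Type := RatFunc ℚ

/-- The indeterminate `q` of `K = ℚ(q)`. -/
def q : K := RatFunc.X

theorem q_ne_zero : q ≠ 0 := RatFunc.X_ne_zero

theorem transcendental_q_inv : Transcendental ℚ (q⁻¹) := fun h => by
  have h' : IsAlgebraic ℚ q := IsAlgebraic.inv_iff.mp h
  refine RatFunc.transcendental_X (K := ℚ) ?_
  convert h'
  · exact Subsingleton.elim _ _
  · rfl

/-- The field endomorphism of `ℚ(q)` over `ℚ` with `q ↦ q⁻¹`. -/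
def barK : K →+* K :=
  RatFunc.liftRingHom (Polynomial.aeval (q⁻¹) : Polynomial ℚ →ₐ[ℚ] K).toRingHom
    (nonZeroDivisors_le_comap_nonZeroDivisors_of_injective _
      (transcendental_iff_injective.mp transcendental_q_inv))

theorem barK_q : barK q = q⁻¹ := by
  have h := RatFunc.liftRingHom_X
    (Polynomial.aeval (q⁻¹) : Polynomial ℚ →ₐ[ℚ] K).toRingHom
    (nonZeroDivisors_le_comap_nonZeroDivisors_of_injective _
      (transcendental_iff_injective.mp transcendental_q_inv))
  refine Eq.trans h ?_
  simp

/-- The free generators. -/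
def freeZ {n : ℕ} (i j : Fin n) : FreeAlgebra K (Fin n × Fin n) := FreeAlgebra.ι K (i, j)

/-- The defining relations of the coordinate algebra of quantum `n × n` matrices. -/
inductive Rel (n : ℕ) :
    FreeAlgebra K (Fin n × Fin n) → FreeAlgebra K (Fin n × Fin n) → Prop
  | row (i j k : Fin n) (h : j < k) :
      Rel n (freeZ i j * freeZ i k) (q ^ 2 • (freeZ i k * freeZ i j))
  | col (i k j : Fin n) (h : i < k) :
      Rel n (freeZ i j * freeZ k j) (q ^ 2 • (freeZ k j * freeZ i j))
  | anti (i j s t : Fin n) (h : s < i) (h' : j < t) :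
      Rel n (freeZ i j * freeZ s t) (freeZ s t * freeZ i j)
  | diag (i j s t : Fin n) (h : i < s) (h' : j < t) :
      Rel n (freeZ i j * freeZ s t)
        (freeZ s t * freeZ i j + (q ^ 2 - q ^ (-2 : ℤ)) • (freeZ i t * freeZ s j))

/-- The coordinate algebra `O_q(M(n))` of quantum `n × n` matrices over `K = ℚ(q)`. -/
abbrev OqM (n : ℕ) : Type := RingQuot (Rel n)

/-- The generator `Z_{ij}` of `O_q(M(n))`. -/
def Z {n : ℕ} (i j : Fin n) : OqM n := RingQuot.mkAlgHom K (Rel n) (freeZ i j)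

section relations

variable {n : ℕ}

theorem Z_row (i j k : Fin n) (h : j < k) : Z i j * Z i k = q ^ 2 • (Z i k * Z i j) := by
  simpa [Z] using RingQuot.mkAlgHom_rel K (Rel.row i j k h)

theorem Z_col (i k j : Fin n) (h : i < k) : Z i j * Z k j = q ^ 2 • (Z k j * Z i j) := by
  simpa [Z] using RingQuot.mkAlgHom_rel K (Rel.col i k j h)

theorem Z_anti (i j s t : Fin n) (h : s < i) (h' : j < t) :
    Z i j * Z s t = Z s t * Z i j := by
  simpa only [Z, map_mul] using RingQuot.mkAlgHom_rel K (Rel.anti i j s t h h')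

theorem Z_diag (i j s t : Fin n) (h : i < s) (h' : j < t) :
    Z i j * Z s t = Z s t * Z i j + (q ^ 2 - q ^ (-2 : ℤ)) • (Z i t * Z s j) := by
  simpa only [Z, map_mul, map_add, map_smul] using
    RingQuot.mkAlgHom_rel K (Rel.diag i j s t h h')

end relations

/-- The opposite ring of `O_q(M(n))`, as a `K`-algebra through `q ↦ q⁻¹`. -/
def BarTarget (n : ℕ) : Type := (OqM n)ᵐᵒᵖ

instance (n : ℕ) : Ring (BarTarget n) := inferInstanceAs (Ring (OqM n)ᵐᵒᵖ)

instance (n : ℕ) : Algebra K (BarTarget n) :=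
  RingHom.toAlgebra' ((algebraMap K (OqM n)ᵐᵒᵖ).comp barK)
    (fun c x => Algebra.commutes (A := (OqM n)ᵐᵒᵖ) (barK c) x)

/-- `x`, viewed in the opposite ring. -/
def toBar {n : ℕ} (x : OqM n) : BarTarget n := MulOpposite.op x

/-- `x`, viewed in `O_q(M(n))` again. -/
def ofBar {n : ℕ} (x : BarTarget n) : OqM n := MulOpposite.unop (show (OqM n)ᵐᵒᵖ from x)

section toBar

variable {n : ℕ}

theorem toBar_mul (x y : OqM n) : toBar x * toBar y = toBar (y * x) := rfl

theorem toBar_add (x y : OqM n) : toBar x + toBar y = toBar (x + y) := rfl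

theorem smul_toBar (c : K) (x : OqM n) : c • toBar x = toBar (barK c • x) := by
  rw [Algebra.smul_def, Algebra.smul_def, Algebra.commutes (barK c) x]
  rfl

end toBar

/-- The bar involution of `O_q(M(n))` as a homomorphism to the opposite ring. -/
def barHom (n : ℕ) : OqM n →ₐ[K] BarTarget n :=
  RingQuot.liftAlgHom K
    ⟨FreeAlgebra.lift K (fun p : Fin n × Fin n => toBar (Z p.1 p.2)), by
      have e : ∀ c : K, barK (c ^ 2) = barK c ^ 2 := fun c => map_pow _ _ _
      have hq : barK q ^ 2 * q ^ 2 = 1 := by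
        rw [barK_q, ← mul_pow, inv_mul_cancel₀ q_ne_zero, one_pow]
      have hd : barK (q ^ 2 - q ^ (-2 : ℤ)) = -(q ^ 2 - q ^ (-2 : ℤ)) := by
        rw [map_sub, map_zpow₀, map_pow, barK_q]
        simp [zpow_neg]
      intro x y h
      induction h with
      | row i j k h =>
        simp only [freeZ, map_mul, map_smul, FreeAlgebra.lift_ι_apply, toBar_mul, smul_toBar, e,
          Z_row i j k h, smul_smul, hq, one_smul]
      | col i k j h =>
        simp only [freeZ, map_mul, map_smul, FreeAlgebra.lift_ι_apply, toBar_mul, smul_toBar, e,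
          Z_col i k j h, smul_smul, hq, one_smul]
      | anti i j s t h h' =>
        simp only [freeZ, map_mul, FreeAlgebra.lift_ι_apply, toBar_mul, Z_anti i j s t h h']
      | diag i j s t h h' =>
        simp only [freeZ, map_mul, map_add, map_smul, FreeAlgebra.lift_ι_apply, toBar_mul,
          smul_toBar, toBar_add, Z_diag i j s t h h', hd, Z_anti s j i t h h']
        rw [neg_smul (q ^ 2 - q ^ (-2 : ℤ)) (Z i t * Z s j), add_neg_cancel_right]⟩

/-- The bar involution: the anti-automorphism of the ring `O_q(M(n))` with `q ↦ q⁻¹` and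
`Z_{ij} ↦ Z_{ij}`. -/
def bar {n : ℕ} (x : OqM n) : OqM n := ofBar (barHom n x)

/-- The automorphism `σ` of the `K`-algebra `O_q(M(n))` with `Z_{ij} ↦ Z_{ji}`. -/
def sigma (n : ℕ) : OqM n →ₐ[K] OqM n :=
  RingQuot.liftAlgHom K
    ⟨FreeAlgebra.lift K (fun p : Fin n × Fin n => Z p.2 p.1), by
      intro x y h
      induction h with
      | row i j k h =>
        simp only [freeZ, map_mul, map_smul, FreeAlgebra.lift_ι_apply, Z_col j k i h]
      | col i k j h =>
        simp only [freeZ, map_mul, map_smul, FreeAlgebra.lift_ι_apply, Z_row j i k h]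
      | anti i j s t h h' =>
        simp only [freeZ, map_mul, FreeAlgebra.lift_ι_apply, Z_anti t s j i h' h]
      | diag i j s t h h' =>
        simp only [freeZ, map_mul, map_add, map_smul, FreeAlgebra.lift_ι_apply,
          Z_diag j i t s h' h, Z_anti t i j s h' h]⟩

section characterization

variable {n : ℕ}

theorem bar_Z (i j : Fin n) : bar (Z i j) = Z i j := by
  refine congrArg ofBar ((RingQuot.liftAlgHom_mkAlgHom_apply K _ _ _).trans ?_) (a₂ := toBar _)
  rw [freeZ, FreeAlgebra.lift_ι_apply]
  rfl

theorem bar_mul (x y : OqM n) : bar (x * y) = bar y * bar x := by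
  unfold bar
  rw [map_mul]
  rfl

theorem bar_add (x y : OqM n) : bar (x + y) = bar x + bar y := by
  unfold bar
  rw [map_add]
  rfl

theorem bar_smul (c : K) (x : OqM n) : bar (c • x) = barK c • bar x := by
  unfold bar
  rw [map_smul]
  exact congrArg ofBar (smul_toBar c (ofBar (barHom n x)))

theorem sigma_Z (i j : Fin n) : sigma n (Z i j) = Z j i := by
  refine (RingQuot.liftAlgHom_mkAlgHom_apply K _ _ _).trans ?_
  rw [freeZ, FreeAlgebra.lift_ι_apply]

end characterization

/-- The monomial `Z^A = ∏ Z_{ij}^{a_{ij}}`, with the factors in the lexicographic order of the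
positions `(i, j)`. -/
def monomial {n : ℕ} (A : Matrix (Fin n) (Fin n) ℕ) : OqM n :=
  ((List.finRange n).map fun i => ((List.finRange n).map fun j => Z i j ^ A i j).prod).prod

/-- The number `∑_i ∑_{j>k} a_{ij} a_{ik} + ∑_i ∑_{j>k} a_{ji} a_{ki}`. -/
def normExp {n : ℕ} (A : Matrix (Fin n) (Fin n) ℕ) : ℕ :=
  (∑ i, ∑ j, ∑ k, if k < j then A i j * A i k else 0) +
    ∑ i, ∑ j, ∑ k, if k < j then A j i * A k i else 0

/-- The normalized monomial `Z(A) = D(A) Z^A`, where `D(A) = q ^ (- normExp A)`. -/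
def normMonomial {n : ℕ} (A : Matrix (Fin n) (Fin n) ℕ) : OqM n :=
  q ^ (-(normExp A : ℤ)) • monomial A

/-- The strict lexicographic order on matrices, the entries being read in the lexicographic
order of their positions. -/
def LexLT {n : ℕ} (B A : Matrix (Fin n) (Fin n) ℕ) : Prop :=
  ∃ i j, B i j < A i j ∧ ∀ k l, (k < i ∨ (k = i ∧ l < j)) → B k l = A k l

/-- `B` and `A` have the same row sums and the same column sums. -/
def SameSums {n : ℕ} (B A : Matrix (Fin n) (Fin n) ℕ) : Prop :=
  (∀ i, ∑ j, B i j = ∑ j, A i j) ∧ (∀ j, ∑ i, B i j = ∑ i, A i j)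

/-- The subset `qℤ[q]` of `K`. -/
def qIntPoly : Set K := {x | ∃ p : Polynomial ℤ, x = q * Polynomial.aeval q p}

/-- The family `b` is the dual canonical basis `B^* = {b(A)}` of `O_q(M(n))`: each `b A` is
bar-invariant, and `b A = Z(A) + ∑_{B < A} h_B(A) Z(B)` with `h_B(A) ∈ qℤ[q]`, where `B` runs
over matrices with the row sums and column sums of `A`. -/
structure IsDualCanonicalBasis {n : ℕ} (b : Matrix (Fin n) (Fin n) ℕ → OqM n) : Prop where
  bar_eq : ∀ A, bar (b A) = b A
  triangular : ∀ A, ∃ h : Matrix (Fin n) (Fin n) ℕ →₀ K,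
    (∀ B, h B ∈ qIntPoly) ∧ (∀ B, h B ≠ 0 → LexLT B A ∧ SameSums B A) ∧
      b A = normMonomial A + h.sum fun B c => c • normMonomial B

/-- `x ∼ y`: the elements differ by an integral power of `q`. -/
def QEquiv {n : ℕ} (x y : OqM n) : Prop := ∃ m : ℤ, y = q ^ m • x

/-- The length (number of inversions) of a permutation. -/
def permLength {m : ℕ} (s : Equiv.Perm (Fin m)) : ℕ :=
  (Finset.univ.filter fun p : Fin m × Fin m => p.1 < p.2 ∧ s p.2 < s p.1).card

/-- The quantum minor with rows `r 0 < r 1 < ⋯` and columns `c 0 < c 1 < ⋯`, that is,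
`∑_s (-q²)^{ℓ(s)} Z_{r 0, c (s 0)} Z_{r 1, c (s 1)} ⋯`. -/
def quantumMinor {n m : ℕ} (r c : Fin m ↪o Fin n) : OqM n :=
  ∑ s : Equiv.Perm (Fin m),
    (-q ^ 2) ^ permLength s • ((List.finRange m).map fun i => Z (r i) (c (s i))).prod

/-- The last `t` indices `n - t + 1, …, n` (counted from `1`), in increasing order. -/
def lastEmb {n t : ℕ} (ht : t ≤ n) : Fin t ↪o Fin n :=
  OrderEmbedding.ofStrictMono (fun i => ⟨n - t + i, by omega⟩) (by
    intro i j h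
    have h' : (i : ℕ) < j := h
    simp only [Fin.mk_lt_mk]
    omega)

/-- `det_q(t)`: the quantum minor with rows `1, …, t` and columns `n - t + 1, …, n`. -/
def detq {n : ℕ} (t : ℕ) (ht : t ≤ n) : OqM n :=
  quantumMinor (Fin.castLEOrderEmb ht) (lastEmb ht)

/-- The matrix with diagonal entries `a i`, with all entries of the `(k - 1)`-st superdiagonal
equal to `b k`, and with all entries of the `(k - 1)`-st subdiagonal equal to `c k`
(`2 ≤ k ≤ n`). -/
def toeplitzLike {n : ℕ} (a : Fin n → ℕ) (b c : ℕ → ℕ) : Matrix (Fin n) (Fin n) ℕ :=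
  fun i j => if i = j then a i
    else if i < j then b ((j : ℕ) - i + 1) else c ((i : ℕ) - j + 1)

end QMat

end

/-! Write L for the ℤ[q]-lattice spanned by the normalized monomials Z(A), and E_t for the matrix
with ones at the positions (i, n-t+i), 1 ≤ i ≤ t. Everything rests on one multiplication rule:
b(A+E_t) = q^m det_q(t) b(A), where m is the sum of the first t row sums of A minus the sum of its
last t column sums (`IsDualCanonicalBasis.detq_mul`). Applying the transposition σ gives the same
rule, up to a power of q, for σ(det_q(t)) and the transpose of E_t. The matrix in the theorem is
diag(a) plus b_{n-t+1} copies of E_t and c_{n-t+1} copies of its transpose for each t < n, so the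
product formula follows by adding these one at a time. The order of the t plays no role, since the
rule holds for every A.

The dual canonical basis is characterized by bar-invariance together with the congruence b(A) ≡ Z(A)
mod qL. Indeed bar is unitriangular on the Z(A) for the lexicographic order on matrices with fixed
row and column sums (`bar_normMonomial_sub_mem`), and an element x with both x and bar x in qL
vanishes (`eq_zero_of_mem_scale`). The same triangularity yields existence by a Kazhdan-Lusztig type
recursion (`exists_eq_sub_bar`). These arguments need the monomials to be linearly independent,
which is shown by building a faithful enough representation one row at a time
(`exists_representation`).

The rule has two halves. The first is the congruence q^m det_q(t) Z(B) ≡ Z(B+E_t) mod qL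
(`qminor_mul_normMonomial`). The minor is expanded along its first row and moved through the
monomial, one generator power at a time. The commutation of a minor with a generator of a row above
it (`minor_mul_aux`) has an explicit correction term, and bookkeeping of exponents shows that every
contribution except the diagonal one carries a positive power of q. Since m depends only on the row
and column sums, the congruence passes from Z(B) to b(A).

The second half concerns bar. The bar image of q^m det_q(t) b(A) is q^{-m} b(A) det_q(t), with the
minor on the other side, so the first half does not apply to it directly. The reflection ρ in the
antidiagonal is a K-linear anti-automorphism that commutes with bar, permutes the Z(A), hence
permutes the b(A), and fixes det_q(t). It exchanges the top row sums with the right column sums, so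
it turns q^{-m} b(A) det_q(t) into a product already treated. Thus q^m det_q(t) b(A) and its bar
image are both congruent to Z(A+E_t), and the difference with b(A+E_t) is zero. No commutation of
det_q(t) with b(A) has to be known beforehand. -/

noncomputable section

namespace QMat

/-! ### Quantum minors and their commutation with generators of a higher row. -/

section Minor

variable {F A ι κ : Type*} [Field F] [Ring A] [Algebra F A] [LinearOrder ι] [LinearOrder κ]

/-- A matrix over an `F`-algebra whose entries satisfy the quantum matrix relations. -/
structure IsQuantumMatrix (v : F) (z : ι → κ → A) : Prop where
  row : ∀ i j k, j < k → z i j * z i k = v • (z i k * z i j)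
  col : ∀ i k j, i < k → z i j * z k j = v • (z k j * z i j)
  anti : ∀ i j s t, s < i → j < t → z i j * z s t = z s t * z i j
  diag : ∀ i j s t, i < s → j < t →
    z i j * z s t = z s t * z i j + (v - v⁻¹) • (z i t * z s j)

/-- The number of elements of `I` below `j`. -/
def posIn (I : Finset κ) (j : κ) : ℕ := (I.filter (· < j)).card

theorem posIn_insert {I : Finset κ} {k : κ} (h : k ∉ I) (p : κ) :
    posIn (insert k I) p = posIn I p + if k < p then 1 else 0 := by
  unfold posIn
  rw [Finset.filter_insert]
  split_ifs with hk
  · rw [Finset.card_insert_of_notMem (by simp [h])]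
  · rfl

theorem posIn_erase {I : Finset κ} {m : κ} (h : m ∈ I) (p : κ) :
    posIn I p = posIn (I.erase m) p + if m < p then 1 else 0 := by
  conv_lhs => rw [← Finset.insert_erase h]
  exact posIn_insert (Finset.notMem_erase m I) p

/-- The quantum minor with the given list of rows and the given set of columns, defined by
expansion along the first row. -/
def minor (v : F) (z : ι → κ → A) : List ι → Finset κ → A
  | [], I => if I = ∅ then 1 else 0
  | i :: rs, I => ∑ j ∈ I, (-v) ^ posIn I j • (z i j * minor v z rs (I.erase j))

/-- The part of the expansion of a minor along its first row that uses columns beyond `k`. -/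
def minorTail (v : F) (z : ι → κ → A) (i : ι) (rs : List ι) (J : Finset κ) (k : κ) : A :=
  ∑ m ∈ J, if k < m then (-v) ^ posIn J m • (z i m * minor v z rs (J.erase m)) else 0

/-- The quantum relations match double sums over columns only after the terms for (a, b) and (b, a)
are added. The coordinate swap is an involution that cancels the difference of the two sums. -/
theorem sum_sum_eq_of_swap {M : Type*} [AddCommGroup M] (I : Finset κ) (G H : κ → κ → M)
    (h : ∀ a ∈ I, ∀ b ∈ I, a < b → G a b + G b a = H a b + H b a)
    (h' : ∀ a ∈ I, G a a = H a a) :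
    ∑ a ∈ I, ∑ b ∈ I, G a b = ∑ a ∈ I, ∑ b ∈ I, H a b := by
  rw [← Finset.sum_product', ← Finset.sum_product', ← sub_eq_zero, ← Finset.sum_sub_distrib]
  refine Finset.sum_involution (fun p _ => (p.2, p.1)) ?_ ?_ ?_ ?_
  · rintro ⟨a, b⟩ hp
    simp only [Finset.mem_product] at hp
    rcases lt_trichotomy a b with hab | rfl | hab
    · have := h a hp.1 b hp.2 hab
      rw [← sub_eq_zero] at this
      rw [← this]; abel
    · simp [h' a hp.1]
    · have := h b hp.2 a hp.1 hab
      rw [← sub_eq_zero] at this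
      rw [← this]; abel
  · rintro ⟨a, b⟩ hp hne heq
    simp only [Finset.mem_product, Prod.mk.injEq] at hp heq
    obtain ⟨rfl, -⟩ := heq
    exact hne (sub_eq_zero.2 (h' _ hp.1))
  · rintro ⟨a, b⟩ hp
    simp only [Finset.mem_product] at hp ⊢
    exact ⟨hp.2, hp.1⟩
  · rintro ⟨a, b⟩ hp; rfl

variable {v : F} {z : ι → κ → A}

theorem IsQuantumMatrix.swap_below (hz : IsQuantumMatrix v z) {i r : ι} (hir : i < r) (m k : κ)
    (hmk : m ≠ k) :
    z r m * z i k = z i k * z r m - if k < m then (v - v⁻¹) • (z i m * z r k) else 0 := by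
  split_ifs with h
  · rw [hz.diag i k r m hir h]; simp
  · rw [sub_zero]
    exact hz.anti r m i k hir (lt_of_le_of_ne (not_lt.1 h) hmk)

theorem IsQuantumMatrix.swap_col (hz : IsQuantumMatrix v z) (hv : v ≠ 0) {i r : ι} (hir : i < r)
    (k : κ) : z r k * z i k = v⁻¹ • (z i k * z r k) := by
  rw [hz.col i r k hir, smul_smul, inv_mul_cancel₀ hv, one_smul]

omit [LinearOrder ι] in
theorem minorTail_insert {I : Finset κ} {k : κ} (hk : k ∉ I) (i : ι) (rs : List ι) :
    minorTail v z i rs (insert k I) k = ∑ p ∈ I, if k < p then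
      (-v) ^ (posIn I p + 1) • (z i p * minor v z rs (insert k (I.erase p))) else 0 := by
  rw [minorTail, Finset.sum_insert hk, if_neg (lt_irrefl k), zero_add]
  refine Finset.sum_congr rfl fun p _ => ?_
  split_ifs with h
  · rw [posIn_insert hk, if_pos h, Finset.erase_insert_of_ne h.ne]
  · rfl

/-- Induction on the rows: expand along the first row r and move each z r m past z i k. The two
claims feed each other, because the term m = k of the first claim leaves a minor whose column set no
longer contains k. -/
theorem minor_mul_aux (hz : IsQuantumMatrix v z) (hv : v ≠ 0) (i : ι) :
    ∀ rs : List ι, (∀ r ∈ rs, i < r) → ∀ (I : Finset κ) (k : κ),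
      (k ∈ I → minor v z rs I * z i k = v⁻¹ • (z i k * minor v z rs I)) ∧
      (k ∉ I → minor v z rs I * z i k = z i k * minor v z rs I +
        ((1 - v⁻¹ * v⁻¹) * ((-v) ^ posIn I k)⁻¹) • minorTail v z i rs (insert k I) k) := by
  have hV : (-v) ≠ 0 := neg_ne_zero.2 hv
  intro rs
  induction rs with
  | nil =>
    intro _ I k
    constructor
    · intro hk
      have : I ≠ ∅ := Finset.ne_empty_of_mem hk
      simp [minor, this]
    · intro hk
      have ht : minorTail v z i [] (insert k I) k = 0 := by
        refine Finset.sum_eq_zero fun m _ => ?_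
        split_ifs with h
        · have : (insert k I).erase m ≠ ∅ :=
            Finset.ne_empty_of_mem (a := k) (by simp [h.ne])
          simp [minor, this]
        · rfl
      rw [ht, smul_zero, add_zero]
      by_cases hI : I = ∅ <;> simp [minor, hI]
  | cons r rs ih =>
    intro hrs I k
    have hir : i < r := hrs r (by simp)
    have ih := ih (fun r' hr' => hrs r' (by simp [hr']))
    constructor
    · intro hk
      have key : ∀ m ∈ I, ((-v) ^ posIn I m • (z r m * minor v z rs (I.erase m))) * z i k =
          v⁻¹ • (z i k * ((-v) ^ posIn I m • (z r m * minor v z rs (I.erase m)))) +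
          ((if m = k then (1 - v⁻¹ * v⁻¹) • (z r k * minorTail v z i rs I k) else 0) -
          if k < m then (1 - v⁻¹ * v⁻¹) • (-v) ^ posIn I m •
            (z r k * (z i m * minor v z rs (I.erase m))) else 0) := by
        intro m hm
        by_cases hmk : m = k
        · subst hmk
          rw [smul_mul_assoc, mul_assoc, (ih (I.erase m) m).2 (Finset.notMem_erase m I),
            Finset.insert_erase hm]
          have hp : posIn I m = posIn (I.erase m) m := by rw [posIn_erase hm m]; simp
          rw [← hp]
          simp only [if_true, lt_irrefl, if_false, mul_add, smul_add, mul_smul_comm, sub_zero,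
            ← mul_assoc, hz.swap_col hv hir]
          simp only [smul_mul_assoc, smul_smul]
          congr 2
          · ring
          · field_simp
        · rw [smul_mul_assoc, mul_assoc, (ih (I.erase m) k).1 (by simp [Ne.symm hmk, hk]),
            mul_smul_comm, ← mul_assoc, hz.swap_below hir m k hmk]
          simp only [hmk, if_false, zero_sub, sub_mul, ite_mul, zero_mul]
          split_ifs with h
          · rw [← mul_assoc (z r k), ← hz.anti r k i m hir h]
            generalize (-v) ^ posIn I m = p
            simp only [smul_mul_assoc, mul_smul_comm, ← mul_assoc]
            match_scalars <;> field_simp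
          · simp only [mul_smul_comm, ← mul_assoc]
            module
      -- The tail produced by m = k is cancelled by the corrections from all m beyond k.
      rw [minor, Finset.sum_mul, Finset.sum_congr rfl key, Finset.sum_add_distrib,
        Finset.sum_sub_distrib, Finset.sum_ite_eq' I k, if_pos hk, Finset.mul_sum,
        Finset.smul_sum, add_eq_left, sub_eq_zero, minorTail, Finset.mul_sum, Finset.smul_sum]
      refine Finset.sum_congr rfl fun m _ => ?_
      split_ifs <;> simp
    · intro hk
      have hne : ∀ m ∈ I, m ≠ k := fun m hm h => hk (h ▸ hm)
      set c : F := 1 - v⁻¹ * v⁻¹ with hc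
      have key : ∀ m ∈ I, ((-v) ^ posIn I m • (z r m * minor v z rs (I.erase m))) * z i k =
          z i k * ((-v) ^ posIn I m • (z r m * minor v z rs (I.erase m))) +
          (if k < m then -((v - v⁻¹) * (-v) ^ posIn I m) •
            (z i m * (z r k * minor v z rs (I.erase m))) else 0) +
          ∑ p ∈ I, if m ≠ p ∧ k < p then
            ((-v) ^ posIn I m * (c * ((-v) ^ posIn (I.erase m) k)⁻¹ *
              (-v) ^ (posIn (I.erase m) p + 1))) •
              (z r m * (z i p * minor v z rs (insert k ((I.erase m).erase p)))) else 0 := by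
        intro m hm
        have hkm : k ∉ I.erase m := by simp [hk]
        rw [smul_mul_assoc, mul_assoc, (ih (I.erase m) k).2 hkm, minorTail_insert hkm,
          mul_add, smul_add, ← mul_assoc, hz.swap_below hir m k (hne m hm)]
        congr 1
        · split_ifs with h
          · simp only [sub_mul, smul_mul_assoc, mul_smul_comm, ← mul_assoc]
            module
          · simp [mul_assoc]
        · rw [← Finset.sum_erase (a := m) I (by simp), mul_smul_comm, Finset.mul_sum,
            Finset.smul_sum, Finset.smul_sum]
          refine Finset.sum_congr rfl fun p hp => ?_
          have hmp : m ≠ p := (Finset.ne_of_mem_erase hp).symm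
          by_cases hkp : k < p
          · simp only [hkp, hmp, if_true, ne_eq, not_false_eq_true, and_self, mul_smul_comm,
              smul_smul]
          · simp [hkp]
      have key' : ∀ p ∈ I, (if k < p then (-v) ^ (posIn I p + 1) •
            (z i p * minor v z (r :: rs) (insert k (I.erase p))) else 0) =
          (if k < p then ((-v) ^ (posIn I p + 1) * (-v) ^ posIn I k) •
            (z i p * (z r k * minor v z rs (I.erase p))) else 0) +
          ∑ m ∈ I, if m ≠ p ∧ k < p then
            ((-v) ^ (posIn I p + 1) * (-v) ^ posIn (insert k (I.erase p)) m) •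
              (z i p * (z r m * minor v z rs (insert k ((I.erase m).erase p)))) else 0 := by
        intro p hp
        have hkp' : k ∉ I.erase p := by simp [hk]
        rw [← Finset.sum_erase (a := p) I (by simp)]
        split_ifs with h
        · rw [minor, Finset.sum_insert hkp', mul_add, smul_add, Finset.erase_insert hkp']
          congr 1
          · rw [posIn_insert hkp', posIn_erase hp k]
            simp [h.not_gt, smul_smul]
          · rw [Finset.mul_sum, Finset.smul_sum]
            refine Finset.sum_congr rfl fun m hm => ?_
            have hmp : m ≠ p := Finset.ne_of_mem_erase hm
            rw [if_pos ⟨hmp, h⟩, mul_smul_comm, smul_smul,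
              Finset.erase_insert_of_ne (hne m (Finset.mem_of_mem_erase hm)).symm,
              Finset.erase_right_comm]
        · simp [h]
      rw [minorTail_insert hk, Finset.sum_congr rfl key', minor, Finset.sum_mul,
        Finset.sum_congr rfl key, Finset.sum_add_distrib, Finset.sum_add_distrib,
        Finset.sum_add_distrib, ← Finset.mul_sum, smul_add, add_assoc]
      congr 2
      · rw [Finset.smul_sum]
        refine Finset.sum_congr rfl fun m hm => ?_
        split_ifs with h
        · rw [smul_smul]
          congr 1
          rw [hc, pow_succ]
          have : (-v) ^ posIn I k ≠ 0 := pow_ne_zero _ hV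
          field_simp
        · simp
      · rw [Finset.smul_sum]
        simp only [Finset.smul_sum]
        rw [Finset.sum_comm (s := I) (t := I) (f := fun p m => (c * ((-v) ^ posIn I k)⁻¹) • _)]
        refine sum_sum_eq_of_swap I _ _ ?_ (by simp)
        intro a ha b hb hab
        have e1 := posIn_erase ha k
        have e2 := posIn_erase ha b
        have e3 := posIn_erase hb a
        have e4 := posIn_erase hb k
        have e5 : posIn (insert k (I.erase b)) a = _ := posIn_insert (by simp [hk]) a
        have e6 : posIn (insert k (I.erase a)) b = _ := posIn_insert (by simp [hk]) b
        rw [Finset.erase_right_comm (s := I) (a := b) (b := a)]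
        generalize minor v z rs (insert k ((I.erase a).erase b)) = D
        rw [if_pos hab] at e2
        rw [if_neg hab.not_gt, add_zero] at e3
        -- With a < b, the tail involves both columns if k < a, at most b if a < k. The case k = a
        -- is excluded since k is not in I.
        rcases lt_trichotomy k a with h | h | h
        · have hkb := h.trans hab
          rw [if_neg h.not_gt, add_zero] at e1
          rw [if_neg hkb.not_gt, add_zero] at e4
          rw [if_pos h] at e5
          rw [if_pos hkb] at e6
          simp only [h, hkb, hab.ne, hab.ne', ne_eq, not_false_eq_true, and_self, if_true]
          rw [e6, e5, e2, ← e1, ← e4, ← e3, ← mul_assoc (z r a), ← mul_assoc (z r b),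
            ← mul_assoc (z i a), ← mul_assoc (z i b), hz.swap_below hir a b hab.ne,
            hz.swap_below hir b a hab.ne', if_neg hab.not_gt, if_pos hab]
          have : (-v) ^ posIn I k ≠ 0 := pow_ne_zero _ hV
          simp only [sub_mul, sub_zero, smul_mul_assoc, pow_succ]
          match_scalars <;> field_simp <;> ring
        · exact absurd h.symm (hne a ha)
        · by_cases hkb : k < b
          · rw [if_pos h] at e1
            rw [if_neg h.not_gt, add_zero] at e5
            simp only [h.not_gt, hkb, hab.ne, hab.ne', ne_eq, not_false_eq_true, and_self,
              if_true, and_false, if_false, add_zero]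
            rw [e5, e2, e1, ← e3, ← mul_assoc (z r a), ← mul_assoc (z i b),
              hz.swap_below hir a b hab.ne, if_neg hab.not_gt]
            have : (-v) ^ posIn (I.erase a) k ≠ 0 := pow_ne_zero _ hV
            simp only [sub_zero, pow_succ]
            match_scalars <;> field_simp
          · simp [hkb, h.not_gt]

theorem minor_mul_of_mem (hz : IsQuantumMatrix v z) (hv : v ≠ 0) {i : ι} {rs : List ι}
    (h : ∀ r ∈ rs, i < r) {I : Finset κ} {k : κ} (hk : k ∈ I) :
    minor v z rs I * z i k = v⁻¹ • (z i k * minor v z rs I) :=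
  (minor_mul_aux hz hv i rs h I k).1 hk

theorem minor_mul_of_notMem (hz : IsQuantumMatrix v z) (hv : v ≠ 0) {i : ι} {rs : List ι}
    (h : ∀ r ∈ rs, i < r) {I : Finset κ} {k : κ} (hk : k ∉ I) :
    minor v z rs I * z i k = z i k * minor v z rs I +
      ((1 - v⁻¹ * v⁻¹) * ((-v) ^ posIn I k)⁻¹) • minorTail v z i rs (insert k I) k :=
  (minor_mul_aux hz hv i rs h I k).2 hk

/-- Each term of the tail gives two factors v⁻¹: one from z i m with k < m in the same row, one from
the minor, whose columns still include k. -/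
theorem minorTail_mul_of_mem (hz : IsQuantumMatrix v z) (hv : v ≠ 0) {i : ι} {rs : List ι}
    (h : ∀ r ∈ rs, i < r) {J : Finset κ} {k : κ} (hk : k ∈ J) :
    minorTail v z i rs J k * z i k = (v⁻¹ * v⁻¹) • (z i k * minorTail v z i rs J k) := by
  rw [minorTail, Finset.sum_mul, Finset.mul_sum, Finset.smul_sum]
  refine Finset.sum_congr rfl fun m _ => ?_
  split_ifs with hkm
  · rw [smul_mul_assoc, mul_assoc,
      minor_mul_of_mem hz hv h (Finset.mem_erase.2 ⟨hkm.ne, hk⟩), mul_smul_comm, ← mul_assoc,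
      mul_smul_comm, ← mul_assoc, hz.row i k m hkm]
    simp only [smul_mul_assoc]
    match_scalars
    field_simp
  · simp

/-- The row relation supplies v⁻¹. The corrections from the minors cancel in pairs: exchanging z i a
and z i b costs v, while exchanging their positions in the signs costs -v. -/
theorem minorTail_mul_of_notMem (hz : IsQuantumMatrix v z) (hv : v ≠ 0) {i : ι} {rs : List ι}
    (h : ∀ r ∈ rs, i < r) {J : Finset κ} {k : κ} (hk : k ∉ J) :
    minorTail v z i rs J k * z i k = v⁻¹ • (z i k * minorTail v z i rs J k) := by
  have key : ∀ m ∈ J, (if k < m then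
      (-v) ^ posIn J m • (z i m * minor v z rs (J.erase m)) else 0) * z i k =
      v⁻¹ • (z i k * if k < m then
        (-v) ^ posIn J m • (z i m * minor v z rs (J.erase m)) else 0) +
      ∑ p ∈ J, if m ≠ p ∧ k < m ∧ k < p then
        ((1 - v⁻¹ * v⁻¹) * ((-v) ^ posIn J k)⁻¹ * ((-v) ^ posIn J m *
          (-v) ^ (posIn (J.erase m) p + 1))) •
          (z i m * (z i p * minor v z rs (insert k ((J.erase m).erase p)))) else 0 := by
    intro m hm
    have hkm' : k ∉ J.erase m := by simp [hk]
    by_cases hkm : k < m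
    · simp only [hkm, if_true, true_and]
      rw [smul_mul_assoc, mul_assoc, minor_mul_of_notMem hz hv h hkm', minorTail_insert hkm',
        mul_add, smul_add, ← Finset.sum_erase (a := m) J (by simp)]
      congr 1
      · rw [← mul_assoc, mul_smul_comm, ← mul_assoc, hz.row i k m hkm]
        simp only [smul_mul_assoc]
        match_scalars
        field_simp
      · rw [mul_smul_comm, Finset.mul_sum, Finset.smul_sum, Finset.smul_sum]
        refine Finset.sum_congr rfl fun p hp => ?_
        have hmp : m ≠ p := (Finset.ne_of_mem_erase hp).symm
        rw [posIn_erase hm k, if_neg hkm.not_gt, add_zero]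
        by_cases hkp : k < p
        · simp only [hkp, hmp, if_true, ne_eq, not_false_eq_true, and_self, mul_smul_comm]
          module
        · simp [hkp]
    · simp [hkm]
  rw [minorTail, Finset.sum_mul, Finset.sum_congr rfl key, Finset.sum_add_distrib,
    ← Finset.smul_sum, ← Finset.mul_sum, add_eq_left, ← Finset.sum_const_zero (s := J)]
  rw [show (∑ _a ∈ J, (0 : A)) = ∑ _a ∈ J, ∑ _b ∈ J, (0 : A) by simp]
  refine sum_sum_eq_of_swap J _ _ ?_ (by simp)
  intro a ha b hb hab
  by_cases hka : k < a
  · have hkb := hka.trans hab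
    have e2 := posIn_erase ha b
    have e3 := posIn_erase hb a
    rw [if_pos hab] at e2
    rw [if_neg hab.not_gt, add_zero] at e3
    rw [Finset.erase_right_comm (s := J) (a := b) (b := a)]
    simp only [hka, hkb, hab.ne, hab.ne', ne_eq, not_false_eq_true, and_self, if_true]
    rw [e2, ← e3, ← mul_assoc (z i a), ← mul_assoc (z i b), hz.row i a b hab]
    simp only [smul_mul_assoc]
    match_scalars
    ring
  · simp [hka]

omit [LinearOrder ι] in
theorem sum_posIn {M : Type*} [AddCommMonoid M] (g : ℕ → M) (I : Finset κ) :
    ∑ j ∈ I, g (posIn I j) = ∑ k ∈ Finset.range I.card, g k := by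
  induction I using Finset.induction_on_max with
  | empty => simp
  | insert a s hs ih =>
    have ha : a ∉ s := fun h => lt_irrefl a (hs a h)
    rw [Finset.sum_insert ha, Finset.card_insert_of_notMem ha, Finset.sum_range_succ, add_comm,
      ← ih]
    congr 1
    · refine Finset.sum_congr rfl fun j hj => ?_
      rw [posIn_insert ha, if_neg (hs j hj).not_gt, add_zero]
    · rw [posIn_insert ha, if_neg (lt_irrefl a), add_zero, posIn, Finset.filter_true_of_mem hs]

/-- The expansion with reversed products and inverted coefficients, which is what bar makes of the
defining one. With p the position of column m, the corrections sum to a geometric series, and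
(-v)^(-p) + (1 - v^(-2p)) (-v)^p = (-v)^p. -/
theorem sum_inv_smul_minor_mul (hz : IsQuantumMatrix v z) (hv : v ≠ 0) {i : ι} {rs : List ι}
    (h : ∀ r ∈ rs, i < r) (J : Finset κ) :
    ∑ j ∈ J, ((-v) ^ posIn J j)⁻¹ • (minor v z rs (J.erase j) * z i j) =
      minor v z (i :: rs) J := by
  have hV : (-v) ≠ 0 := neg_ne_zero.2 hv
  have key : ∀ j ∈ J, ((-v) ^ posIn J j)⁻¹ • (minor v z rs (J.erase j) * z i j) =
      ((-v) ^ posIn J j)⁻¹ • (z i j * minor v z rs (J.erase j)) +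
      ∑ m ∈ J, if j < m then ((1 - v⁻¹ * v⁻¹) * (v⁻¹ * v⁻¹) ^ posIn J j * (-v) ^ posIn J m) •
        (z i m * minor v z rs (J.erase m)) else 0 := by
    intro j hj
    rw [minor_mul_of_notMem hz hv h (Finset.notMem_erase j J), Finset.insert_erase hj, minorTail,
      smul_add, Finset.smul_sum, Finset.smul_sum]
    congr 1
    refine Finset.sum_congr rfl fun m _ => ?_
    have e := posIn_erase hj j
    rw [if_neg (lt_irrefl j), add_zero] at e
    split_ifs
    · rw [← e, smul_smul, smul_smul]
      congr 1
      have : ((-v) ^ posIn J j)⁻¹ * ((-v) ^ posIn J j)⁻¹ = (v⁻¹ * v⁻¹) ^ posIn J j := by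
        rw [← inv_pow, ← mul_pow, inv_neg, neg_mul_neg]
      rw [← this]
      ring
    · simp
  rw [Finset.sum_congr rfl key, Finset.sum_add_distrib, Finset.sum_comm, ← Finset.sum_add_distrib,
    minor]
  refine Finset.sum_congr rfl fun m hm => ?_
  rw [← Finset.sum_filter, ← Finset.sum_smul, ← add_smul]
  congr 1
  rw [← Finset.sum_mul, ← Finset.mul_sum]
  have e : ∀ j ∈ J.filter (· < m), (v⁻¹ * v⁻¹) ^ posIn J j =
      (v⁻¹ * v⁻¹) ^ posIn (J.filter (· < m)) j := by
    intro j hj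
    congr 1
    unfold posIn
    rw [Finset.filter_filter]
    congr 1
    refine Finset.filter_congr fun x _ => ?_
    have := (Finset.mem_filter.1 hj).2
    exact ⟨fun hx => ⟨hx.trans this, hx⟩, fun hx => hx.2⟩
  rw [Finset.sum_congr rfl e, sum_posIn (fun k => (v⁻¹ * v⁻¹) ^ k), mul_neg_geom_sum]
  change _ + (1 - (v⁻¹ * v⁻¹) ^ posIn J m) * _ = _
  have : (v⁻¹ * v⁻¹) ^ posIn J m = ((-v) ^ posIn J m)⁻¹ * ((-v) ^ posIn J m)⁻¹ := by
    rw [← inv_pow, ← mul_pow, inv_neg, neg_mul_neg]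
  rw [this]
  have : (-v) ^ posIn J m ≠ 0 := pow_ne_zero _ hV
  field_simp
  ring

end Minor
end QMat
end
noncomputable section

namespace QMat

/-! ### Minors and tails moved past powers of a generator. -/

section MinorPow

variable {F A ι κ : Type*} [Field F] [Ring A] [Algebra F A] [LinearOrder ι] [LinearOrder κ]
variable {v : F} {z : ι → κ → A}

theorem minor_mul_pow_of_mem (hz : IsQuantumMatrix v z) (hv : v ≠ 0) {i : ι} {rs : List ι}
    (h : ∀ r ∈ rs, i < r) {I : Finset κ} {k : κ} (hk : k ∈ I) (x : ℕ) :
    minor v z rs I * z i k ^ x = v⁻¹ ^ x • (z i k ^ x * minor v z rs I) := by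
  induction x with
  | zero => simp
  | succ x ih =>
    rw [pow_succ, ← mul_assoc, ih, smul_mul_assoc, mul_assoc, minor_mul_of_mem hz hv h hk,
      mul_smul_comm, smul_smul, ← mul_assoc, pow_succ]

theorem minorTail_mul_pow_of_mem (hz : IsQuantumMatrix v z) (hv : v ≠ 0) {i : ι} {rs : List ι}
    (h : ∀ r ∈ rs, i < r) {J : Finset κ} {k : κ} (hk : k ∈ J) (x : ℕ) :
    minorTail v z i rs J k * z i k ^ x =
      (v⁻¹ * v⁻¹) ^ x • (z i k ^ x * minorTail v z i rs J k) := by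
  induction x with
  | zero => simp
  | succ x ih =>
    rw [pow_succ, ← mul_assoc, ih, smul_mul_assoc, mul_assoc, minorTail_mul_of_mem hz hv h hk,
      mul_smul_comm, smul_smul, ← mul_assoc (z i k ^ x), pow_succ, ← pow_succ]

theorem minorTail_mul_pow_of_notMem (hz : IsQuantumMatrix v z) (hv : v ≠ 0) {i : ι}
    {rs : List ι} (h : ∀ r ∈ rs, i < r) {J : Finset κ} {k : κ} (hk : k ∉ J) (x : ℕ) :
    minorTail v z i rs J k * z i k ^ x = v⁻¹ ^ x • (z i k ^ x * minorTail v z i rs J k) := by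
  induction x with
  | zero => simp
  | succ x ih =>
    rw [pow_succ, ← mul_assoc, ih, smul_mul_assoc, mul_assoc, minorTail_mul_of_notMem hz hv h hk,
      mul_smul_comm, smul_smul, ← mul_assoc, pow_succ]

theorem minor_mul_pow_of_notMem (hz : IsQuantumMatrix v z) (hv : v ≠ 0) {i : ι} {rs : List ι}
    (h : ∀ r ∈ rs, i < r) {I : Finset κ} {k : κ} (hk : k ∉ I) (x : ℕ) :
    minor v z rs I * z i k ^ x = z i k ^ x * minor v z rs I +
      ((1 - (v⁻¹ * v⁻¹) ^ x) * ((-v) ^ posIn I k)⁻¹) •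
        (z i k ^ (x - 1) * minorTail v z i rs (insert k I) k) := by
  induction x with
  | zero => simp
  | succ x ih =>
    -- At x = 0 the scalar vanishes, so the truncated exponent x - 1 does no harm.
    have e : (1 - (v⁻¹ * v⁻¹) ^ x) • z i k ^ (x - 1) * z i k =
        (1 - (v⁻¹ * v⁻¹) ^ x) • z i k ^ x := by
      rcases x with _ | x
      · simp
      · rw [Nat.add_sub_cancel, smul_mul_assoc, ← pow_succ]
    have e' : ((1 - (v⁻¹ * v⁻¹) ^ x) * ((-v) ^ posIn I k)⁻¹) •
        (z i k ^ (x - 1) * minorTail v z i rs (insert k I) k) * z i k =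
        (((-v) ^ posIn I k)⁻¹ * (v⁻¹ * v⁻¹) * (1 - (v⁻¹ * v⁻¹) ^ x)) •
          (z i k ^ x * minorTail v z i rs (insert k I) k) := by
      rw [smul_mul_assoc, mul_assoc, minorTail_mul_of_mem hz hv h (Finset.mem_insert_self k I),
        mul_smul_comm, ← mul_assoc, smul_smul]
      calc _ = (((-v) ^ posIn I k)⁻¹ * (v⁻¹ * v⁻¹)) • (((1 - (v⁻¹ * v⁻¹) ^ x) •
            z i k ^ (x - 1) * z i k) * minorTail v z i rs (insert k I) k) := by
            simp only [smul_mul_assoc, smul_smul]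
            congr 1
            ring
        _ = _ := by rw [e, smul_mul_assoc, smul_smul]
    rw [pow_succ, ← mul_assoc, ih, add_mul, e', mul_assoc, minor_mul_of_notMem hz hv h hk,
      mul_add, mul_smul_comm, add_assoc, ← add_smul, ← mul_assoc, Nat.add_sub_cancel]
    congr 2
    ring

/-- Moving the minor creates a multiple 1 - v^(-2x) of the tail and moving the tail itself costs
v^(-2x). These add up to 1, so the tail ends up behind the power with no scalar. -/
theorem expansion_mul_pow (hz : IsQuantumMatrix v z) (hv : v ≠ 0) {i : ι} {rs : List ι}
    (h : ∀ r ∈ rs, i < r) {J : Finset κ} {k : κ} (hk : k ∈ J) (x : ℕ) :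
    ((-v) ^ posIn J k • (z i k * minor v z rs (J.erase k)) + minorTail v z i rs J k) *
        z i k ^ x =
      (-v) ^ posIn J k • (z i k ^ (x + 1) * minor v z rs (J.erase k)) +
        z i k ^ x * minorTail v z i rs J k := by
  have hp : posIn J k = posIn (J.erase k) k := by
    rw [posIn_erase hk k, if_neg (lt_irrefl k), add_zero]
  have hV : (-v) ^ posIn (J.erase k) k ≠ 0 := pow_ne_zero _ (neg_ne_zero.2 hv)
  rw [hp, add_mul, smul_mul_assoc, mul_assoc,
    minor_mul_pow_of_notMem hz hv h (Finset.notMem_erase k J),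
    minorTail_mul_pow_of_mem hz hv h hk, Finset.insert_erase hk,
    mul_add, ← mul_assoc, ← pow_succ', mul_smul_comm, ← mul_assoc, ← pow_succ']
  rcases x with _ | x
  · simp
  · rw [Nat.add_sub_cancel]
    generalize (v⁻¹ * v⁻¹) ^ (x + 1) = c
    match_scalars
    · rfl
    · field_simp
      ring

end MinorPow

/-! ### Specialization to v = q², normalized powers, and ℤ[q]-lattices. -/

theorem q_sq_ne_zero : q ^ 2 ≠ 0 := pow_ne_zero _ q_ne_zero

variable {n : ℕ}

theorem isQuantumMatrix_Z : IsQuantumMatrix (q ^ 2) (Z (n := n)) where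
  row := Z_row
  col := Z_col
  anti := Z_anti
  diag i j s t h h' := by
    rw [Z_diag i j s t h h', zpow_neg]
    rfl

/-- The normalized power `q ^ (c ^ 2) Z_{ij} ^ c`. -/
def zhat (i j : Fin n) (c : ℕ) : OqM n := q ^ (c * c) • Z i j ^ c

/-- Quantum minors of the matrix of generators. -/
abbrev qminor (rs : List (Fin n)) (I : Finset (Fin n)) : OqM n := minor (q ^ 2) Z rs I

/-- Tails of the expansion of the quantum minors of the matrix of generators. -/
abbrev qminorTail (i : Fin n) (rs : List (Fin n)) (J : Finset (Fin n)) (k : Fin n) : OqM n :=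
  minorTail (q ^ 2) Z i rs J k

theorem q_sq_inv_pow (x : ℕ) : ((q ^ 2)⁻¹) ^ x = q ^ (-2 * x : ℤ) := by
  rw [inv_pow, ← pow_mul, ← zpow_natCast, ← zpow_neg]
  push_cast
  congr 1

theorem q_sq_inv_mul_pow (x : ℕ) : ((q ^ 2)⁻¹ * (q ^ 2)⁻¹) ^ x = q ^ (-4 * x : ℤ) := by
  rw [mul_pow, q_sq_inv_pow, ← zpow_add₀ q_ne_zero]
  congr 1
  ring

variable {i : Fin n} {rs : List (Fin n)}

theorem qminor_mul_zhat_of_mem (h : ∀ r ∈ rs, i < r) {I : Finset (Fin n)} {k : Fin n}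
    (hk : k ∈ I) (x : ℕ) :
    qminor rs I * zhat i k x = q ^ (-2 * x : ℤ) • (zhat i k x * qminor rs I) := by
  rw [zhat, mul_smul_comm, minor_mul_pow_of_mem isQuantumMatrix_Z q_sq_ne_zero h hk,
    q_sq_inv_pow, smul_mul_assoc, smul_comm]

theorem qminorTail_mul_zhat_of_notMem (h : ∀ r ∈ rs, i < r) {J : Finset (Fin n)} {k : Fin n}
    (hk : k ∉ J) (x : ℕ) :
    qminorTail i rs J k * zhat i k x = q ^ (-2 * x : ℤ) • (zhat i k x * qminorTail i rs J k) := by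
  rw [zhat, mul_smul_comm, minorTail_mul_pow_of_notMem isQuantumMatrix_Z q_sq_ne_zero h hk,
    q_sq_inv_pow, smul_mul_assoc, smul_comm]

theorem qminor_mul_zhat_of_notMem (h : ∀ r ∈ rs, i < r) {I : Finset (Fin n)} {k : Fin n}
    (hk : k ∉ I) (x : ℕ) :
    qminor rs I * zhat i k x = zhat i k x * qminor rs I +
      (((-q ^ 2) ^ posIn I k)⁻¹ * (q ^ (2 * x - 1 : ℤ) - q ^ (-2 * x - 1 : ℤ))) •
        (zhat i k (x - 1) * qminorTail i rs (insert k I) k) := by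
  rw [zhat, mul_smul_comm, minor_mul_pow_of_notMem isQuantumMatrix_Z q_sq_ne_zero h hk,
    q_sq_inv_mul_pow, smul_add, smul_mul_assoc, zhat, smul_mul_assoc, smul_smul, smul_smul]
  -- For x = 0 the two powers of q in the coefficient cancel. For x > 0 the scalars match because x²
  -- = (x-1)² + (2x-1).
  rcases x with _ | x
  · simp
  · congr 2
    rw [Nat.add_sub_cancel]
    have e1 : q ^ ((x + 1) * (x + 1)) = q ^ (x * x) * q ^ (2 * (x + 1 : ℕ) - 1 : ℤ) := by
      rw [← zpow_natCast, ← zpow_natCast, ← zpow_add₀ q_ne_zero]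
      congr 1
      push_cast
      ring
    have e2 : q ^ (-2 * (x + 1 : ℕ) - 1 : ℤ) =
        q ^ (2 * (x + 1 : ℕ) - 1 : ℤ) * q ^ (-4 * (x + 1 : ℕ) : ℤ) := by
      rw [← zpow_add₀ q_ne_zero]
      congr 1
      ring
    rw [e1, e2]
    ring

theorem expansion_mul_zhat (h : ∀ r ∈ rs, i < r) {J : Finset (Fin n)} {k : Fin n}
    (hk : k ∈ J) (x : ℕ) :
    ((-q ^ 2) ^ posIn J k • (Z i k * qminor rs (J.erase k)) + qminorTail i rs J k) * zhat i k x =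
      ((-q ^ 2) ^ posIn J k * q ^ (-2 * x - 1 : ℤ)) • (zhat i k (x + 1) * qminor rs (J.erase k)) +
        zhat i k x * qminorTail i rs J k := by
  have e1 : q ^ (x * x) = q ^ (-2 * x - 1 : ℤ) * q ^ ((x + 1) * (x + 1)) := by
    rw [← zpow_natCast, ← zpow_natCast, ← zpow_add₀ q_ne_zero]
    congr 1
    push_cast
    ring
  rw [zhat, mul_smul_comm, expansion_mul_pow isQuantumMatrix_Z q_sq_ne_zero h hk, smul_add,
    smul_mul_assoc, zhat, smul_mul_assoc, smul_smul, smul_smul]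
  congr 2
  rw [e1]
  ring

/-- The subring `ℤ[q]` of `K`. -/
def Zq : Subring K := (Polynomial.aeval q : Polynomial ℤ →ₐ[ℤ] K).toRingHom.range

theorem q_mem_Zq : q ∈ Zq := ⟨Polynomial.X, by simp⟩

theorem Zq_smul_mem {T : Submodule Zq (OqM n)} {x : OqM n} (hx : x ∈ T) {c : K} (hc : c ∈ Zq) :
    c • x ∈ T := T.smul_mem (⟨c, hc⟩ : Zq) hx

theorem q_pow_smul_mem {T : Submodule Zq (OqM n)} {x : OqM n} (hx : x ∈ T) (m : ℕ) :
    q ^ m • x ∈ T := Zq_smul_mem hx (pow_mem q_mem_Zq m)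

/-- The multiples `q ^ (-e) T` of a `ℤ[q]`-submodule `T`. -/
def scale (e : ℤ) (T : Submodule Zq (OqM n)) : Submodule Zq (OqM n) where
  carrier := {x | q ^ e • x ∈ T}
  zero_mem' := by simp
  add_mem' {x y} hx hy := by
    simp only [Set.mem_ofPred_eq, smul_add] at *
    exact T.add_mem hx hy
  smul_mem' c x hx := by
    simp only [Set.mem_ofPred_eq] at *
    have := Zq_smul_mem hx c.2
    rwa [smul_comm] at this

theorem mem_scale {e : ℤ} {T : Submodule Zq (OqM n)} {x : OqM n} :
    x ∈ scale e T ↔ q ^ e • x ∈ T := Iff.rfl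

end QMat
end
-- Moving a minor through the monomial of a single row.
noncomputable section

namespace QMat

variable {n : ℕ}

/-- The normalized product of the powers of the generators of row `i` in the columns from `k` on. -/
def rowFrom (i : Fin n) (k : ℕ) (x : Fin n → ℕ) : OqM n :=
  (((List.finRange n).drop k).map fun j => zhat i j (x j)).prod

theorem drop_finRange (k : Fin n) :
    (List.finRange n).drop k = k :: (List.finRange n).drop (k + 1) := by
  rw [List.drop_eq_getElem_cons (by simp)]
  simp

theorem rowFrom_self (i : Fin n) (x : Fin n → ℕ) : rowFrom i n x = 1 := by
  rw [rowFrom, List.drop_eq_nil_of_le (by simp)]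
  rfl

theorem rowFrom_eq (i k : Fin n) (x : Fin n → ℕ) :
    rowFrom i k x = zhat i k (x k) * rowFrom i (k + 1) x := by
  rw [rowFrom, drop_finRange, List.map_cons, List.prod_cons, rowFrom]

theorem mem_drop_finRange {k : ℕ} {j : Fin n} : j ∈ (List.finRange n).drop k ↔ k ≤ j := by
  rw [List.mem_iff_getElem]
  constructor
  · rintro ⟨m, hm, rfl⟩
    simp
  · intro h
    refine ⟨j - k, ?_, ?_⟩
    · rw [List.length_drop, List.length_finRange]
      omega
    · simp [h]

theorem rowFrom_congr (i : Fin n) {k : ℕ} {x y : Fin n → ℕ} (h : ∀ j : Fin n, k ≤ j → x j = y j) :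
    rowFrom i k x = rowFrom i k y := by
  unfold rowFrom
  congr 1
  refine List.map_congr_left fun j hj => ?_
  rw [h j (mem_drop_finRange.1 hj)]

/-- The sum of the entries from position `k` on. -/
def sumFrom (k : ℕ) (x : Fin n → ℕ) : ℕ := ∑ m : Fin n, if k ≤ (m : ℕ) then x m else 0

theorem sumFrom_eq (k : Fin n) (x : Fin n → ℕ) :
    sumFrom k x = x k + sumFrom (k + 1) x := by
  unfold sumFrom
  rw [← Finset.sum_erase_add _ _ (Finset.mem_univ k),
    ← Finset.sum_erase_add (f := fun m : Fin n => if (k : ℕ) + 1 ≤ m then x m else 0) _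
      (Finset.mem_univ k), if_pos le_rfl, if_neg (by omega), add_zero, add_comm]
  congr 1
  refine Finset.sum_congr rfl fun m hm => ?_
  have : (m : ℕ) ≠ k := fun h => Finset.ne_of_mem_erase hm (Fin.ext h)
  split_ifs <;> first | rfl | omega

theorem sumFrom_congr {k : ℕ} {x y : Fin n → ℕ} (h : ∀ j : Fin n, k ≤ j → x j = y j) :
    sumFrom k x = sumFrom k y := by
  refine Finset.sum_congr rfl fun j _ => ?_
  split_ifs with hj
  · exact h j hj
  · rfl

theorem sumFrom_zero (x : Fin n → ℕ) : sumFrom 0 x = ∑ m, x m := by simp [sumFrom]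

theorem sumFrom_self (x : Fin n → ℕ) : sumFrom n x = 0 :=
  Finset.sum_eq_zero fun m _ => if_neg (by omega)

/-- The number of elements of `J` below `k`. -/
def cardBelow (J : Finset (Fin n)) (k : ℕ) : ℕ := (J.filter fun j : Fin n => (j : ℕ) < k).card

theorem cardBelow_coe (J : Finset (Fin n)) (k : Fin n) : cardBelow J k = posIn J k := rfl

theorem cardBelow_succ_of_mem {J : Finset (Fin n)} {k : Fin n} (hk : k ∈ J) :
    cardBelow J (k + 1) = posIn J k + 1 := by
  unfold cardBelow posIn
  rw [← Finset.card_insert_of_notMem (a := k) (by simp)]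
  congr 1
  ext m
  simp only [Finset.mem_filter, Finset.mem_insert, Fin.lt_def, Fin.ext_iff]
  constructor
  · rintro ⟨h1, h2⟩
    by_cases h : (m : ℕ) = k
    · exact Or.inl h
    · exact Or.inr ⟨h1, by omega⟩
  · rintro (h | ⟨h1, h2⟩)
    · rw [Fin.ext h]
      exact ⟨hk, by omega⟩
    · exact ⟨h1, by omega⟩

theorem cardBelow_succ_of_notMem {J : Finset (Fin n)} {k : Fin n} (hk : k ∉ J) :
    cardBelow J (k + 1) = posIn J k := by
  unfold cardBelow posIn
  congr 1
  refine Finset.filter_congr fun m hm => ?_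
  have : (m : ℕ) ≠ k := fun h => hk (Fin.ext h ▸ hm)
  rw [Fin.lt_def]
  omega

/-- The part of the expansion of a quantum minor along its first row that uses the columns from
`k` on. -/
def qminorFrom (i : Fin n) (rs : List (Fin n)) (J : Finset (Fin n)) (k : ℕ) : OqM n :=
  ∑ m ∈ J, if k ≤ (m : ℕ) then (-q ^ 2) ^ posIn J m • (Z i m * qminor rs (J.erase m)) else 0

theorem qminorFrom_zero (i : Fin n) (rs : List (Fin n)) (J : Finset (Fin n)) :
    qminorFrom i rs J 0 = qminor (i :: rs) J := by
  simp [qminorFrom, minor]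

theorem qminorFrom_self (i : Fin n) (rs : List (Fin n)) (J : Finset (Fin n)) :
    qminorFrom i rs J n = 0 := Finset.sum_eq_zero fun m _ => if_neg (by omega)

theorem qminorFrom_succ (i : Fin n) (rs : List (Fin n)) (J : Finset (Fin n)) (k : Fin n) :
    qminorFrom i rs J (k + 1) = qminorTail i rs J k := rfl

theorem qminorFrom_of_mem (i : Fin n) (rs : List (Fin n)) {J : Finset (Fin n)} {k : Fin n}
    (hk : k ∈ J) : qminorFrom i rs J k =
      (-q ^ 2) ^ posIn J k • (Z i k * qminor rs (J.erase k)) + qminorTail i rs J k := by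
  rw [← qminorFrom_succ]
  unfold qminorFrom
  rw [← Finset.sum_erase_add _ _ hk,
    ← Finset.sum_erase_add (f := fun m : Fin n => if (k : ℕ) + 1 ≤ m then
      (-q ^ 2) ^ posIn J m • (Z i m * qminor rs (J.erase m)) else 0) _ hk,
    if_pos le_rfl, if_neg (by omega), add_zero, add_comm]
  congr 1
  refine Finset.sum_congr rfl fun m hm => ?_
  have : (m : ℕ) ≠ k := fun h => Finset.ne_of_mem_erase hm (Fin.ext h)
  have : (k : ℕ) ≤ m ↔ (k : ℕ) + 1 ≤ m := by omega
  simp only [this]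

theorem qminorFrom_of_notMem (i : Fin n) (rs : List (Fin n)) {J : Finset (Fin n)} {k : Fin n}
    (hk : k ∉ J) : qminorFrom i rs J k = qminorTail i rs J k := by
  rw [← qminorFrom_succ]
  refine Finset.sum_congr rfl fun m hm => ?_
  have : (m : ℕ) ≠ k := fun h => hk (Fin.ext h ▸ hm)
  have : (k : ℕ) ≤ m ↔ (k : ℕ) + 1 ≤ m := by omega
  simp only [this]

/-- The indicator of a finite set. -/
def ind (J : Finset (Fin n)) (m : Fin n) : ℕ := if m ∈ J then 1 else 0

theorem ind_erase {J : Finset (Fin n)} {k : Fin n} (hk : k ∈ J) (m : Fin n) :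
    ind J m = ind (J.erase k) m + if m = k then 1 else 0 := by
  unfold ind
  by_cases h : m = k
  · subst h; simp [hk]
  · simp [h]

theorem ind_insert {J : Finset (Fin n)} {k : Fin n} (hk : k ∉ J) (m : Fin n) :
    ind (insert k J) m = ind J m + if m = k then 1 else 0 := by
  unfold ind
  by_cases h : m = k
  · subst h; simp [hk]
  · simp [h]

theorem update_succ (x : Fin n → ℕ) (k m : Fin n) :
    Function.update x k (x k + 1) m = x m + if m = k then 1 else 0 := by
  by_cases h : m = k
  · subst h; simp
  · simp [h]

theorem update_pred {x : Fin n → ℕ} {k : Fin n} (hx : x k ≠ 0) (m : Fin n) :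
    x m = Function.update x k (x k - 1) m + if m = k then 1 else 0 := by
  by_cases h : m = k
  · subst h; simp; omega
  · simp [h]

theorem neg_one_pow_smul_mem {T : Submodule Zq (OqM n)} {x : OqM n} (hx : x ∈ T) (m : ℕ) :
    (-1 : K) ^ m • x ∈ T :=
  Zq_smul_mem hx (pow_mem (neg_mem (one_mem _)) m)

theorem neg_q_sq_pow (m : ℕ) : (-q ^ 2 : K) ^ m = (-1) ^ m * q ^ (2 * m : ℤ) := by
  rw [neg_pow, ← pow_mul, ← zpow_natCast q]
  push_cast
  rfl

theorem neg_q_sq_pow_inv (m : ℕ) : ((-q ^ 2 : K) ^ m)⁻¹ = (-1) ^ m * q ^ (-2 * m : ℤ) := by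
  rw [neg_q_sq_pow, mul_inv, ← inv_pow, ← zpow_neg]
  congr 2
  norm_num

theorem q_zpow_smul_mem {T : Submodule Zq (OqM n)} {x : OqM n} {a b : ℤ} (h : a ≤ b)
    (hx : q ^ a • x ∈ T) : q ^ b • x ∈ T := by
  have := q_pow_smul_mem hx (b - a).toNat
  rwa [smul_smul, ← zpow_natCast, ← zpow_add₀ q_ne_zero, Int.toNat_of_nonneg (by omega),
    sub_add_cancel] at this

theorem sum_update_succ (x : Fin n → ℕ) (k : Fin n) :
    ∑ m, Function.update x k (x k + 1) m = ∑ m, x m + 1 := by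
  simp only [update_succ, Finset.sum_add_distrib, Finset.sum_ite_eq', Finset.mem_univ, if_true]

theorem sum_update_pred {x : Fin n → ℕ} {k : Fin n} (hx : x k ≠ 0) :
    ∑ m, x m = ∑ m, Function.update x k (x k - 1) m + 1 := by
  rw [Finset.sum_congr rfl fun m _ => update_pred hx m]
  simp only [Finset.sum_add_distrib, Finset.sum_ite_eq', Finset.mem_univ, if_true]

variable {i : Fin n} {rs : List (Fin n)}

/-- An integrality bound, by induction on the number of columns still to be crossed. Column k either
keeps its exponent or exchanges one unit between the row exponent and the column set, so y + ind J'
is preserved. The value of N distinguishes a partial expansion that still contributes a generator of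
row i from a minor of the lower rows only; each of the two claims at k uses both at k + 1. The term
-2 · `cardBelow` in the exponent absorbs the powers of q² in the expansion coefficients, all of
which are at least that large from column k on. -/
theorem row_step (h : ∀ r ∈ rs, i < r) (Y : OqM n) (T : Submodule Zq (OqM n)) (N d : ℕ) :
    ∀ k : ℕ, k + d = n → ∀ (P : OqM n) (x : Fin n → ℕ) (J : Finset (Fin n)),
    (∀ (y : Fin n → ℕ) (J' : Finset (Fin n)), (∀ m, y m + ind J' m = x m + ind J m) →
        ∑ m, y m = N → (∀ m : Fin n, (m : ℕ) < k → y m = x m) →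
        P * (rowFrom i k y * (qminor rs J' * Y)) ∈ T) →
    (N = ∑ m, x m + 1 → q ^ (2 * sumFrom k x + 1 - 2 * cardBelow J k : ℤ) •
        (P * (qminorFrom i rs J k * (rowFrom i k x * Y))) ∈ T) ∧
    (N = ∑ m, x m → q ^ (2 * sumFrom k x : ℤ) •
        (P * (qminor rs J * (rowFrom i k x * Y))) ∈ T) := by
  induction d with
  | zero =>
    intro k hk P x J H
    obtain rfl : k = n := by omega
    constructor
    · intro _
      simp [qminorFrom_self]
    · intro hN
      simpa [rowFrom_self, sumFrom_self] using H x J (fun _ => rfl) hN.symm (fun _ _ => rfl)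
  | succ d ih =>
    intro k0 hk P x J H
    obtain ⟨k, rfl⟩ : ∃ k : Fin n, (k : ℕ) = k0 := ⟨⟨k0, by omega⟩, rfl⟩
    have ih : ∀ (x' : Fin n → ℕ) (J1 : Finset (Fin n)), (∀ j, j ≠ k → x' j = x j) →
        (∀ m, x' m + ind J1 m = x m + ind J m) →
        (N = ∑ m, x' m + 1 → q ^ (2 * sumFrom (k + 1) x + 1 - 2 * cardBelow J1 (k + 1) : ℤ) •
          (P * (zhat i k (x' k) * (qminorFrom i rs J1 (k + 1) *
            (rowFrom i (k + 1) x * Y)))) ∈ T) ∧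
        (N = ∑ m, x' m → q ^ (2 * sumFrom (k + 1) x : ℤ) •
          (P * (zhat i k (x' k) * (qminor rs J1 * (rowFrom i (k + 1) x * Y)))) ∈ T) := by
      intro x' J1 hx' hJ
      have hx'' : ∀ j : Fin n, (k : ℕ) + 1 ≤ j → x' j = x j := fun j hj =>
        hx' j (by rintro rfl; omega)
      -- The finished power of column k is absorbed into the left factor P. This is why P varies in
      -- the induction.
      have := ih (k + 1) (by omega) (P * zhat i k (x' k)) x' J1 (fun y J' h1 h2 h3 => by
        have hyk : y k = x' k := h3 k (by omega)
        have := H y J' (fun m => (h1 m).trans (hJ m)) h2 (fun m hm => by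
          rw [h3 m (by omega), hx' m (by rintro rfl; omega)])
        rw [rowFrom_eq i k y, hyk] at this
        simpa only [mul_assoc] using this)
      rw [sumFrom_congr hx'', rowFrom_congr i hx''] at this
      simpa only [mul_assoc] using this
    constructor
    · intro hN
      by_cases hkJ : k ∈ J
      · have e1 : qminorFrom i rs J k * (rowFrom i k x * Y) =
            ((-q ^ 2) ^ posIn J k * q ^ (-2 * x k - 1 : ℤ)) •
              (zhat i k (x k + 1) * (qminor rs (J.erase k) * (rowFrom i (k + 1) x * Y))) +
            zhat i k (x k) * (qminorFrom i rs J (k + 1) * (rowFrom i (k + 1) x * Y)) := by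
          rw [rowFrom_eq, mul_assoc (zhat _ _ _), ← mul_assoc, qminorFrom_of_mem i rs hkJ,
            expansion_mul_zhat h hkJ, qminorFrom_succ, add_mul]
          simp only [smul_mul_assoc, mul_assoc]
        rw [e1, mul_add, smul_add]
        refine T.add_mem ?_ ?_
        · have := (ih (Function.update x k (x k + 1)) (J.erase k)
            (fun j hj => Function.update_of_ne hj _ _)
            (fun m => by rw [update_succ, ind_erase hkJ m]; ring)).2
            (by rw [sum_update_succ, hN])
          rw [Function.update_self] at this
          have := neg_one_pow_smul_mem this (posIn J k)
          rw [mul_smul_comm, smul_smul]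
          rw [smul_smul] at this
          convert this using 2
          rw [neg_q_sq_pow, sumFrom_eq, cardBelow_coe, mul_assoc ((-1) ^ _), mul_left_comm,
            ← zpow_add₀ q_ne_zero, ← zpow_add₀ q_ne_zero]
          congr 2
          push_cast
          ring
        -- Here the exponent has a surplus of 2 x_k + 2. This positive surplus is what later places
        -- non-leading terms in qT.
        · have := (ih x J (fun _ _ => rfl) (fun _ => rfl)).1 hN
          refine q_zpow_smul_mem ?_ this
          rw [sumFrom_eq, cardBelow_coe, cardBelow_succ_of_mem hkJ]
          push_cast
          omega
      · have e1 : qminorFrom i rs J k * (rowFrom i k x * Y) = q ^ (-2 * x k : ℤ) •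
            (zhat i k (x k) * (qminorFrom i rs J (k + 1) * (rowFrom i (k + 1) x * Y))) := by
          rw [rowFrom_eq, mul_assoc (zhat _ _ _), ← mul_assoc, qminorFrom_of_notMem i rs hkJ,
            qminorTail_mul_zhat_of_notMem h hkJ, qminorFrom_succ]
          simp only [smul_mul_assoc, mul_assoc]
        have := (ih x J (fun _ _ => rfl) (fun _ => rfl)).1 hN
        rw [e1, mul_smul_comm, smul_smul, ← zpow_add₀ q_ne_zero]
        convert this using 3
        rw [sumFrom_eq, cardBelow_coe, cardBelow_succ_of_notMem hkJ]
        push_cast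
        ring
    · intro hN
      by_cases hkJ : k ∈ J
      · have e1 : qminor rs J * (rowFrom i k x * Y) = q ^ (-2 * x k : ℤ) •
            (zhat i k (x k) * (qminor rs J * (rowFrom i (k + 1) x * Y))) := by
          rw [rowFrom_eq, mul_assoc (zhat _ _ _), ← mul_assoc, qminor_mul_zhat_of_mem h hkJ]
          simp only [smul_mul_assoc, mul_assoc]
        have := (ih x J (fun _ _ => rfl) (fun _ => rfl)).2 hN
        rw [e1, mul_smul_comm, smul_smul, ← zpow_add₀ q_ne_zero]
        convert this using 3
        rw [sumFrom_eq]
        push_cast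
        ring
      · have e1 : qminor rs J * (rowFrom i k x * Y) =
            zhat i k (x k) * (qminor rs J * (rowFrom i (k + 1) x * Y)) +
            (((-q ^ 2) ^ posIn J k)⁻¹ * (q ^ (2 * x k - 1 : ℤ) - q ^ (-2 * x k - 1 : ℤ))) •
              (zhat i k (x k - 1) *
                (qminorFrom i rs (insert k J) (k + 1) * (rowFrom i (k + 1) x * Y))) := by
          rw [rowFrom_eq, mul_assoc (zhat _ _ _), ← mul_assoc, qminor_mul_zhat_of_notMem h hkJ,
            qminorFrom_succ, add_mul]
          simp only [smul_mul_assoc, mul_assoc]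
        rw [e1, mul_add, smul_add]
        refine T.add_mem ?_ ?_
        · have := (ih x J (fun _ _ => rfl) (fun _ => rfl)).2 hN
          refine q_zpow_smul_mem ?_ this
          rw [sumFrom_eq]
          push_cast
          omega
        -- The correction has coefficient 0 when x k = 0. Otherwise one unit moves from the exponent
        -- of column k into the column set.
        · by_cases hx : x k = 0
          · simp [hx]
          have := (ih (Function.update x k (x k - 1)) (insert k J)
            (fun j hj => Function.update_of_ne hj _ _)
            (fun m => by rw [update_pred hx m, ind_insert hkJ m]; ring)).1
            (by rw [hN, ← sum_update_pred hx])
          rw [Function.update_self, cardBelow_succ_of_mem (Finset.mem_insert_self k J),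
            posIn_insert hkJ, if_neg (lt_irrefl k), add_zero] at this
          have := neg_one_pow_smul_mem this (posIn J k)
          rw [smul_smul] at this
          rw [mul_smul_comm, smul_smul, neg_q_sq_pow_inv, mul_sub, mul_sub, sub_smul]
          -- Used for c = 2 x_k - 1 and c = -2 x_k - 1, where the surplus exponent c + 2 x_k + 1
          -- equals 4 x_k and 0.
          have e2 : ∀ c : ℤ, q ^ (2 * sumFrom k x : ℤ) *
              ((-1) ^ posIn J k * q ^ (-2 * posIn J k : ℤ) * q ^ c) =
              q ^ (c + 2 * x k + 1) * ((-1) ^ posIn J k *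
              q ^ (2 * sumFrom (k + 1) x + 1 - 2 * (posIn J k + 1 : ℕ) : ℤ)) := by
            intro c
            rw [mul_assoc ((-1) ^ posIn J k), mul_left_comm, mul_left_comm (q ^ (c + _ + _)),
              ← zpow_add₀ q_ne_zero, ← zpow_add₀ q_ne_zero, ← zpow_add₀ q_ne_zero, sumFrom_eq]
            congr 2
            push_cast
            ring
          rw [e2, e2, mul_smul (q ^ _), mul_smul (q ^ _)]
          refine T.sub_mem ?_ ?_
          · exact q_zpow_smul_mem (a := 0) (by omega) (by simpa using this)
          · exact q_zpow_smul_mem (a := 0) (by omega) (by simpa using this)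

end QMat
end
-- Moving a minor through the monomials of several rows.
noncomputable section

namespace QMat

variable {n : ℕ}

/-- The product over a list of rows of the normalized products of powers of the generators. -/
def rowsMono (l : List (Fin n)) (C : Matrix (Fin n) (Fin n) ℕ) : OqM n :=
  (l.map fun i => rowFrom i 0 (C i)).prod

theorem rowsMono_cons (i : Fin n) (l : List (Fin n)) (C : Matrix (Fin n) (Fin n) ℕ) :
    rowsMono (i :: l) C = rowFrom i 0 (C i) * rowsMono l C := by
  simp [rowsMono]

theorem rowsMono_congr {l : List (Fin n)} {C D : Matrix (Fin n) (Fin n) ℕ}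
    (h : ∀ i ∈ l, C i = D i) : rowsMono l C = rowsMono l D := by
  unfold rowsMono
  congr 1
  exact List.map_congr_left fun j hj => by rw [h j hj]

/-- The exponent of `q` that arises when a quantum minor with the given rows is moved past a
normalized monomial. -/
def shiftExp (l : List (Fin n)) (B : Matrix (Fin n) (Fin n) ℕ) : ℕ :=
  (l.map fun i => 2 * ∑ j, B i j + 1).sum

theorem shiftExp_congr {l : List (Fin n)} {C D : Matrix (Fin n) (Fin n) ℕ}
    (h : ∀ i ∈ l, C i = D i) : shiftExp l C = shiftExp l D := by
  unfold shiftExp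
  congr 1
  exact List.map_congr_left fun j hj => by rw [h j hj]

theorem sum_update_row (B : Matrix (Fin n) (Fin n) ℕ) (i : Fin n) (y : Fin n → ℕ) (j : Fin n) :
    ∑ r, B.updateRow i y r j + B i j = ∑ r, B r j + y j := by
  rw [← Finset.sum_erase_add _ _ (Finset.mem_univ i),
    ← Finset.sum_erase_add (f := fun r => B r j) _ (Finset.mem_univ i), Matrix.updateRow_self,
    Finset.sum_congr rfl (g := fun r => B r j) fun r hr => by
      rw [Matrix.updateRow_ne (Finset.ne_of_mem_erase hr)]]
  ring

/-- The matrices whose monomials can occur in the product of the quantum minor with rows `rs` and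
columns `J` and the monomial of `B`. -/
def Reaches (rs : List (Fin n)) (J : Finset (Fin n)) (B C : Matrix (Fin n) (Fin n) ℕ) : Prop :=
  (∀ j, ∑ i, C i j = ∑ i, B i j + ind J j) ∧ (∀ i ∈ rs, ∑ j, C i j = ∑ j, B i j + 1) ∧
    ∀ i, i ∉ rs → C i = B i

theorem Reaches.cons {rs : List (Fin n)} {i : Fin n} {J J' : Finset (Fin n)}
    {B C : Matrix (Fin n) (Fin n) ℕ} {y : Fin n → ℕ} (hi : i ∉ rs)
    (hy : ∀ m, y m + ind J' m = B i m + ind J m) (hs : ∑ m, y m = ∑ m, B i m + 1)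
    (h : Reaches rs J' (B.updateRow i y) C) : Reaches (i :: rs) J B C ∧ C i = y := by
  obtain ⟨h1, h2, h3⟩ := h
  have hCi : C i = y := by rw [h3 i hi, Matrix.updateRow_self]
  refine ⟨⟨fun j => ?_, fun r hr => ?_, fun r hr => ?_⟩, hCi⟩
  · have e1 := h1 j
    have e2 := sum_update_row B i y j
    have e3 := hy j
    omega
  · rcases List.mem_cons.1 hr with rfl | hr
    · rw [hCi, hs]
    · rw [h2 r hr, Matrix.updateRow_ne (ne_of_mem_of_not_mem hr hi)]
  · rw [List.mem_cons, not_or] at hr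
    rw [h3 r hr.2, Matrix.updateRow_ne hr.1]

/-- Row by row application of `row_step`. The rows `us` stand to the right of those of the minor and
are never crossed. -/
theorem qminor_mul_rowsMono_mem (us : List (Fin n)) (T : Submodule Zq (OqM n)) :
    ∀ (rs : List (Fin n)), rs.Pairwise (· < ·) → (rs ++ us).Nodup →
    ∀ (J : Finset (Fin n)) (B : Matrix (Fin n) (Fin n) ℕ) (P : OqM n),
    (∀ C, Reaches rs J B C → P * rowsMono (rs ++ us) C ∈ T) →
    q ^ shiftExp rs B • (P * (qminor rs J * rowsMono (rs ++ us) B)) ∈ T := by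
  intro rs
  induction rs with
  | nil =>
    intro _ _ J B P H
    by_cases hJ : J = ∅
    · subst hJ
      simpa [minor, shiftExp] using H B ⟨fun j => by simp [ind], by simp, fun _ _ => rfl⟩
    · simp [minor, hJ]
  | cons i rs ih =>
    intro hs hnd J B P H
    rw [List.pairwise_cons] at hs
    rw [List.cons_append, List.nodup_cons, List.mem_append, not_or] at hnd
    have hB : ∀ y : Fin n → ℕ, ∀ r ∈ rs ++ us, (B.updateRow i y) r = B r := by
      intro y r hr
      refine Matrix.updateRow_ne ?_
      rintro rfl
      exact (List.mem_append.1 hr).elim hnd.1.1 hnd.1.2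
    -- Scaling T reserves the power of q that the remaining rows `rs` will need. The finished row i
    -- joins P in the induction hypothesis.
    have key := (row_step hs.1 (rowsMono (rs ++ us) B) (scale (shiftExp rs B) T)
      (∑ m, B i m + 1) n 0 (by omega) P (B i) J (fun y J' h1 h2 _ => by
        rw [mem_scale, zpow_natCast]
        have := ih hs.2 hnd.2 J' (B.updateRow i y) (P * rowFrom i 0 y) (fun C hC => by
          obtain ⟨hC', hCi⟩ := hC.cons hnd.1.1 h1 h2
          have := H C hC'
          rwa [List.cons_append, rowsMono_cons, hCi, ← mul_assoc] at this)
        rwa [rowsMono_congr (hB y), shiftExp_congr fun r hr => hB y r (by simp [hr]),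
          mul_assoc] at this)).1 rfl
    rw [mem_scale, sumFrom_zero, qminorFrom_zero, smul_smul, ← zpow_add₀ q_ne_zero] at key
    rw [List.cons_append, rowsMono_cons, ← zpow_natCast]
    convert key using 3
    simp [shiftExp, cardBelow]
    ring

/-- Supplies the membership hypothesis that `row_step_lead` requires of every possible outcome in
row i. -/
theorem qminor_row_mem {us : List (Fin n)} {T : Submodule Zq (OqM n)} {i : Fin n}
    {rs : List (Fin n)} (hs : (i :: rs).Pairwise (· < ·)) (hnd : (i :: rs ++ us).Nodup)
    {J : Finset (Fin n)} {B : Matrix (Fin n) (Fin n) ℕ} {P : OqM n}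
    (H : ∀ C, Reaches (i :: rs) J B C → P * rowsMono (i :: rs ++ us) C ∈ T)
    {y : Fin n → ℕ} {J' : Finset (Fin n)} (h1 : ∀ m, y m + ind J' m = B i m + ind J m)
    (h2 : ∑ m, y m = ∑ m, B i m + 1) :
    P * (rowFrom i 0 y * (qminor rs J' * rowsMono (rs ++ us) B)) ∈ scale (shiftExp rs B) T := by
  rw [List.pairwise_cons] at hs
  rw [List.cons_append, List.nodup_cons, List.mem_append, not_or] at hnd
  have hB : ∀ r ∈ rs ++ us, (B.updateRow i y) r = B r := by
    intro r hr
    refine Matrix.updateRow_ne ?_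
    rintro rfl
    exact (List.mem_append.1 hr).elim hnd.1.1 hnd.1.2
  rw [mem_scale, zpow_natCast]
  have := qminor_mul_rowsMono_mem us T rs hs.2 hnd.2 J' (B.updateRow i y)
    (P * rowFrom i 0 y) (fun C hC => by
      obtain ⟨hC', hCi⟩ := hC.cons hnd.1.1 h1 h2
      have := H C hC'
      rwa [List.cons_append, rowsMono_cons, hCi, ← mul_assoc] at this)
  rwa [rowsMono_congr hB, shiftExp_congr fun r hr => hB r (by simp [hr]), mul_assoc] at this

/-! ### The leading term of a minor times a monomial. -/

variable {i : Fin n} {rs : List (Fin n)}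

theorem qminor_mul_rowFrom (h : ∀ r ∈ rs, i < r) {I : Finset (Fin n)} (x : Fin n → ℕ) (d : ℕ) :
    ∀ k : ℕ, k + d = n → (∀ m : Fin n, k ≤ m → m ∈ I) →
      q ^ (2 * sumFrom k x : ℤ) • (qminor rs I * rowFrom i k x) =
        rowFrom i k x * qminor rs I := by
  induction d with
  | zero =>
    intro k hk _
    obtain rfl : k = n := by omega
    simp [rowFrom_self, sumFrom_self]
  | succ d ih =>
    intro k0 hk hI
    obtain ⟨k, rfl⟩ : ∃ k : Fin n, (k : ℕ) = k0 := ⟨⟨k0, by omega⟩, rfl⟩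
    have ih := ih (k + 1) (by omega) (fun m hm => hI m (by omega))
    rw [rowFrom_eq, ← mul_assoc, qminor_mul_zhat_of_mem h (hI k le_rfl), mul_assoc, ← ih,
      smul_mul_assoc, smul_smul, ← zpow_add₀ q_ne_zero, mul_assoc, mul_smul_comm]
    congr 2
    rw [sumFrom_eq]
    push_cast
    ring

/-- For J consisting of all columns from j0 on, the columns before j0 contribute only powers of q.
At j0 the expansion coefficient is 1 and the remaining minor keeps all later columns, so it crosses
them without correction and gives the leading monomial with exponent 0. The rest of the expansion is
bounded by `row_step` with exponent to spare and falls into qT, which is `scale (-1) T`. -/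
theorem row_step_lead (h : ∀ r ∈ rs, i < r) (Y : OqM n) (T : Submodule Zq (OqM n)) (N : ℕ)
    (j0 : Fin n) (J : Finset (Fin n)) (hJ : ∀ m, m ∈ J ↔ j0 ≤ m) (d : ℕ) :
    ∀ k : ℕ, k + d = j0 → ∀ (P : OqM n) (x : Fin n → ℕ),
    (∀ (y : Fin n → ℕ) (J' : Finset (Fin n)), (∀ m, y m + ind J' m = x m + ind J m) →
        ∑ m, y m = N → (∀ m : Fin n, (m : ℕ) < k → y m = x m) →
        P * (rowFrom i k y * (qminor rs J' * Y)) ∈ T) →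
    N = ∑ m, x m + 1 →
      q ^ (2 * sumFrom k x + 1 : ℤ) • (P * (qminorFrom i rs J k * (rowFrom i k x * Y))) -
        P * (rowFrom i k (Function.update x j0 (x j0 + 1)) * (qminor rs (J.erase j0) * Y)) ∈
          scale (-1) T := by
  induction d with
  | zero =>
    intro k0 hk P x H hN
    obtain rfl : k0 = j0 := by omega
    have hj0 : j0 ∈ J := (hJ j0).2 le_rfl
    have hp : posIn J j0 = 0 := by
      rw [posIn, Finset.card_eq_zero, Finset.filter_eq_empty_iff]
      exact fun m hm => not_lt.2 ((hJ m).1 hm)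
    have hrow : rowFrom i (j0 + 1) (Function.update x j0 (x j0 + 1)) = rowFrom i (j0 + 1) x :=
      rowFrom_congr i fun j hj => Function.update_of_ne (by rintro rfl; omega) _ _
    have e1 : qminorFrom i rs J j0 * (rowFrom i j0 x * Y) =
        q ^ (-2 * x j0 - 1 : ℤ) •
          (zhat i j0 (x j0 + 1) * (qminor rs (J.erase j0) * (rowFrom i (j0 + 1) x * Y))) +
        zhat i j0 (x j0) * (qminorFrom i rs J (j0 + 1) * (rowFrom i (j0 + 1) x * Y)) := by
      rw [rowFrom_eq, mul_assoc (zhat _ _ _), ← mul_assoc, qminorFrom_of_mem i rs hj0,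
        expansion_mul_zhat h hj0, qminorFrom_succ, add_mul, hp, pow_zero, one_mul]
      simp only [smul_mul_assoc, mul_assoc]
    have e2 : rowFrom i j0 (Function.update x j0 (x j0 + 1)) * (qminor rs (J.erase j0) * Y) =
        q ^ (2 * sumFrom (j0 + 1) x : ℤ) •
          (zhat i j0 (x j0 + 1) * (qminor rs (J.erase j0) * (rowFrom i (j0 + 1) x * Y))) := by
      rw [rowFrom_eq, Function.update_self, hrow, mul_assoc, ← mul_assoc (rowFrom _ _ _),
        ← qminor_mul_rowFrom h x (n - (j0 + 1)) (j0 + 1) (by omega) (fun m hm =>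
          Finset.mem_erase.2 ⟨by rintro rfl; omega, (hJ m).2 (Fin.le_def.2 (by omega))⟩)]
      simp only [smul_mul_assoc, mul_smul_comm, mul_assoc]
    have e3 : (2 * sumFrom j0 x + 1 : ℤ) + (-2 * x j0 - 1) = 2 * sumFrom (j0 + 1) x := by
      rw [sumFrom_eq]
      push_cast
      ring
    rw [e1, e2, mul_add, smul_add, mul_smul_comm, smul_smul, ← zpow_add₀ q_ne_zero, e3,
      mul_smul_comm, add_sub_cancel_left, mem_scale, smul_smul, ← zpow_add₀ q_ne_zero]
    have := (row_step h Y T N (n - (j0 + 1)) (j0 + 1) (by omega) (P * zhat i j0 (x j0)) x J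
      (fun y J' h1 h2 h3 => by
        have := H y J' h1 h2 (fun m hm => h3 m (by omega))
        rw [rowFrom_eq i j0 y, h3 j0 (by omega)] at this
        simpa only [mul_assoc] using this)).1 hN
    rw [mul_assoc] at this
    -- Even after multiplication by q⁻¹ a surplus of 2 x_{j0} + 1 remains, since `cardBelow` has
    -- increased to 1 past column j0.
    refine q_zpow_smul_mem ?_ this
    rw [cardBelow_succ_of_mem hj0, hp, sumFrom_eq]
    push_cast
    omega
  | succ d ih =>
    intro k0 hk P x H hN
    obtain ⟨k, rfl⟩ : ∃ k : Fin n, (k : ℕ) = k0 := ⟨⟨k0, by omega⟩, rfl⟩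
    have hkj : k ≠ j0 := by rintro rfl; omega
    have hkJ : k ∉ J := fun hk' => by
      have := Fin.le_def.1 ((hJ k).1 hk')
      omega
    have e1 : qminorFrom i rs J k * (rowFrom i k x * Y) = q ^ (-2 * x k : ℤ) •
        (zhat i k (x k) * (qminorFrom i rs J (k + 1) * (rowFrom i (k + 1) x * Y))) := by
      rw [rowFrom_eq, mul_assoc (zhat _ _ _), ← mul_assoc, qminorFrom_of_notMem i rs hkJ,
        qminorTail_mul_zhat_of_notMem h hkJ, qminorFrom_succ]
      simp only [smul_mul_assoc, mul_assoc]
    have := ih (k + 1) (by omega) (P * zhat i k (x k)) x (fun y J' h1 h2 h3 => by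
        have := H y J' h1 h2 (fun m hm => h3 m (by omega))
        rw [rowFrom_eq i k y, h3 k (by omega)] at this
        simpa only [mul_assoc] using this) hN
    rw [e1, rowFrom_eq i k (Function.update x j0 (x j0 + 1)), Function.update_of_ne hkj,
      mul_smul_comm, smul_smul, ← zpow_add₀ q_ne_zero]
    simp only [mul_assoc] at this ⊢
    convert this using 4
    rw [sumFrom_eq]
    push_cast
    ring

/-- The rows `p, …, t - 1`. -/
def rowRange (n t p : ℕ) : List (Fin n) := ((List.finRange n).take t).drop p

/-- The columns from `k` on. -/
def colsFrom (n k : ℕ) : Finset (Fin n) := Finset.univ.filter fun j => k ≤ (j : ℕ)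

/-- The matrix with entries `1` in the positions `(i, n - t + i)`, `p ≤ i < t`. -/
def partialDiag (n t p : ℕ) : Matrix (Fin n) (Fin n) ℕ :=
  fun i j => if p ≤ (i : ℕ) ∧ (i : ℕ) < t ∧ (j : ℕ) = n - t + i then 1 else 0

theorem rowRange_eq {t p : ℕ} (hp : p < t) (ht : t ≤ n) :
    rowRange n t p = ⟨p, by omega⟩ :: rowRange n t (p + 1) := by
  unfold rowRange
  rw [List.drop_eq_getElem_cons (by simp; omega)]
  simp

theorem rowRange_self (t : ℕ) : rowRange n t t = [] :=
  List.drop_eq_nil_of_le (by simp)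

theorem mem_rowRange {t p : ℕ} {i : Fin n} : i ∈ rowRange n t p ↔ p ≤ i ∧ (i : ℕ) < t := by
  rw [rowRange, List.mem_iff_getElem]
  constructor
  · rintro ⟨m, hm, rfl⟩
    simp only [List.length_drop, List.length_take, List.length_finRange] at hm
    simp
    omega
  · rintro ⟨h1, h2⟩
    refine ⟨i - p, ?_, ?_⟩
    · simp only [List.length_drop, List.length_take, List.length_finRange]
      omega
    · simp [h1]

/-- In each row p the leading term uses the leftmost available column n - t + p, and the remaining
column set is again a final segment. Hence only the identity permutation survives modulo qT. -/
theorem qminor_mul_rowsMono_lead (t : ℕ) (ht : t ≤ n) (us : List (Fin n))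
    (T : Submodule Zq (OqM n)) (d : ℕ) :
    ∀ p : ℕ, p + d = t → (rowRange n t p).Pairwise (· < ·) → (rowRange n t p ++ us).Nodup →
    ∀ (B : Matrix (Fin n) (Fin n) ℕ) (P : OqM n),
    (∀ C, Reaches (rowRange n t p) (colsFrom n (n - t + p)) B C →
      P * rowsMono (rowRange n t p ++ us) C ∈ T) →
    q ^ shiftExp (rowRange n t p) B •
      (P * (qminor (rowRange n t p) (colsFrom n (n - t + p)) * rowsMono (rowRange n t p ++ us) B)) -
      P * rowsMono (rowRange n t p ++ us) (B + partialDiag n t p) ∈ scale (-1) T := by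
  induction d with
  | zero =>
    intro p hp _ _ B P _
    obtain rfl : p = t := by omega
    have e1 : colsFrom n (n - p + p) = ∅ := by
      rw [colsFrom, Finset.filter_eq_empty_iff]
      intro m _
      omega
    have e2 : partialDiag n p p = 0 := by
      ext i j
      simp only [partialDiag, Matrix.zero_apply]
      rw [if_neg (by omega)]
    rw [rowRange_self, e1, e2, add_zero]
    simp [minor, shiftExp]
  | succ d ih =>
    intro p hp hs hnd B P H
    have hpt : p < t := by omega
    have ih := ih (p + 1) (by omega)
    obtain ⟨i, hi⟩ : ∃ i : Fin n, (i : ℕ) = p := ⟨⟨p, by omega⟩, rfl⟩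
    obtain ⟨j0, hj0⟩ : ∃ j : Fin n, (j : ℕ) = n - t + p := ⟨⟨n - t + p, by omega⟩, rfl⟩
    have hrr : rowRange n t p = i :: rowRange n t (p + 1) := by
      rw [rowRange_eq hpt ht]
      congr 1
      exact Fin.ext hi.symm
    rw [hrr] at hs hnd H ⊢
    set rs := rowRange n t (p + 1) with hrs
    set J := colsFrom n (n - t + p) with hJdef
    have hJ : ∀ m, m ∈ J ↔ j0 ≤ m := fun m => by
      simp [hJdef, colsFrom, Fin.le_def, hj0]
    have hJ' : J.erase j0 = colsFrom n (n - t + (p + 1)) := by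
      ext m
      rw [Finset.mem_erase, hJ, Fin.le_def, ne_eq, Fin.ext_iff]
      simp only [colsFrom, Finset.mem_filter, Finset.mem_univ, true_and]
      omega
    have lead := row_step_lead (List.pairwise_cons.1 hs).1 (rowsMono (rs ++ us) B)
      (scale (shiftExp rs B) T) (∑ m, B i m + 1) j0 J hJ j0 0 (by omega) P (B i)
      (fun y J' h1 h2 _ => qminor_row_mem hs hnd H h1 h2) rfl
    rw [mem_scale, smul_sub, mem_scale, smul_sub, sumFrom_zero, qminorFrom_zero, hJ'] at lead
    have hnd' := hnd
    rw [List.cons_append, List.nodup_cons, List.mem_append, not_or] at hnd'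
    set y := Function.update (B i) j0 (B i j0 + 1) with hy
    have hB : ∀ r ∈ rs ++ us, (B.updateRow i y) r = B r := by
      intro r hr
      refine Matrix.updateRow_ne ?_
      rintro rfl
      exact (List.mem_append.1 hr).elim hnd'.1.1 hnd'.1.2
    have next := ih (List.pairwise_cons.1 hs).2 hnd'.2 (B.updateRow i y)
      (P * rowFrom i 0 y) (fun C hC => by
        obtain ⟨hC', hCi⟩ := hC.cons (J := J) hnd'.1.1 (fun m => by
          rw [hy, update_succ, ← hJ', ind_erase ((hJ j0).2 le_rfl) m]
          ring) (by rw [hy, sum_update_succ])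
        have := H C hC'
        rwa [List.cons_append, rowsMono_cons, hCi, ← mul_assoc] at this)
    have hE : B.updateRow i y + partialDiag n t (p + 1) = B + partialDiag n t p := by
      ext r m
      by_cases hr : r = i
      · subst hr
        rw [Matrix.add_apply, Matrix.add_apply, Matrix.updateRow_self, hy, update_succ]
        simp only [partialDiag, Fin.ext_iff, hj0, hi]
        split_ifs <;> omega
      · rw [Matrix.add_apply, Matrix.add_apply, Matrix.updateRow_ne hr]
        have : (r : ℕ) ≠ p := fun h => hr (Fin.ext (h.trans hi.symm))
        simp only [partialDiag]
        congr 1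
        split_ifs <;> omega
    have hEi : (B + partialDiag n t p) i = y := by
      ext m
      rw [hy, update_succ, Matrix.add_apply]
      simp only [partialDiag, Fin.ext_iff, hj0, hi]
      congr 1
      split_ifs <;> omega
    rw [rowsMono_congr hB, shiftExp_congr fun r hr => hB r (by simp [hr]), hE, mem_scale,
      smul_sub] at next
    rw [List.cons_append, rowsMono_cons, rowsMono_cons, hEi, mem_scale, smul_sub]
    -- The difference telescopes through the product in which only row i has been crossed.
    have := T.add_mem lead next
    convert this using 1
    rw [show shiftExp (i :: rs) B = (2 * ∑ j, B i j + 1) + shiftExp rs B by simp [shiftExp]]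
    simp only [mul_assoc]
    rw [zpow_natCast, smul_comm (q ^ shiftExp rs B) (q ^ (-1 : ℤ)) (P * _),
      sub_add_sub_cancel]
    congr 1
    rw [smul_smul, smul_smul, smul_smul, ← zpow_natCast, ← zpow_natCast, ← zpow_add₀ q_ne_zero,
      ← zpow_add₀ q_ne_zero, ← zpow_add₀ q_ne_zero]
    congr 2
    push_cast
    ring

end QMat
end
-- Normalization: row and column sums, and the congruence for the minor.
noncomputable section

namespace QMat

variable {n : ℕ}

theorem list_prod_map_q_smul {ι : Type*} (l : List ι) (e : ι → ℕ) (f : ι → OqM n) :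
    (l.map fun j => q ^ e j • f j).prod = q ^ (l.map e).sum • (l.map f).prod := by
  induction l with
  | nil => simp
  | cons a l ih =>
    simp only [List.map_cons, List.prod_cons, List.sum_cons, ih, smul_mul_assoc, mul_smul_comm,
      smul_smul, pow_add, mul_comm (q ^ e a)]

/-- The sum of the squares of the entries. -/
def sqSum (A : Matrix (Fin n) (Fin n) ℕ) : ℕ := ∑ i, ∑ j, A i j * A i j

theorem rowsMono_finRange (A : Matrix (Fin n) (Fin n) ℕ) :
    rowsMono (List.finRange n) A = q ^ sqSum A • monomial A := by
  unfold rowsMono rowFrom zhat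
  simp only [List.drop_zero, list_prod_map_q_smul, ← Fin.sum_univ_def]
  rfl

theorem two_mul_sum_lt (f : Fin n → ℕ) :
    2 * (∑ j, ∑ k, if k < j then f j * f k else 0) + ∑ j, f j * f j = (∑ j, f j) ^ 2 := by
  have h1 : (∑ j, ∑ k, if j < k then f j * f k else 0) =
      ∑ j, ∑ k, if k < j then f j * f k else 0 := by
    rw [Finset.sum_comm]
    refine Finset.sum_congr rfl fun j _ => Finset.sum_congr rfl fun k _ => ?_
    rw [mul_comm]
  have h2 : ∑ j, f j * f j = ∑ j, ∑ k, if j = k then f j * f k else 0 := by simp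
  rw [two_mul]
  nth_rw 2 [← h1]
  rw [h2, ← Finset.sum_add_distrib, ← Finset.sum_add_distrib, sq, Finset.sum_mul_sum]
  refine Finset.sum_congr rfl fun j _ => ?_
  rw [← Finset.sum_add_distrib, ← Finset.sum_add_distrib]
  refine Finset.sum_congr rfl fun k _ => ?_
  rcases lt_trichotomy j k with h | h | h
  · simp [h, h.not_gt, h.ne]
  · simp [h]
  · simp [h, h.not_gt, h.ne']

/-- The reason for the factor q^(c²) in `zhat`: `normExp A + sqSum A` depends only on the row and
column sums. The products of the `zhat` are therefore a common multiple of the Z(A) on each set of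
matrices with given sums. -/
theorem two_mul_normExp (A : Matrix (Fin n) (Fin n) ℕ) :
    2 * (normExp A + sqSum A) = ∑ i, (∑ j, A i j) ^ 2 + ∑ j, (∑ i, A i j) ^ 2 := by
  have e : ∑ j, ∑ i, A i j * A i j = sqSum A := Finset.sum_comm
  simp only [← two_mul_sum_lt, Finset.sum_add_distrib, ← Finset.mul_sum]
  rw [e]
  unfold normExp sqSum
  ring

theorem SameSums.normExp_add_sqSum {A B : Matrix (Fin n) (Fin n) ℕ} (h : SameSums A B) :
    normExp A + sqSum A = normExp B + sqSum B := by
  have h1 := two_mul_normExp A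
  have h2 := two_mul_normExp B
  simp only [h.1, h.2] at h1
  omega

theorem rowsMono_eq_normMonomial (A : Matrix (Fin n) (Fin n) ℕ) :
    rowsMono (List.finRange n) A = q ^ (normExp A + sqSum A) • normMonomial A := by
  rw [rowsMono_finRange, normMonomial, smul_smul, ← zpow_natCast, ← zpow_natCast,
    ← zpow_add₀ q_ne_zero]
  congr 2
  push_cast
  ring

variable (n) in
/-- The `ℤ[q]`-lattice spanned by the normalized monomials. -/
def lattice : Submodule Zq (OqM n) := Submodule.span Zq (Set.range normMonomial)

theorem normMonomial_mem (A : Matrix (Fin n) (Fin n) ℕ) : normMonomial A ∈ lattice n :=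
  Submodule.subset_span ⟨A, rfl⟩

theorem Reaches.sameSums {t : ℕ} (ht : t ≤ n) {B C : Matrix (Fin n) (Fin n) ℕ}
    (h : Reaches (rowRange n t 0) (colsFrom n (n - t)) B C) :
    SameSums C (B + partialDiag n t 0) := by
  constructor
  · intro i
    simp only [Matrix.add_apply, Finset.sum_add_distrib]
    by_cases hi : (i : ℕ) < t
    · rw [h.2.1 i (mem_rowRange.2 ⟨Nat.zero_le _, hi⟩)]
      congr 1
      rw [Finset.sum_eq_single (⟨n - t + i, by omega⟩ : Fin n)]
      · simp [partialDiag, hi]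
      · intro j _ hj
        have : (j : ℕ) ≠ n - t + i := fun h => hj (Fin.ext h)
        simp [partialDiag, this]
      · simp
    · rw [h.2.2 i (fun hi' => hi (mem_rowRange.1 hi').2)]
      simp [partialDiag, hi]
  · intro j
    simp only [Matrix.add_apply, Finset.sum_add_distrib]
    rw [h.1 j]
    congr 1
    by_cases hj : n - t ≤ (j : ℕ)
    · rw [Finset.sum_eq_single (⟨j - (n - t), by omega⟩ : Fin n)]
      · have h1 : (j : ℕ) - (n - t) < t := by omega
        have h2 : (j : ℕ) = n - t + (j - (n - t)) := by omega
        simp only [ind, colsFrom, partialDiag, Finset.mem_filter, Finset.mem_univ, true_and, hj, h1,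
          if_true, Nat.zero_le, ← h2]
      · intro i _ hi
        have : (j : ℕ) ≠ n - t + i := fun h => hi (Fin.ext (by simp; omega))
        simp [partialDiag, this]
      · simp
    · have : ∀ i : Fin n, (j : ℕ) ≠ n - t + i := fun i => by omega
      simp only [partialDiag, ind, colsFrom, Finset.mem_filter, Finset.mem_univ, hj, this,
        and_false, if_false, Finset.sum_const_zero]

/-- The sum of the first `t` row sums. -/
def topSum (t : ℕ) (B : Matrix (Fin n) (Fin n) ℕ) : ℕ :=
  ∑ i : Fin n, ∑ j : Fin n, if (i : ℕ) < t then B i j else 0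

/-- The sum of the last `t` column sums. -/
def rightSum (t : ℕ) (B : Matrix (Fin n) (Fin n) ℕ) : ℕ :=
  ∑ i : Fin n, ∑ j : Fin n, if n - t ≤ (j : ℕ) then B i j else 0

theorem shiftExp_rowRange (t : ℕ) (ht : t ≤ n) (B : Matrix (Fin n) (Fin n) ℕ) :
    shiftExp (rowRange n t 0) B = 2 * topSum t B + t := by
  have key : ∀ p, p ≤ t → ∀ d, p + d = t → shiftExp (rowRange n t p) B =
      2 * (∑ i : Fin n, ∑ j, if p ≤ (i : ℕ) ∧ (i : ℕ) < t then B i j else 0) + d := by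
    intro p hp d
    induction d generalizing p with
    | zero =>
      intro h
      obtain rfl : p = t := by omega
      rw [rowRange_self]
      have : ∀ i : Fin n, ¬ (p ≤ (i : ℕ) ∧ (i : ℕ) < p) := fun i => by omega
      simp [shiftExp, this]
    | succ d ih =>
      intro h
      rw [rowRange_eq (by omega) ht, shiftExp, List.map_cons, List.sum_cons]
      change _ + shiftExp _ _ = _
      rw [ih (p + 1) (by omega) (by omega)]
      have e : ∀ i : Fin n, (∑ j, if p ≤ (i : ℕ) ∧ (i : ℕ) < t then B i j else 0) =
          (if i = ⟨p, by omega⟩ then ∑ j, B i j else 0) +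
            ∑ j, if p + 1 ≤ (i : ℕ) ∧ (i : ℕ) < t then B i j else 0 := by
        intro i
        by_cases hi : i = ⟨p, by omega⟩
        · subst hi
          simp
          omega
        · have : (i : ℕ) ≠ p := fun h => hi (Fin.ext h)
          rw [if_neg hi, zero_add]
          refine Finset.sum_congr rfl fun j _ => ?_
          have : p ≤ (i : ℕ) ↔ p + 1 ≤ (i : ℕ) := by omega
          simp only [this]
      rw [Finset.sum_congr rfl fun i _ => e i, Finset.sum_add_distrib, Finset.sum_ite_eq']
      simp only [Finset.mem_univ, if_true]
      ring
  rw [key 0 (Nat.zero_le _) t (by omega)]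
  simp [topSum]

/-- The first t row sums and the last t column sums grow by one; in half the sum of their squares
this adds `topSum` + `rightSum` + t. -/
theorem normExp_add_partialDiag {t : ℕ} (ht : t ≤ n) (B : Matrix (Fin n) (Fin n) ℕ) :
    normExp (B + partialDiag n t 0) + sqSum (B + partialDiag n t 0) =
      normExp B + sqSum B + topSum t B + rightSum t B + t := by
  have h1 := two_mul_normExp (B + partialDiag n t 0)
  have h2 := two_mul_normExp B
  have hr : ∀ i : Fin n, ∑ j, (B + partialDiag n t 0) i j =
      ∑ j, B i j + if (i : ℕ) < t then 1 else 0 := by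
    intro i
    simp only [Matrix.add_apply, Finset.sum_add_distrib]
    congr 1
    by_cases hi : (i : ℕ) < t
    · rw [Finset.sum_eq_single (⟨n - t + i, by omega⟩ : Fin n)]
      · simp [partialDiag, hi]
      · intro j _ hj
        have : (j : ℕ) ≠ n - t + i := fun h => hj (Fin.ext h)
        simp [partialDiag, this]
      · simp
    · simp [partialDiag, hi]
  have hc : ∀ j : Fin n, ∑ i, (B + partialDiag n t 0) i j =
      ∑ i, B i j + if n - t ≤ (j : ℕ) then 1 else 0 := by
    intro j
    simp only [Matrix.add_apply, Finset.sum_add_distrib]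
    congr 1
    by_cases hj : n - t ≤ (j : ℕ)
    · rw [Finset.sum_eq_single (⟨j - (n - t), by omega⟩ : Fin n)]
      · have h1 : (j : ℕ) - (n - t) < t := by omega
        have h2 : (j : ℕ) = n - t + (j - (n - t)) := by omega
        simp only [partialDiag, hj, h1, if_true, Nat.zero_le, true_and, ← h2]
      · intro i _ hi
        have : (j : ℕ) ≠ n - t + i := fun h => hi (Fin.ext (by simp; omega))
        simp [partialDiag, this]
      · simp
    · have : ∀ i : Fin n, (j : ℕ) ≠ n - t + i := fun i => by omega
      simp [partialDiag, hj, this]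
  have sq_add : ∀ (x : ℕ) (p : Prop) [Decidable p], (x + if p then 1 else 0) ^ 2 =
      x ^ 2 + (2 * (if p then x else 0) + if p then 1 else 0) := by
    intro x p _
    split_ifs <;> ring
  have ct : ∑ i : Fin n, (if (i : ℕ) < t then 1 else 0) = t := by
    rw [Finset.sum_boole, Nat.cast_id]
    rw [show (Finset.univ.filter fun i : Fin n => (i : ℕ) < t) =
      Finset.univ.map (Fin.castLEEmb ht) by
        ext i
        simp only [Finset.mem_filter, Finset.mem_univ, true_and, Finset.mem_map]
        exact ⟨fun h => ⟨⟨i, h⟩, Fin.ext rfl⟩, fun ⟨a, ha⟩ => ha ▸ a.2⟩]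
    simp
  have cr : ∑ j : Fin n, (if n - t ≤ (j : ℕ) then 1 else 0) = t := by
    rw [← Equiv.sum_comp Fin.revPerm, ← ct]
    conv_rhs => rw [ct]; rw [← ct]
    refine Finset.sum_congr rfl fun i _ => ?_
    simp only [Fin.revPerm_apply, Fin.val_rev]
    split_ifs <;> omega
  have tt : topSum t B = ∑ i : Fin n, if (i : ℕ) < t then ∑ j, B i j else 0 := by
    refine Finset.sum_congr rfl fun i _ => ?_
    split_ifs <;> simp
  have rr : rightSum t B = ∑ j : Fin n, if n - t ≤ (j : ℕ) then ∑ i, B i j else 0 := by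
    rw [rightSum, Finset.sum_comm]
    refine Finset.sum_congr rfl fun i _ => ?_
    split_ifs <;> simp
  simp only [hr, hc, sq_add, Finset.sum_add_distrib, ← Finset.mul_sum, ← tt, ← rr, ct, cr] at h1
  omega

theorem pairwise_rowRange (t p : ℕ) : (rowRange n t p).Pairwise (· < ·) := by
  unfold rowRange
  exact (List.pairwise_lt_finRange n).sublist ((List.drop_sublist _ _).trans (List.take_sublist _ _))

/-- The exponent is the cost 2 · `topSum` + t of crossing the rows minus the change `topSum` +
`rightSum` + t of the normalization. -/
theorem qminor_mul_normMonomial {t : ℕ} (ht : t ≤ n) (B : Matrix (Fin n) (Fin n) ℕ) :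
    q ^ (topSum t B - rightSum t B : ℤ) •
      (qminor (rowRange n t 0) (colsFrom n (n - t)) * normMonomial B) -
      normMonomial (B + partialDiag n t 0) ∈ scale (-1) (lattice n) := by
  have happ : rowRange n t 0 ++ (List.finRange n).drop t = List.finRange n := by
    simp [rowRange]
  have key := qminor_mul_rowsMono_lead t ht ((List.finRange n).drop t)
    (scale (-(normExp (B + partialDiag n t 0) + sqSum (B + partialDiag n t 0) : ℕ)) (lattice n)) t 0
    (by omega) (pairwise_rowRange t 0) (by rw [happ]; exact List.nodup_finRange n) B 1
    (by
      intro C hC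
      rw [happ, one_mul, rowsMono_eq_normMonomial, ← (hC.sameSums ht).normExp_add_sqSum, mem_scale,
        smul_smul, ← zpow_natCast, ← zpow_add₀ q_ne_zero, neg_add_cancel, zpow_zero, one_smul]
      exact normMonomial_mem C)
  rw [happ, one_mul, one_mul, rowsMono_eq_normMonomial, rowsMono_eq_normMonomial, mem_scale,
    mem_scale, smul_comm (_ : K) (q ^ (-1 : ℤ)), ← mem_scale] at key
  convert key using 1
  rw [smul_sub, ← zpow_natCast, ← zpow_natCast, ← zpow_natCast, mul_smul_comm, smul_smul, smul_smul,
    smul_smul, ← zpow_add₀ q_ne_zero, ← zpow_add₀ q_ne_zero, ← zpow_add₀ q_ne_zero, neg_add_cancel,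
    zpow_zero, one_smul]
  congr 3
  rw [normExp_add_partialDiag ht, shiftExp_rowRange t ht]
  push_cast
  ring

end QMat
end
noncomputable section

namespace QMat

/-! ### Products of quantum matrices with mutually commuting entries. -/

section Coproduct

variable {F A ι κ : Type*} [Field F] [Ring A] [Algebra F A] [LinearOrder ι] [LinearOrder κ]

/-- This is the multiplicativity of the comultiplication. The commutation hypothesis separates the
two kinds of entries, after which each relation is checked on unordered pairs of summation indices.
-/
theorem IsQuantumMatrix.mul [Fintype κ] {v : F} {z : ι → κ → A} {g : κ → κ → A}
    (hz : IsQuantumMatrix v z) (hg : IsQuantumMatrix v g) (hv : v ≠ 0)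
    (hc : ∀ i a b c, g b c * z i a = z i a * g b c) :
    IsQuantumMatrix v (fun i j => ∑ a, z i a * g a j) := by
  have expand : ∀ i s j t, (∑ a, z i a * g a j) * (∑ b, z s b * g b t) =
      ∑ a, ∑ b, z i a * z s b * (g a j * g b t) := by
    intro i s j t
    rw [Finset.sum_mul_sum]
    refine Finset.sum_congr rfl fun a _ => Finset.sum_congr rfl fun b _ => ?_
    rw [mul_assoc, ← mul_assoc (g a j), hc]
    simp only [mul_assoc]
  refine ⟨?_, ?_, ?_, ?_⟩
  · intro i j k hjk
    simp only [expand, Finset.smul_sum]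
    refine sum_sum_eq_of_swap _ _ _ (fun a _ b _ hab => ?_) (fun a _ => ?_)
    · rw [hz.row i a b hab, hg.diag a j b k hab hjk, hg.anti b j a k hab hjk]
      simp only [smul_mul_assoc, mul_smul_comm, mul_add]
      match_scalars
      · field_simp
      · field_simp
        ring
    · rw [hg.row a j k hjk, mul_smul_comm]
  · intro i s j his
    simp only [expand, Finset.smul_sum]
    refine sum_sum_eq_of_swap _ _ _ (fun a _ b _ hab => ?_) (fun a _ => ?_)
    · rw [hg.col a b j hab, hz.diag i a s b his hab, ← hz.anti s a i b his hab]
      simp only [smul_mul_assoc, mul_smul_comm, add_mul]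
      match_scalars
      · field_simp
      · field_simp
        ring
    · rw [hz.col i s a his, smul_mul_assoc]
  · intro i j s t hsi hjt
    simp only [expand]
    refine sum_sum_eq_of_swap _ _ _ (fun a _ b _ hab => ?_) (fun a _ => ?_)
    · rw [hz.anti i a s b hsi hab, hg.diag a j b t hab hjt, hg.anti b j a t hab hjt,
        hz.diag s a i b hsi hab]
      simp only [smul_mul_assoc, mul_smul_comm, add_mul, mul_add]
      module
    · rw [hz.col s i a hsi, hg.row a j t hjt]
      simp only [smul_mul_assoc, mul_smul_comm]
  · intro i j s t his hjt
    simp only [expand, Finset.smul_sum, ← Finset.sum_add_distrib]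
    refine sum_sum_eq_of_swap _ _ _ (fun a _ b _ hab => ?_) (fun a _ => ?_)
    · rw [hz.diag i a s b his hab, hg.diag a j b t hab hjt, hg.anti b j a t hab hjt,
        ← hz.anti s a i b his hab]
      simp only [smul_mul_assoc, mul_smul_comm, add_mul, mul_add]
      module
    · rw [hz.col i s a his, hg.row a j t hjt]
      simp only [smul_mul_assoc, mul_smul_comm]
      match_scalars
      field_simp
      ring

end Coproduct

/-! ### Weighted shift operators that model a new top row. -/

section Shift

variable {F V : Type*} [Field F] [AddCommGroup V] [Module F V] {n : ℕ}

/-- The weighted shift `x ↦ c x • (x + d)` on finitely supported functions on `ℤ ^ n`. -/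
def wshift (V : Type*) [AddCommGroup V] [Module F V] (c : (Fin n → ℤ) → F) (d : Fin n → ℤ) :
    Module.End F ((Fin n → ℤ) →₀ V) :=
  Finsupp.lsum F fun x => c x • Finsupp.lsingle (x + d)

theorem wshift_single (c : (Fin n → ℤ) → F) (d x : Fin n → ℤ) (w : V) :
    wshift V c d (Finsupp.single x w) = Finsupp.single (x + d) (c x • w) := by
  simp [wshift]

theorem wshift_mul (c c' : (Fin n → ℤ) → F) (d d' : Fin n → ℤ) :
    wshift V c d * wshift V c' d' = wshift V (fun x => c (x + d') * c' x) (d' + d) := by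
  refine Finsupp.lhom_ext fun x w => ?_
  rw [Module.End.mul_apply, wshift_single, wshift_single, wshift_single, smul_smul, add_assoc]

theorem wshift_add (c c' : (Fin n → ℤ) → F) (d : Fin n → ℤ) :
    wshift V c d + wshift V c' d = wshift V (fun x => c x + c' x) d := by
  refine Finsupp.lhom_ext fun x w => ?_
  rw [LinearMap.add_apply, wshift_single, wshift_single, wshift_single, ← Finsupp.single_add,
    add_smul]

theorem smul_wshift (r : F) (c : (Fin n → ℤ) → F) (d : Fin n → ℤ) :
    r • wshift V c d = wshift V (fun x => r * c x) d := by
  refine Finsupp.lhom_ext fun x w => ?_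
  rw [LinearMap.smul_apply, wshift_single, wshift_single, Finsupp.smul_single, smul_smul]

theorem wshift_congr {c c' : (Fin n → ℤ) → F} {d d' : Fin n → ℤ} (hc : ∀ x, c x = c' x)
    (hd : d = d') : wshift V c d = wshift V c' d' := by
  rw [hd, funext hc]

/-- The sum of the entries before `j`. -/
def psum (j : Fin n) (x : Fin n → ℤ) : ℤ := ∑ m, if m < j then x m else 0

/-- The standard basis vector. -/
abbrev sv (j : Fin n) : Fin n → ℤ := Pi.single j 1

theorem psum_add (j : Fin n) (x y : Fin n → ℤ) : psum j (x + y) = psum j x + psum j y := by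
  simp only [psum, ← Finset.sum_add_distrib]
  refine Finset.sum_congr rfl fun m _ => ?_
  split_ifs <;> simp

theorem psum_sub (j : Fin n) (x y : Fin n → ℤ) : psum j (x - y) = psum j x - psum j y := by
  simp only [psum, ← Finset.sum_sub_distrib]
  refine Finset.sum_congr rfl fun m _ => ?_
  split_ifs <;> simp

theorem psum_sv (j m : Fin n) : psum j (sv m) = if m < j then 1 else 0 := by
  rw [psum, Finset.sum_eq_single m]
  · simp
  · intro b _ hb
    simp [hb]
  · simp

/-- The operators by which the generators of the first row act. -/
def rowOp (v : F) (V : Type*) [AddCommGroup V] [Module F V] (j : Fin n) :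
    Module.End F ((Fin n → ℤ) →₀ V) :=
  wshift V (fun x => v ^ (-psum j x)) (sv j)

/-- The operators that describe how the generators of the other rows are moved past the first row. -/
def passOp (v : F) (V : Type*) [AddCommGroup V] [Module F V] (a j : Fin n) :
    Module.End F ((Fin n → ℤ) →₀ V) :=
  if a = j then wshift V (fun x => v ^ (-x a)) 0
  else if a < j then
    wshift V (fun x => -v * (v ^ x a - v ^ (-x a)) * v ^ (psum a x - psum j x)) (sv j - sv a)
  else 0

theorem passOp_self (v : F) (a : Fin n) :
    passOp v V a a = wshift V (fun x => v ^ (-x a)) 0 := by simp [passOp]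

theorem passOp_of_lt (v : F) {a j : Fin n} (h : a < j) : passOp v V a j =
    wshift V (fun x => -v * (v ^ x a - v ^ (-x a)) * v ^ (psum a x - psum j x)) (sv j - sv a) := by
  simp [passOp, h, h.ne]

theorem passOp_of_gt (v : F) {a j : Fin n} (h : j < a) : passOp v V a j = 0 := by
  simp [passOp, h.not_gt, h.ne']

variable {v : F}

/-- The weight of `rowOp` is the factor for sorting a generator of the top row into an ordered
monomial with exponents x. Since `wshift_mul` composes weights and shifts, this and the following
relations become scalar identities. -/
theorem rowOp_mul_rowOp (hv : v ≠ 0) {j k : Fin n} (h : j < k) :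
    rowOp v V j * rowOp v V k = v • (rowOp v V k * rowOp v V j) := by
  simp only [rowOp, wshift_mul, smul_wshift]
  refine wshift_congr (fun x => ?_) (by abel)
  simp only [psum_add, psum_sv, h, h.not_gt, if_true, if_false, neg_add, zpow_add₀ hv, zpow_neg,
    zpow_one, add_zero]
  field_simp

theorem rowOp_mul_passOp (hv : v ≠ 0) (a j : Fin n) :
    rowOp v V j * passOp v V a j = v • (passOp v V a j * rowOp v V j) := by
  rcases lt_trichotomy a j with h | rfl | h
  · simp only [passOp_of_lt v h, rowOp, wshift_mul, smul_wshift]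
    refine wshift_congr (fun x => ?_) (by abel)
    simp only [psum_add, psum_sub, psum_sv, h, h.not_gt, h.ne, if_true, if_false, Pi.add_apply,
      Pi.single_apply, lt_irrefl, zpow_add₀ hv, zpow_sub₀ hv, zpow_neg,
      zpow_one, neg_add, add_zero, zero_sub]
    field_simp
  · simp only [passOp_self, rowOp, wshift_mul, smul_wshift]
    refine wshift_congr (fun x => ?_) (by abel)
    simp only [if_true, Pi.add_apply,
      Pi.single_apply, zpow_add₀ hv, zpow_neg,
      zpow_one, neg_add, add_zero]
    field_simp
  · simp [passOp_of_gt v h]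

theorem passOp_mul_rowOp (hv : v ≠ 0) (a : Fin n) {j t : Fin n} (h : j < t) :
    passOp v V a j * rowOp v V t = rowOp v V t * passOp v V a j := by
  rcases lt_trichotomy a j with h1 | rfl | h1
  · have h2 := h1.trans h
    simp only [passOp_of_lt v h1, rowOp, wshift_mul]
    refine wshift_congr (fun x => ?_) (by abel)
    simp only [psum_add, psum_sub, psum_sv, Pi.add_apply, Pi.single_apply, h, h2, h.not_gt, h2.not_gt, h2.ne, if_true, if_false, zpow_sub₀ hv, zpow_neg, add_zero, sub_self]
    field_simp
  · simp only [passOp_self, rowOp, wshift_mul]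
    refine wshift_congr (fun x => ?_) (by abel)
    simp only [Pi.add_apply, Pi.single_apply, h.ne, if_false, zpow_neg, add_zero]
    field_simp
  · simp [passOp_of_gt v h1]

theorem rowOp_mul_passOp_add (hv : v ≠ 0) (a : Fin n) {j t : Fin n} (h : j < t) :
    rowOp v V j * passOp v V a t =
      passOp v V a t * rowOp v V j + (v - v⁻¹) • (rowOp v V t * passOp v V a j) := by
  rcases lt_trichotomy a j with h1 | rfl | h1
  · have h2 := h1.trans h
    simp only [passOp_of_lt v h1, passOp_of_lt v h2, rowOp, wshift_mul, smul_wshift]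
    rw [show sv j + (sv t - sv a) = sv t - sv a + sv j by abel,
      show sv j - sv a + sv t = sv t - sv a + sv j by abel, wshift_add]
    refine wshift_congr (fun x => ?_) (by abel)
    simp only [psum_add, psum_sub, psum_sv, Pi.add_apply, Pi.single_apply, h, h1, h2, h.not_gt, h1.not_gt, h1.ne, if_true, if_false, zpow_add₀ hv, zpow_sub₀ hv, zpow_neg, zpow_one, neg_add, add_zero, zero_sub, sub_self]
    field_simp
    ring
  · simp only [passOp_of_lt v h, passOp_self, rowOp, wshift_mul, smul_wshift]
    rw [show sv a + (sv t - sv a) = sv t by abel, zero_add, wshift_add,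
      show sv t - sv a + sv a = sv t by abel]
    refine wshift_congr (fun x => ?_) rfl
    simp only [psum_add, psum_sub, psum_sv, Pi.add_apply, Pi.single_apply, lt_irrefl,
      h, h.not_gt, if_true, if_false, zpow_add₀ hv, zpow_sub₀ hv, zpow_neg, zpow_one, neg_add, add_zero, sub_self]
    field_simp
    ring
  · rcases lt_trichotomy a t with h2 | rfl | h2
    · simp only [passOp_of_lt v h2, passOp_of_gt v h1, rowOp, wshift_mul, mul_zero, smul_zero,
        add_zero]
      refine wshift_congr (fun x => ?_) (by abel)
      simp only [psum_add, psum_sub, psum_sv, Pi.add_apply, Pi.single_apply, h, h1, h.not_gt, h1.not_gt, h1.ne', if_true, if_false, zpow_add₀ hv, zpow_sub₀ hv, zpow_neg, zpow_one, add_zero, sub_self]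
      field_simp
    · simp only [passOp_self, passOp_of_gt v h1, rowOp, wshift_mul, mul_zero, smul_zero,
        add_zero]
      refine wshift_congr (fun x => ?_) (by abel)
      simp only [Pi.add_apply, Pi.single_apply, h.ne', if_false, zpow_neg, add_zero]
      field_simp
    · simp [passOp_of_gt v h1, passOp_of_gt v h2]

/-- `passOp a j` is the part of moving a lower-row generator in column j through a top-row monomial
that comes out in column a: unchanged for a = j, or with one top-row generator traded from column a
to column j for a < j. The relations are verified case by case according to the order of the
indices. -/
theorem isQuantumMatrix_passOp (hv : v ≠ 0) : IsQuantumMatrix v (passOp (n := n) v V) where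
  row a j t h := by
    rcases lt_trichotomy a j with h1 | rfl | h1
    · have h2 := h1.trans h
      simp only [passOp_of_lt v h1, passOp_of_lt v h2, wshift_mul, smul_wshift]
      refine wshift_congr (fun x => ?_) (by abel)
      simp only [psum_add, psum_sub, psum_sv, Pi.add_apply, Pi.sub_apply, Pi.single_apply, lt_irrefl,
      h, h1, h2, h.not_gt, h1.not_gt, h2.not_gt, h1.ne, h2.ne, if_true, if_false, zpow_add₀ hv, zpow_sub₀ hv, zpow_neg, zpow_one, neg_add, add_zero, zero_sub, sub_self]
      field_simp
      try ring
    · simp only [passOp_of_lt v h, passOp_self, wshift_mul, smul_wshift]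
      refine wshift_congr (fun x => ?_) (by abel)
      simp only [Pi.zero_apply, Pi.add_apply, Pi.sub_apply, Pi.single_apply, h.ne, if_true, if_false, zpow_add₀ hv, zpow_sub₀ hv, zpow_neg, zpow_one, neg_add, add_zero, zero_sub]
      field_simp
      try ring
    · simp [passOp_of_gt v h1]
  col a b j h := by
    rcases lt_trichotomy b j with h1 | rfl | h1
    · have h2 := h.trans h1
      simp only [passOp_of_lt v h1, passOp_of_lt v h2, wshift_mul, smul_wshift]
      refine wshift_congr (fun x => ?_) (by abel)
      simp only [psum_add, psum_sub, psum_sv, Pi.add_apply, Pi.sub_apply, Pi.single_apply, lt_irrefl,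
      h, h1, h2, h.not_gt, h1.not_gt, h2.not_gt, h.ne, h1.ne, h2.ne, h.ne', if_true, if_false, zpow_add₀ hv, zpow_sub₀ hv, zpow_neg, zpow_one, add_zero, zero_sub, sub_self]
      field_simp
      try ring
    · simp only [passOp_of_lt v h, passOp_self, wshift_mul, smul_wshift]
      refine wshift_congr (fun x => ?_) (by abel)
      simp only [Pi.zero_apply, Pi.add_apply, Pi.sub_apply, Pi.single_apply, h.ne', if_true, if_false, zpow_add₀ hv, zpow_sub₀ hv, zpow_neg, zpow_one, neg_add, add_zero, sub_zero]
      field_simp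
      try ring
    · simp [passOp_of_gt v h1]
  anti a j b t hba hjt := by
    rcases lt_trichotomy a j with h1 | rfl | h1
    · have h2 := hba.trans h1
      have h3 := h2.trans hjt
      have h4 := h1.trans hjt
      simp only [passOp_of_lt v h1, passOp_of_lt v h3, wshift_mul]
      refine wshift_congr (fun x => ?_) (by abel)
      simp only [psum_add, psum_sub, psum_sv, Pi.add_apply, Pi.sub_apply, Pi.single_apply, hba, hjt, h2, h4, hba.not_gt, hjt.not_gt, h2.not_gt, h4.not_gt,
      hba.ne, h2.ne, h4.ne, hba.ne', if_true, if_false, zpow_add₀ hv, zpow_sub₀ hv, zpow_neg, zpow_one, add_zero, zero_sub, sub_self]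
      field_simp
      try ring
    · have h3 := hba.trans hjt
      simp only [passOp_self, passOp_of_lt v h3, wshift_mul]
      refine wshift_congr (fun x => ?_) (by abel)
      simp only [Pi.zero_apply, Pi.add_apply, Pi.sub_apply, Pi.single_apply, hjt.ne, hba.ne', if_false, zpow_sub₀ hv, zpow_neg, add_zero, sub_self]
      field_simp
      try ring
    · simp [passOp_of_gt v h1]
  diag a j b t hab hjt := by
    rcases lt_trichotomy b j with h1 | rfl | h1
    · have h2 := hab.trans h1
      have h3 := h2.trans hjt
      have h4 := h1.trans hjt
      simp only [passOp_of_lt v h1, passOp_of_lt v h2, passOp_of_lt v h3, passOp_of_lt v h4,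
        wshift_mul, smul_wshift]
      rw [show sv j - sv a + (sv t - sv b) = sv t - sv b + (sv j - sv a) by abel,
        show sv j - sv b + (sv t - sv a) = sv t - sv b + (sv j - sv a) by abel, wshift_add]
      refine wshift_congr (fun x => ?_) rfl
      simp only [psum_add, psum_sub, psum_sv, Pi.add_apply, Pi.sub_apply, Pi.single_apply, hab, hjt, h1, h3, h4, hab.not_gt, hjt.not_gt, h1.not_gt, h2.not_gt, h3.not_gt, hab.ne, h1.ne, h2.ne, h3.ne, hab.ne', if_true, if_false, zpow_add₀ hv, zpow_sub₀ hv, zpow_neg, zpow_one, add_zero, zero_sub, sub_self]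
      field_simp
      try ring
    · have h3 := hab.trans hjt
      simp only [passOp_of_lt v hab, passOp_of_lt v hjt, passOp_of_lt v h3, passOp_self,
        wshift_mul, smul_wshift, zero_add]
      rw [show sv b - sv a + (sv t - sv b) = sv t - sv a by abel,
        show sv t - sv b + (sv b - sv a) = sv t - sv a by abel, wshift_add]
      refine wshift_congr (fun x => ?_) rfl
      simp only [psum_add, psum_sub, psum_sv, Pi.zero_apply, Pi.add_apply, Pi.sub_apply, Pi.single_apply, lt_irrefl,
      hab, hjt, h3, hab.not_gt, hjt.not_gt, h3.not_gt,
      hab.ne, h3.ne, hab.ne', if_true, if_false, zpow_add₀ hv, zpow_sub₀ hv, zpow_neg, zpow_one, neg_add, add_zero, sub_zero, zero_sub, sub_self]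
      field_simp
      try ring
    · rw [passOp_of_gt v h1, mul_zero, smul_zero, add_zero]
      rcases lt_trichotomy a j with h2 | rfl | h2
      · have h5 := h2.trans hjt
        rcases lt_trichotomy b t with h3 | rfl | h3
        · simp only [passOp_of_lt v h2, passOp_of_lt v h3, wshift_mul]
          refine wshift_congr (fun x => ?_) (by abel)
          simp only [psum_add, psum_sub, psum_sv, Pi.add_apply, Pi.sub_apply, Pi.single_apply, hab, hjt, h1, h5, hab.not_gt, hjt.not_gt, h1.not_gt, h5.not_gt,
      hab.ne, h5.ne, hab.ne', h1.ne', if_true, if_false, zpow_sub₀ hv, zpow_neg, add_zero, sub_self]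
          field_simp
          try ring
        · simp only [passOp_of_lt v h2, passOp_self, wshift_mul]
          refine wshift_congr (fun x => ?_) (by abel)
          simp only [Pi.zero_apply, Pi.add_apply, Pi.sub_apply, Pi.single_apply, hab.ne', hjt.ne', if_false, zpow_sub₀ hv, zpow_neg, add_zero, sub_self]
          field_simp
          try ring
        · simp [passOp_of_gt v h3]
      · rcases lt_trichotomy b t with h3 | rfl | h3
        · simp only [passOp_self, passOp_of_lt v h3, wshift_mul]
          refine wshift_congr (fun x => ?_) (by abel)
          simp only [Pi.zero_apply, Pi.add_apply, Pi.sub_apply, Pi.single_apply, hab.ne, hjt.ne, if_false, zpow_sub₀ hv, zpow_neg, add_zero, sub_self]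
          field_simp
          try ring
        · simp only [passOp_self, wshift_mul]
          refine wshift_congr (fun x => ?_) (by abel)
          simp [mul_comm]
        · simp [passOp_of_gt v h3]
      · simp [passOp_of_gt v h2]

end Shift
end QMat
end
noncomputable section

namespace QMat

/-! ### Linear independence of the ordered monomials. -/

section Representation

variable {F V : Type*} [Field F] [AddCommGroup V] [Module F V] {m n : ℕ}

/-- An endomorphism of `V` acting on the values of finitely supported functions. -/
def liftEnd (n : ℕ) (f : Module.End F V) : Module.End F ((Fin n → ℤ) →₀ V) :=
  Finsupp.mapRange.linearMap f

theorem liftEnd_single (f : Module.End F V) (x : Fin n → ℤ) (w : V) :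
    liftEnd n f (Finsupp.single x w) = Finsupp.single x (f w) := by
  simp [liftEnd]

theorem liftEnd_mul (f g : Module.End F V) : liftEnd n (f * g) = liftEnd n f * liftEnd n g :=
  Finsupp.lhom_ext fun x w => by simp [liftEnd_single]

theorem liftEnd_add (f g : Module.End F V) : liftEnd n (f + g) = liftEnd n f + liftEnd n g :=
  Finsupp.lhom_ext fun x w => by simp [liftEnd_single]

theorem liftEnd_smul (c : F) (f : Module.End F V) : liftEnd n (c • f) = c • liftEnd n f :=
  Finsupp.lhom_ext fun x w => by simp [liftEnd_single]

theorem wshift_mul_liftEnd (c : (Fin n → ℤ) → F) (d : Fin n → ℤ) (f : Module.End F V) :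
    wshift V c d * liftEnd n f = liftEnd n f * wshift V c d :=
  Finsupp.lhom_ext fun x w => by
    rw [Module.End.mul_apply, Module.End.mul_apply, liftEnd_single, wshift_single, wshift_single,
      liftEnd_single, map_smul]

theorem passOp_mul_liftEnd (v : F) (a j : Fin n) (f : Module.End F V) :
    passOp v V a j * liftEnd n f = liftEnd n f * passOp v V a j := by
  unfold passOp
  split_ifs
  · exact wshift_mul_liftEnd _ _ _
  · exact wshift_mul_liftEnd _ _ _
  · simp

variable {v : F}

theorem IsQuantumMatrix.liftEnd {ι κ : Type*} [LinearOrder ι] [LinearOrder κ]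
    {z : ι → κ → Module.End F V} (hz : IsQuantumMatrix v z) :
    IsQuantumMatrix v fun i j => QMat.liftEnd n (z i j) where
  row i j k h := by rw [← liftEnd_mul, ← liftEnd_mul, ← liftEnd_smul, hz.row i j k h]
  col i j k h := by rw [← liftEnd_mul, ← liftEnd_mul, ← liftEnd_smul, hz.col i j k h]
  anti i j s t h h' := by rw [← liftEnd_mul, ← liftEnd_mul, hz.anti i j s t h h']
  diag i j s t h h' := by
    rw [← liftEnd_mul, ← liftEnd_mul, ← liftEnd_mul, ← liftEnd_smul, ← liftEnd_add,
      hz.diag i j s t h h']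

/-- The quantum matrix with one more row obtained from a quantum matrix of operators. -/
def addRow (v : F) (z : Fin m → Fin n → Module.End F V) :
    Fin (m + 1) → Fin n → Module.End F ((Fin n → ℤ) →₀ V) :=
  Fin.cons (rowOp v V) fun i j => ∑ a, liftEnd n (z i a) * passOp v V a j

theorem addRow_zero (z : Fin m → Fin n → Module.End F V) : addRow v z 0 = rowOp v V := rfl

theorem addRow_succ (z : Fin m → Fin n → Module.End F V) (i : Fin m) (j : Fin n) :
    addRow v z i.succ j = ∑ a, liftEnd n (z i a) * passOp v V a j := rfl

/-- The lower rows are a product of two commuting quantum matrices, so `IsQuantumMatrix.mul`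
applies. Relations with the top row reduce, summand by summand, to those between `rowOp` and
`passOp`. -/
theorem isQuantumMatrix_addRow (hv : v ≠ 0) {z : Fin m → Fin n → Module.End F V}
    (hz : IsQuantumMatrix v z) : IsQuantumMatrix v (addRow v z) := by
  have h := hz.liftEnd.mul (isQuantumMatrix_passOp (V := V) hv) hv
    (fun i a b c => passOp_mul_liftEnd v b c (z i a))
  have comm : ∀ (j : Fin n) (f : Module.End F V),
      rowOp v V j * liftEnd n f = liftEnd n f * rowOp v V j := fun j f => wshift_mul_liftEnd _ _ _
  refine ⟨?_, ?_, ?_, ?_⟩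
  · intro i j k hjk
    refine Fin.cases ?_ (fun i => ?_) i
    · exact rowOp_mul_rowOp hv hjk
    · exact h.row i j k hjk
  · intro i s j
    refine Fin.cases ?_ (fun i => ?_) i <;> refine Fin.cases ?_ (fun s => ?_) s
    · intro h0
      exact absurd h0 (lt_irrefl _)
    · intro _
      rw [addRow_zero, addRow_succ, Finset.mul_sum, Finset.sum_mul, Finset.smul_sum]
      refine Finset.sum_congr rfl fun a _ => ?_
      rw [← mul_assoc, comm, mul_assoc, rowOp_mul_passOp hv, mul_smul_comm, mul_assoc]
    · intro h0
      exact absurd h0 (Fin.not_lt_zero _)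
    · intro h0
      exact h.col i s j (Fin.succ_lt_succ_iff.1 h0)
  · intro i j s t
    refine Fin.cases ?_ (fun i => ?_) i <;> refine Fin.cases ?_ (fun s => ?_) s
    · intro h0
      exact absurd h0 (lt_irrefl _)
    · intro h0
      exact absurd h0 (Fin.not_lt_zero _)
    · intro _ hjt
      rw [addRow_zero, addRow_succ, Finset.mul_sum, Finset.sum_mul]
      refine Finset.sum_congr rfl fun a _ => ?_
      rw [← mul_assoc, comm, mul_assoc, mul_assoc, passOp_mul_rowOp hv a hjt]
    · intro h0 hjt
      exact h.anti i j s t (Fin.succ_lt_succ_iff.1 h0) hjt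
  · intro i j s t
    refine Fin.cases ?_ (fun i => ?_) i <;> refine Fin.cases ?_ (fun s => ?_) s
    · intro h0
      exact absurd h0 (lt_irrefl _)
    · intro _ hjt
      rw [addRow_zero, addRow_succ, addRow_succ, Finset.mul_sum, Finset.sum_mul, Finset.mul_sum,
        Finset.smul_sum, ← Finset.sum_add_distrib]
      refine Finset.sum_congr rfl fun a _ => ?_
      rw [← mul_assoc, comm, mul_assoc, mul_assoc, rowOp_mul_passOp_add hv a hjt, mul_add,
        mul_smul_comm, ← mul_assoc (rowOp v V t), comm, mul_assoc]
    · intro h0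
      exact absurd h0 (Fin.not_lt_zero _)
    · intro h0 hjt
      exact h.diag i j s t (Fin.succ_lt_succ_iff.1 h0) hjt

/-- The ordered monomial in the entries of a matrix. -/
def orderedMonomial {A : Type*} [Monoid A] (z : Fin m → Fin n → A) (C : Fin m → Fin n → ℕ) : A :=
  ((List.finRange m).map fun i => ((List.finRange n).map fun j => z i j ^ C i j).prod).prod

/-- With all exponents 0 there is no top-row generator to trade: the factor v^(x_a) - v^(-x_a)
vanishes. -/
theorem passOp_single_zero (a j : Fin n) (w : V) :
    passOp v V a j (Finsupp.single 0 w) = if a = j then Finsupp.single 0 w else 0 := by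
  unfold passOp
  split_ifs
  · simp [wshift_single]
  · simp [wshift_single]
  · simp

theorem addRow_succ_single_zero (z : Fin m → Fin n → Module.End F V) (i : Fin m) (j : Fin n)
    (w : V) : addRow v z i.succ j (Finsupp.single 0 w) = Finsupp.single 0 (z i j w) := by
  rw [addRow_succ, LinearMap.sum_apply, Finset.sum_eq_single j]
  · rw [Module.End.mul_apply, passOp_single_zero, if_pos rfl, liftEnd_single]
  · intro b _ hb
    rw [Module.End.mul_apply, passOp_single_zero, if_neg hb, map_zero]
  · simp

theorem list_prod_single_zero {ι : Type*} (l : List ι)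
    (f : ι → Module.End F ((Fin n → ℤ) →₀ V)) (g : ι → Module.End F V)
    (h : ∀ i w, f i (Finsupp.single 0 w) = Finsupp.single 0 (g i w)) (w : V) :
    (l.map f).prod (Finsupp.single 0 w) = Finsupp.single 0 ((l.map g).prod w) := by
  induction l with
  | nil => simp
  | cons a l ih => simp [ih, h]

theorem pow_single_zero (f : Module.End F ((Fin n → ℤ) →₀ V)) (g : Module.End F V)
    (h : ∀ w, f (Finsupp.single 0 w) = Finsupp.single 0 (g w)) (k : ℕ) (w : V) :
    (f ^ k) (Finsupp.single 0 w) = Finsupp.single 0 ((g ^ k) w) := by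
  induction k with
  | zero => simp
  | succ k ih => rw [pow_succ', pow_succ', Module.End.mul_apply, Module.End.mul_apply, ih, h]

theorem rowOp_pow_single (hv : v ≠ 0) (j : Fin n) (k : ℕ) (x : Fin n → ℤ) :
    ∃ c : F, c ≠ 0 ∧ ∀ w : V, (rowOp v V j ^ k) (Finsupp.single x w) =
      Finsupp.single (x + (k : ℤ) • sv j) (c • w) := by
  induction k with
  | zero => exact ⟨1, one_ne_zero, fun w => by simp⟩
  | succ k ih =>
    obtain ⟨c, hc, h⟩ := ih
    refine ⟨v ^ (-psum j (x + (k : ℤ) • sv j)) * c, mul_ne_zero (zpow_ne_zero _ hv) hc, fun w => ?_⟩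
    rw [pow_succ', Module.End.mul_apply, h, rowOp, wshift_single, smul_smul, add_assoc]
    congr 2
    push_cast
    rw [add_smul, one_smul]

theorem rowOp_list_single (hv : v ≠ 0) (C : Fin n → ℕ) (l : List (Fin n)) (x : Fin n → ℤ) :
    ∃ c : F, c ≠ 0 ∧ ∀ w : V, (l.map fun j => rowOp v V j ^ C j).prod (Finsupp.single x w) =
      Finsupp.single (x + (l.map fun j => (C j : ℤ) • sv j).sum) (c • w) := by
  induction l with
  | nil => exact ⟨1, one_ne_zero, fun w => by simp⟩
  | cons a l ih =>
    obtain ⟨c, hc, h⟩ := ih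
    obtain ⟨c', hc', h'⟩ := rowOp_pow_single (V := V) hv a (C a)
      (x + (l.map fun j => (C j : ℤ) • sv j).sum)
    refine ⟨c' * c, mul_ne_zero hc' hc, fun w => ?_⟩
    rw [List.map_cons, List.prod_cons, Module.End.mul_apply, h, h', smul_smul, List.map_cons,
      List.sum_cons, add_assoc, add_comm (List.sum _)]

/-- The lower rows act first and leave the exponent at 0, acting only on the value. The top row then
records its exponents as the position in ℤ^n, up to a nonzero scalar. -/
theorem orderedMonomial_addRow (hv : v ≠ 0) (z : Fin m → Fin n → Module.End F V)
    (C : Fin (m + 1) → Fin n → ℕ) : ∃ c : F, c ≠ 0 ∧ ∀ w : V,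
    orderedMonomial (addRow v z) C (Finsupp.single 0 w) =
      c • Finsupp.single (fun j => (C 0 j : ℤ)) (orderedMonomial z (fun i => C i.succ) w) := by
  obtain ⟨c, hc, h⟩ := rowOp_list_single (V := V) hv (C 0) (List.finRange n) 0
  refine ⟨c, hc, fun w => ?_⟩
  rw [orderedMonomial, List.finRange_succ, List.map_cons, List.prod_cons, List.map_map,
    Module.End.mul_apply, addRow_zero]
  have key := list_prod_single_zero (List.finRange m)
    (fun i => ((List.finRange n).map fun j => addRow v z i.succ j ^ C i.succ j).prod)
    (fun i => ((List.finRange n).map fun j => z i j ^ C i.succ j).prod) (fun i w =>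
      list_prod_single_zero _ _ (fun j => z i j ^ C i.succ j)
        (fun j w => pow_single_zero _ _ (addRow_succ_single_zero z i j) _ w) w) w
  refine Eq.trans (congrArg _ key) ?_
  rw [h, Finsupp.smul_single]
  congr 1
  rw [zero_add, ← Fin.sum_univ_def]
  ext j
  simp [Finset.sum_apply, Pi.single_apply]

end Representation

/-- Induction on the number of rows. Monomials with different top rows land at different positions,
and those with equal top rows are separated by their values. -/
theorem exists_representation {F : Type} [Field F] {v : F} (hv : v ≠ 0) (n m : ℕ) :
    ∃ (V : Type) (_ : AddCommGroup V) (_ : Module F V) (z : Fin m → Fin n → Module.End F V) (w : V),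
      IsQuantumMatrix v z ∧
        LinearIndependent F fun C : Fin m → Fin n → ℕ => orderedMonomial z C w := by
  induction m with
  | zero =>
    refine ⟨F, inferInstance, inferInstance, Fin.elim0, 1,
      ⟨fun i => i.elim0, fun i => i.elim0, fun i => i.elim0, fun i => i.elim0⟩, ?_⟩
    rw [linearIndependent_unique_iff]
    simp [orderedMonomial]
  | succ m ih =>
    obtain ⟨V, _, _, z, w, hz, hli⟩ := ih
    refine ⟨(Fin n → ℤ) →₀ V, Finsupp.instAddCommGroup, Finsupp.module _ _, addRow v z, Finsupp.single 0 w,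
      isQuantumMatrix_addRow hv hz, ?_⟩
    choose c hc h using orderedMonomial_addRow (m := m) (n := n) hv z
    have h1 := Finsupp.linearIndependent_single (R := F) (ι := Fin n → ℤ)
      (fun _ => fun C : Fin m → Fin n → ℕ => orderedMonomial z C w) (fun _ => hli)
    have h2 := h1.comp (fun C : Fin (m + 1) → Fin n → ℕ =>
      ⟨fun j => (C 0 j : ℤ), fun i => C i.succ⟩) (by
        intro C D hCD
        simp only [Sigma.mk.injEq, heq_eq_eq] at hCD
        ext i j
        refine Fin.cases ?_ (fun i => ?_) i
        · have := congrFun hCD.1 j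
          simpa using this
        · exact congrFun (congrFun hCD.2 i) j)
    have h3 := h2.units_smul (fun C => Units.mk0 (c C) (hc C))
    simp only [h]
    exact h3



theorem linearIndependent_monomial (n : ℕ) :
    LinearIndependent K (monomial (n := n)) := by
  obtain ⟨V, _, _, z, w, hz, hli⟩ := exists_representation q_sq_ne_zero n n
  let φ : OqM n →ₐ[K] Module.End K V := RingQuot.liftAlgHom K
    ⟨FreeAlgebra.lift K (fun p : Fin n × Fin n => z p.1 p.2), by
      intro x y h
      induction h with
      | row i j k h => simp [freeZ, hz.row i j k h]
      | col i k j h => simp [freeZ, hz.col i k j h]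
      | anti i j s t h h' => simp only [freeZ, map_mul, FreeAlgebra.lift_ι_apply, hz.anti i j s t h h']
      | diag i j s t h h' =>
        simp only [freeZ, map_mul, map_add, map_smul, FreeAlgebra.lift_ι_apply,
          hz.diag i j s t h h', zpow_neg]
        rfl⟩
  have hφ : ∀ i j, φ (Z i j) = z i j := by
    intro i j
    refine (RingQuot.liftAlgHom_mkAlgHom_apply K _ _ _).trans ?_
    rw [freeZ, FreeAlgebra.lift_ι_apply]
  refine LinearIndependent.of_comp ((LinearMap.applyₗ w).comp φ.toLinearMap) ?_
  have h : ∀ C : Fin n → Fin n → ℕ, φ (monomial C) = orderedMonomial z C := fun C => by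
    simp only [monomial, orderedMonomial, map_list_prod, List.map_map, Function.comp_def, map_pow,
      hφ]
  change LinearIndependent K fun C : Fin n → Fin n → ℕ => φ (monomial C) w
  simpa only [h] using hli

end QMat
end
noncomputable section

namespace QMat

/-! ### Laurent polynomials in q and the bar involution on scalars. -/

section Laurent

theorem aeval_q_injective : Function.Injective (Polynomial.aeval q : Polynomial ℤ →ₐ[ℤ] K) := by
  have h : ((Polynomial.aeval q : Polynomial ℤ →ₐ[ℤ] K) : Polynomial ℤ →+* K) =
      (algebraMap (Polynomial ℚ) K).comp (Polynomial.mapRingHom (Int.castRingHom ℚ)) := by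
    refine Polynomial.ringHom_ext' (RingHom.ext_int _ _) ?_
    simp [q]
  intro x y hxy
  have hx := RingHom.congr_fun h x
  have hy := RingHom.congr_fun h y
  refine Polynomial.map_injective (Int.castRingHom ℚ) Int.cast_injective
    (RatFunc.algebraMap_injective (K := ℚ) ?_)
  exact hx.symm.trans ((show _ = _ from hxy).trans hy)

/-- The Laurent polynomial in `q` with the given coefficients. -/
def laurent : (ℤ →₀ ℤ) →ₗ[ℤ] K := Finsupp.linearCombination ℤ fun k : ℤ => q ^ k

theorem laurent_single (k a : ℤ) : laurent (Finsupp.single k a) = a * q ^ k := by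
  simp [laurent]

theorem laurent_injective : Function.Injective laurent := by
  rw [injective_iff_map_eq_zero]
  intro l hl
  obtain ⟨N, hN⟩ : ∃ N : ℕ, ∀ k ∈ l.support, 0 ≤ k + N := by
    refine ⟨∑ k ∈ l.support, k.natAbs, fun k hk => ?_⟩
    have : k.natAbs ≤ ∑ k ∈ l.support, k.natAbs :=
      Finset.single_le_sum (f := fun k : ℤ => k.natAbs) (fun _ _ => Nat.zero_le _) hk
    omega
  set P : Polynomial ℤ := ∑ k ∈ l.support, Polynomial.monomial (k + N).toNat (l k) with hP
  have hP0 : Polynomial.aeval q P = 0 := by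
    rw [hP, map_sum]
    have : q ^ N * laurent l = 0 := by rw [hl, mul_zero]
    rw [laurent, Finsupp.linearCombination_apply, Finsupp.sum, Finset.mul_sum] at this
    rw [← this]
    refine Finset.sum_congr rfl fun k hk => ?_
    rw [Polynomial.aeval_monomial, ← zpow_natCast, Int.toNat_of_nonneg (hN k hk),
      zpow_add₀ q_ne_zero, zpow_natCast, zsmul_eq_mul, eq_intCast]
    ring
  have hPz : P = 0 := aeval_q_injective (by rw [hP0, map_zero])
  ext k
  by_contra hk
  have hks : k ∈ l.support := Finsupp.mem_support_iff.2 hk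
  have : P.coeff (k + N).toNat = l k := by
    rw [hP, Polynomial.finsetSum_coeff, Finset.sum_eq_single k]
    · simp
    · intro b hb hbk
      rw [Polynomial.coeff_monomial, if_neg]
      have h1 := hN b hb
      have h2 := hN k hks
      omega
    · intro h
      exact absurd hks h
  rw [hPz, Polynomial.coeff_zero] at this
  exact hk this.symm

theorem barK_zpow (k : ℤ) : barK (q ^ k) = q ^ (-k) := by
  rw [map_zpow₀, barK_q, inv_zpow, zpow_neg]

theorem barK_laurent (f : ℤ →₀ ℤ) :
    barK (laurent f) = laurent (f.equivMapDomain (Equiv.neg ℤ)) := by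
  induction f using Finsupp.induction_linear with
  | zero => simp
  | add f g hf hg =>
    rw [map_add, map_add, hf, hg, ← map_add]
    congr 1
    ext
    simp [Finsupp.equivMapDomain_apply]
  | single k a =>
    rw [Finsupp.equivMapDomain_single, laurent_single, laurent_single, map_mul, map_intCast,
      barK_zpow]
    rfl

/-- The subring `ℤ[q, q⁻¹]` of `K`. -/
def ZqPM : Subring K where
  carrier := Set.range laurent
  zero_mem' := ⟨0, map_zero _⟩
  one_mem' := ⟨Finsupp.single 0 1, by simp [laurent_single]⟩
  add_mem' := by
    rintro _ _ ⟨f, rfl⟩ ⟨g, rfl⟩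
    exact ⟨f + g, map_add _ _ _⟩
  neg_mem' := by
    rintro _ ⟨f, rfl⟩
    exact ⟨-f, map_neg _ _⟩
  mul_mem' := by
    rintro _ _ ⟨f, rfl⟩ ⟨g, rfl⟩
    change _ ∈ LinearMap.range laurent
    induction f using Finsupp.induction_linear with
    | zero => simp
    | add f f' hf hf' =>
      rw [map_add, add_mul]
      exact add_mem hf hf'
    | single k a =>
      induction g using Finsupp.induction_linear with
      | zero => simp
      | add g g' hg hg' =>
        rw [map_add, mul_add]
        exact add_mem hg hg'
      | single m b =>
        refine ⟨Finsupp.single (k + m) (a * b), ?_⟩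
        rw [laurent_single, laurent_single, laurent_single, zpow_add₀ q_ne_zero]
        push_cast
        ring

theorem q_zpow_mem_ZqPM (k : ℤ) : q ^ k ∈ ZqPM := ⟨Finsupp.single k 1, by simp [laurent_single]⟩

theorem barK_mem_ZqPM {x : K} (hx : x ∈ ZqPM) : barK x ∈ ZqPM := by
  obtain ⟨f, rfl⟩ := hx
  exact ⟨_, (barK_laurent f).symm⟩

theorem barK_comp_barK : barK.comp barK = RingHom.id K := by
  refine IsLocalization.ringHom_ext (nonZeroDivisors (Polynomial ℚ)) ?_
  refine Polynomial.ringHom_ext' (RingHom.ext_rat _ _) ?_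
  have : barK (barK q) = q := by rw [barK_q, map_inv₀, barK_q, inv_inv]
  simpa [q] using this

theorem barK_barK (x : K) : barK (barK x) = x := RingHom.congr_fun barK_comp_barK x

theorem mem_qIntPoly {x : K} : x ∈ qIntPoly ↔ q⁻¹ * x ∈ Zq := by
  constructor
  · rintro ⟨p, rfl⟩
    exact ⟨p, by rw [inv_mul_cancel_left₀ q_ne_zero]; rfl⟩
  · rintro ⟨p, hp⟩
    exact ⟨p, by rw [show Polynomial.aeval q p = q⁻¹ * x from hp, mul_inv_cancel_left₀ q_ne_zero]⟩

theorem qIntPoly_zero : (0 : K) ∈ qIntPoly := ⟨0, by simp⟩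

theorem exists_laurent_of_mem_qIntPoly {x : K} (hx : x ∈ qIntPoly) :
    ∃ f, laurent f = x ∧ ∀ k ≤ 0, f k = 0 := by
  obtain ⟨p, rfl⟩ := hx
  induction p using Polynomial.induction_on' with
  | add p p' hp hp' =>
    obtain ⟨f, hf, hf0⟩ := hp
    obtain ⟨f', hf', hf0'⟩ := hp'
    refine ⟨f + f', by rw [map_add, map_add, mul_add, hf, hf'], fun k hk => ?_⟩
    rw [Finsupp.add_apply, hf0 k hk, hf0' k hk, add_zero]
  | monomial m a =>
    refine ⟨Finsupp.single (m + 1) a, ?_, fun k hk => Finsupp.single_eq_of_ne (by omega)⟩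
    rw [laurent_single, Polynomial.aeval_monomial, zpow_add₀ q_ne_zero, zpow_natCast, zpow_one,
      eq_intCast]
    ring

/-- All exponents of x are positive, while those of barK x are both positive and negatives of the
exponents of x. -/
theorem eq_zero_of_mem_qIntPoly {x : K} (hx : x ∈ qIntPoly) (hb : barK x ∈ qIntPoly) : x = 0 := by
  obtain ⟨f, rfl, hf⟩ := exists_laurent_of_mem_qIntPoly hx
  obtain ⟨g, hg, hg0⟩ := exists_laurent_of_mem_qIntPoly hb
  rw [barK_laurent] at hg
  have e := laurent_injective hg
  rw [show f = 0 from ?_, map_zero]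
  ext k
  rcases le_or_gt k 0 with hk | hk
  · exact hf k hk
  · have := DFunLike.congr_fun e (-k)
    rw [hg0 (-k) (by omega), Finsupp.equivMapDomain_apply] at this
    simpa using this.symm

theorem exists_sub_barK {x : K} (hx : x ∈ ZqPM) (hb : barK x = -x) :
    ∃ g ∈ qIntPoly, x = g - barK g := by
  obtain ⟨f, rfl⟩ := hx
  rw [barK_laurent, ← map_neg] at hb
  have e := laurent_injective hb
  have e' (k : ℤ) : f (-k) = -f k := by
    have := DFunLike.congr_fun e k
    rwa [Finsupp.equivMapDomain_apply] at this
  -- The part with positive exponents. Antisymmetry makes the constant coefficient zero and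
  -- determines the negative part.
  refine ⟨laurent (f.filter fun k => 0 < k), ?_, ?_⟩
  · rw [mem_qIntPoly, laurent, Finsupp.linearCombination_apply, Finsupp.sum, Finset.mul_sum]
    refine sum_mem fun k hk => ?_
    rw [Finsupp.support_filter, Finset.mem_filter] at hk
    have : q⁻¹ * (f.filter (fun k => 0 < k) k • q ^ k) =
        (f.filter (fun k => 0 < k) k : ℤ) • q ^ (k - 1).toNat := by
      rw [← zpow_natCast, Int.toNat_of_nonneg (by omega), zpow_sub_one₀ q_ne_zero, zsmul_eq_mul,
        zsmul_eq_mul]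
      ring
    rw [this]
    exact zsmul_mem (pow_mem q_mem_Zq _) _
  · rw [barK_laurent, ← map_sub]
    congr 1
    ext k
    rw [Finsupp.sub_apply, Finsupp.equivMapDomain_apply, Finsupp.filter_apply, Finsupp.filter_apply]
    have h1 := e' k
    have h2 : (Equiv.neg ℤ).symm k = -k := rfl
    rw [h2]
    rcases lt_trichotomy k 0 with hk | rfl | hk
    · rw [if_neg (by omega), if_pos (by omega)]; omega
    · simp at *; omega
    · rw [if_pos hk, if_neg (by omega)]; omega

end Laurent

end QMat
end
noncomputable section

namespace QMat

variable {n : ℕ}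

/-! ### The lexicographic order on matrices with fixed row and column sums. -/

section Order

/-- A matrix as an element of a lexicographically ordered product. -/
def lexKey (A : Matrix (Fin n) (Fin n) ℕ) : Lex ((Fin n ×ₗ Fin n) → ℕ) :=
  toLex fun p => A (ofLex p).1 (ofLex p).2

theorem lexKey_injective : Function.Injective (lexKey (n := n)) := fun A B h => by
  ext i j
  exact congrFun (congrArg ofLex h) (toLex (i, j))

theorem lexLT_iff {A B : Matrix (Fin n) (Fin n) ℕ} : LexLT B A ↔ lexKey B < lexKey A := by
  constructor
  · rintro ⟨i, j, h, h'⟩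
    refine ⟨toLex (i, j), fun p hp => h' _ _ ?_, h⟩
    exact (Prod.Lex.lt_iff.1 hp).imp id id
  · rintro ⟨p, h, h'⟩
    refine ⟨(ofLex p).1, (ofLex p).2, h', fun k l hkl => h (toLex (k, l)) ?_⟩
    exact Prod.Lex.lt_iff.2 hkl

theorem LexLT.add_right {A B : Matrix (Fin n) (Fin n) ℕ} (h : LexLT B A)
    (C : Matrix (Fin n) (Fin n) ℕ) : LexLT (B + C) (A + C) := by
  obtain ⟨i, j, h, h'⟩ := h
  refine ⟨i, j, by simpa using h, fun k l hkl => ?_⟩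
  rw [Matrix.add_apply, Matrix.add_apply, h' k l hkl]

/-- `B` is lexicographically smaller than `A` and has the same row and column sums. -/
def Below (B A : Matrix (Fin n) (Fin n) ℕ) : Prop := LexLT B A ∧ SameSums B A

theorem SameSums.trans {A B C : Matrix (Fin n) (Fin n) ℕ} (h : SameSums C B) (h' : SameSums B A) :
    SameSums C A :=
  ⟨fun i => (h.1 i).trans (h'.1 i), fun j => (h.2 j).trans (h'.2 j)⟩

theorem SameSums.add_right {A B : Matrix (Fin n) (Fin n) ℕ} (h : SameSums B A)
    (C : Matrix (Fin n) (Fin n) ℕ) : SameSums (B + C) (A + C) :=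
  ⟨fun i => by simp [Finset.sum_add_distrib, h.1 i],
    fun j => by simp [Finset.sum_add_distrib, h.2 j]⟩

theorem Below.trans {A B C : Matrix (Fin n) (Fin n) ℕ} (h : Below C B) (h' : Below B A) :
    Below C A :=
  ⟨lexLT_iff.2 ((lexLT_iff.1 h.1).trans (lexLT_iff.1 h'.1)), h.2.trans h'.2⟩

theorem Below.irrefl (A : Matrix (Fin n) (Fin n) ℕ) : ¬ Below A A := fun h =>
  lt_irrefl _ (lexLT_iff.1 h.1)

theorem Below.add_right {A B : Matrix (Fin n) (Fin n) ℕ} (h : Below B A)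
    (C : Matrix (Fin n) (Fin n) ℕ) : Below (B + C) (A + C) :=
  ⟨h.1.add_right C, h.2.add_right C⟩

theorem below_wf : WellFounded (Below (n := n)) :=
  Subrelation.wf (fun h => lexLT_iff.1 h.1) (InvImage.wf lexKey (wellFounded_lt))

end Order

/-! ### Straightening words in the generators; unitriangularity of bar. -/

section Words

/-- The product of the generators in a list of positions. -/
def wordProd (w : List (Fin n × Fin n)) : OqM n := (w.map fun p => Z p.1 p.2).prod

/-- The exponent matrix of a list of positions. -/
def content : List (Fin n × Fin n) → Matrix (Fin n) (Fin n) ℕ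
  | [] => 0
  | x :: w => content w + Matrix.single x.1 x.2 1

/-- The sign of the comparison of `a` with `b`. -/
def cmpSign (a b : Fin n) : ℤ := if a < b then 1 else if b < a then -1 else 0

/-- Half the exponent of `q` in the exchange of two generators in a common row or column. -/
def kappa (x y : Fin n × Fin n) : ℤ :=
  if x.1 = y.1 then cmpSign x.2 y.2 else if x.2 = y.2 then cmpSign x.1 y.1 else 0

theorem cmpSign_swap (a b : Fin n) : cmpSign b a = -cmpSign a b := by
  unfold cmpSign
  split_ifs <;> first | rfl | omega

theorem kappa_swap (x y : Fin n × Fin n) : kappa y x = -kappa x y := by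
  unfold kappa
  rw [cmpSign_swap x.1, cmpSign_swap x.2]
  simp only [eq_comm (a := y.1), eq_comm (a := y.2)]
  split_ifs <;> simp

/-- The normalizing exponent of a list of positions. -/
def wordExp : List (Fin n × Fin n) → ℤ
  | [] => 0
  | x :: w => (w.map (kappa x)).sum + wordExp w

/-- The normalized product of the generators in a list of positions. -/
def normWord (w : List (Fin n × Fin n)) : OqM n := q ^ (-wordExp w) • wordProd w

theorem wordProd_cons (x : Fin n × Fin n) (w : List (Fin n × Fin n)) :
    wordProd (x :: w) = Z x.1 x.2 * wordProd w := rfl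

theorem wordProd_append (w w' : List (Fin n × Fin n)) :
    wordProd (w ++ w') = wordProd w * wordProd w' := by simp [wordProd]

theorem bar_one : bar (1 : OqM n) = 1 := by
  unfold bar
  rw [map_one]
  rfl

theorem bar_wordProd (w : List (Fin n × Fin n)) : bar (wordProd w) = wordProd w.reverse := by
  induction w with
  | nil => exact bar_one
  | cons x w ih =>
    rw [wordProd_cons, bar_mul, bar_Z, ih, List.reverse_cons, wordProd_append]
    simp [wordProd]

theorem wordExp_append_singleton (w : List (Fin n × Fin n)) (x : Fin n × Fin n) :
    wordExp (w ++ [x]) = wordExp w - (w.map (kappa x)).sum := by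
  induction w with
  | nil => simp [wordExp]
  | cons y w ih =>
    rw [List.cons_append, wordExp, ih, wordExp]
    simp only [List.map_append, List.sum_append, List.map_cons, List.map_nil, List.sum_cons,
      List.sum_nil, kappa_swap x y]
    ring

theorem wordExp_reverse (w : List (Fin n × Fin n)) : wordExp w.reverse = -wordExp w := by
  induction w with
  | nil => simp [wordExp]
  | cons y w ih =>
    rw [List.reverse_cons, wordExp_append_singleton, ih, wordExp, List.map_reverse,
      List.sum_reverse]
    ring

/-- The exponent `kappa` is antisymmetric, so reversing a word negates its normalizing exponent,
just as bar inverts q. -/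
theorem bar_normWord (w : List (Fin n × Fin n)) : bar (normWord w) = normWord w.reverse := by
  rw [normWord, bar_smul, bar_wordProd, barK_zpow, normWord, wordExp_reverse]

theorem content_perm {w w' : List (Fin n × Fin n)} (h : w.Perm w') : content w = content w' := by
  induction h with
  | nil => rfl
  | cons x _ ih => rw [content, content, ih]
  | swap x y l => simp only [content, add_right_comm]
  | trans _ _ h h' => exact h.trans h'

/-- The span over `ℤ[q, q⁻¹]` of the words whose content is below `A`. -/
def wordSpan (A : Matrix (Fin n) (Fin n) ℕ) : Submodule ZqPM (OqM n) :=
  Submodule.span ZqPM (wordProd '' {w | Below (content w) A})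

theorem ZqPM_smul_mem {T : Submodule ZqPM (OqM n)} {x : OqM n} (hx : x ∈ T) {c : K}
    (hc : c ∈ ZqPM) : c • x ∈ T := T.smul_mem (⟨c, hc⟩ : ZqPM) hx

theorem wordProd_mem_wordSpan {w : List (Fin n × Fin n)} {A : Matrix (Fin n) (Fin n) ℕ}
    (h : Below (content w) A) : wordProd w ∈ wordSpan A := Submodule.subset_span ⟨w, h, rfl⟩

theorem Z_mul_mem_wordSpan (x : Fin n × Fin n) {A : Matrix (Fin n) (Fin n) ℕ} {y : OqM n}
    (hy : y ∈ wordSpan A) : Z x.1 x.2 * y ∈ wordSpan (A + Matrix.single x.1 x.2 1) := by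
  induction hy using Submodule.span_induction with
  | mem y h =>
    obtain ⟨w, hw, rfl⟩ := h
    rw [← wordProd_cons]
    exact wordProd_mem_wordSpan (hw.add_right _)
  | zero => rw [mul_zero]; exact zero_mem _
  | add y y' _ _ h h' => rw [mul_add]; exact add_mem h h'
  | smul c y _ h => rw [mul_smul_comm]; exact Submodule.smul_mem _ c h

/-- The first entry where the two matrices differ is (i, j), which is lowered by one; the exchanged
positions occupy the same rows and columns. This makes the correction term of the diagonal relation
lower. -/
theorem below_exchange {i j s t : Fin n} (h : i < s) (h' : j < t) :
    Below (Matrix.single i t 1 + Matrix.single s j 1 : Matrix (Fin n) (Fin n) ℕ)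
      (Matrix.single i j 1 + Matrix.single s t 1) := by
  have e1 : i ≠ s := h.ne
  have e2 : j ≠ t := h'.ne
  refine ⟨⟨i, j, ?_, fun k l hkl => ?_⟩, fun k => ?_, fun l => ?_⟩
  · simp [e1.symm, e2.symm]
  · have : ¬ (i = k ∧ j = l) ∧ ¬ (i = k ∧ t = l) ∧ ¬ (s = k ∧ t = l) ∧ ¬ (s = k ∧ j = l) := by
      refine ⟨?_, ?_, ?_, ?_⟩ <;> rintro ⟨rfl, rfl⟩ <;> omega
    simp [this]
  · simp [Matrix.single_apply, Finset.sum_add_distrib, ite_and]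
  · simp [Matrix.single_apply, Finset.sum_add_distrib, ite_and, add_comm]

theorem smul_sub_OqM (c : K) (x y : OqM n) : c • (x - y) = c • x - c • y := smul_sub c x y

theorem exchange_mem_wordSpan {x y : Fin n × Fin n} (h : x.1 < y.1) (h' : x.2 < y.2)
    (w : List (Fin n × Fin n)) :
    wordProd (x :: y :: w) - wordProd (y :: x :: w) ∈ wordSpan (content (x :: y :: w)) := by
  simp only [wordProd_cons]
  rw [← mul_assoc, ← mul_assoc, Z_diag _ _ _ _ h h', add_mul, add_sub_cancel_left, smul_mul_assoc,
    mul_assoc]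
  refine ZqPM_smul_mem ?_ (sub_mem (pow_mem ?_ 2) (q_zpow_mem_ZqPM _))
  · have := wordProd_mem_wordSpan (w := (x.1, y.2) :: (y.1, x.2) :: w)
      (A := content (x :: y :: w)) ?_
    · simpa only [wordProd_cons] using this
    · have := (below_exchange h h').add_right (content w)
      convert this using 1 <;> simp only [content] <;> abel
  · simpa using q_zpow_mem_ZqPM 1

/-- When two adjacent generators q-commute, the normalization makes the two words equal. Only the
diagonal relation leaves a correction, and it is a word of lower content. -/
theorem normWord_swap (x y : Fin n × Fin n) (w : List (Fin n × Fin n)) :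
    normWord (x :: y :: w) - normWord (y :: x :: w) ∈ wordSpan (content (x :: y :: w)) := by
  wlog h : x.1 < y.1 ∨ x.1 = y.1 ∧ x.2 ≤ y.2 generalizing x y with H
  · have := H y x (by omega)
    rw [← neg_sub, content_perm (List.Perm.swap y x w)]
    exact neg_mem this
  have hexp : ∀ x y : Fin n × Fin n, -wordExp (x :: y :: w) =
      -kappa x y - ((w.map (kappa x)).sum + (w.map (kappa y)).sum + wordExp w) := by
    intro x y
    simp only [wordExp, List.map_cons, List.sum_cons]
    ring
  have hcomm : ∀ k : ℤ, kappa x y = k →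
      Z x.1 x.2 * Z y.1 y.2 = q ^ (2 * k) • (Z y.1 y.2 * Z x.1 x.2) →
      normWord (x :: y :: w) = normWord (y :: x :: w) := by
    intro k hk hz
    rw [normWord, normWord, hexp, hexp, kappa_swap x y, hk, wordProd_cons, wordProd_cons,
      wordProd_cons, wordProd_cons, ← mul_assoc, hz, smul_mul_assoc, mul_assoc, smul_smul,
      ← zpow_add₀ q_ne_zero]
    congr 2
    ring
  have e2 : q ^ (2 * 1 : ℤ) = q ^ 2 := by rw [mul_one]; exact zpow_natCast q 2
  rcases h with h | ⟨h, h'⟩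
  · rcases lt_trichotomy x.2 y.2 with h' | h' | h'
    · have hk : kappa x y = 0 := by rw [kappa, if_neg h.ne, if_neg h'.ne]
      rw [normWord, normWord, hexp, hexp, kappa_swap x y, hk, neg_zero, neg_zero,
        add_comm (w.map (kappa y)).sum, ← smul_sub_OqM]
      exact ZqPM_smul_mem (exchange_mem_wordSpan h h' w) (q_zpow_mem_ZqPM _)
    · rw [hcomm 1, sub_self]
      · exact zero_mem _
      · rw [kappa, if_neg h.ne, if_pos h', cmpSign, if_pos h]
      · rw [e2, ← h', Z_col _ _ _ h]
    · rw [hcomm 0, sub_self]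
      · exact zero_mem _
      · rw [kappa, if_neg h.ne, if_neg h'.ne']
      · rw [mul_zero, zpow_zero, one_smul, Z_anti _ _ _ _ h h']
  · rcases h'.lt_or_eq with h' | h'
    · rw [hcomm 1, sub_self]
      · exact zero_mem _
      · rw [kappa, if_pos h, cmpSign, if_pos h']
      · rw [e2, ← h, Z_row _ _ _ h']
    · rw [Prod.ext h h', sub_self]
      exact zero_mem _

theorem sum_kappa_perm {w w' : List (Fin n × Fin n)} (h : w.Perm w') (x : Fin n × Fin n) :
    (w.map (kappa x)).sum = (w'.map (kappa x)).sum := (h.map _).sum_eq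

theorem normWord_cons (x : Fin n × Fin n) (w : List (Fin n × Fin n)) :
    normWord (x :: w) = q ^ (-(w.map (kappa x)).sum) • (Z x.1 x.2 * normWord w) := by
  rw [normWord, normWord, wordExp, wordProd_cons, mul_smul_comm, smul_smul,
    ← zpow_add₀ q_ne_zero, neg_add]

theorem normWord_perm {w w' : List (Fin n × Fin n)} (h : w.Perm w') :
    normWord w - normWord w' ∈ wordSpan (content w) := by
  induction h with
  | nil => rw [sub_self]; exact zero_mem _
  | cons x h ih =>
    rw [normWord_cons, normWord_cons, sum_kappa_perm h, ← smul_sub_OqM, ← mul_sub]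
    exact ZqPM_smul_mem (Z_mul_mem_wordSpan x ih) (q_zpow_mem_ZqPM _)
  | swap x y l => exact normWord_swap y x l
  | trans h1 _ ih1 ih2 =>
    rw [← content_perm h1] at ih2
    have := add_mem ih1 ih2
    rwa [sub_add_sub_cancel] at this

/-- The positions, with multiplicities given by `A`, in the lexicographic order. -/
def word (A : Matrix (Fin n) (Fin n) ℕ) : List (Fin n × Fin n) :=
  (List.finRange n).flatMap fun i => (List.finRange n).flatMap fun j =>
    List.replicate (A i j) (i, j)

theorem wordProd_flatMap {ι : Type*} (l : List ι) (f : ι → List (Fin n × Fin n)) :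
    wordProd (l.flatMap f) = (l.map fun i => wordProd (f i)).prod := by
  induction l with
  | nil => rfl
  | cons a l ih => rw [List.flatMap_cons, wordProd_append, ih, List.map_cons, List.prod_cons]

theorem wordProd_word (A : Matrix (Fin n) (Fin n) ℕ) : wordProd (word A) = monomial A := by
  simp only [word, wordProd_flatMap, monomial]
  simp [wordProd]

theorem content_append (w w' : List (Fin n × Fin n)) :
    content (w ++ w') = content w + content w' := by
  induction w with
  | nil => simp [content]
  | cons x w ih => rw [List.cons_append, content, ih, content, add_right_comm]

theorem content_flatMap {ι : Type*} (l : List ι) (f : ι → List (Fin n × Fin n)) :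
    content (l.flatMap f) = (l.map fun i => content (f i)).sum := by
  induction l with
  | nil => rfl
  | cons a l ih => rw [List.flatMap_cons, content_append, ih, List.map_cons, List.sum_cons]

theorem content_replicate (k : ℕ) (x : Fin n × Fin n) :
    content (List.replicate k x) = Matrix.single x.1 x.2 k := by
  induction k with
  | zero => simp [content]
  | succ k ih => rw [List.replicate_succ, content, ih, ← Matrix.single_add]

theorem content_word (A : Matrix (Fin n) (Fin n) ℕ) : content (word A) = A := by
  simp only [word, content_flatMap, content_replicate, ← Fin.sum_univ_def]
  exact (Matrix.matrix_eq_sum_single A).symm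

theorem content_apply (w : List (Fin n × Fin n)) (i j : Fin n) :
    content w i j = w.count (i, j) := by
  induction w with
  | nil => simp [content]
  | cons x w ih =>
    rw [content, Matrix.add_apply, ih, List.count_cons, Matrix.single_apply]
    simp [Prod.ext_iff]

theorem perm_of_content_eq {w w' : List (Fin n × Fin n)} (h : content w = content w') :
    w.Perm w' := by
  rw [List.perm_iff_count]
  intro p
  rw [← content_apply w p.1 p.2, h, content_apply w' p.1 p.2]

theorem word_sorted (A : Matrix (Fin n) (Fin n) ℕ) :
    (word A).Pairwise fun x y => x.1 < y.1 ∨ x.1 = y.1 ∧ x.2 ≤ y.2 := by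
  have hs : (List.finRange n).Pairwise (· < ·) := List.pairwise_lt_finRange n
  rw [word, List.pairwise_flatMap]
  refine ⟨fun i _ => ?_, hs.imp fun {i i'} h x hx y hy => ?_⟩
  · rw [List.pairwise_flatMap]
    refine ⟨fun j _ => ?_, hs.imp fun {j j'} h x hx y hy => ?_⟩
    · rw [List.pairwise_replicate]
      exact Or.inr (Or.inr ⟨rfl, le_rfl⟩)
    · rw [List.eq_of_mem_replicate hx, List.eq_of_mem_replicate hy]
      exact Or.inr ⟨rfl, h.le⟩
  · simp only [List.mem_flatMap, List.mem_replicate] at hx hy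
    obtain ⟨j, _, _, rfl⟩ := hx
    obtain ⟨j', _, _, rfl⟩ := hy
    exact Or.inl h

theorem sum_kappa_of_le {x : Fin n × Fin n} {w : List (Fin n × Fin n)}
    (h : ∀ y ∈ w, x.1 < y.1 ∨ x.1 = y.1 ∧ x.2 ≤ y.2) :
    (w.map (kappa x)).sum + 2 * (content w x.1 x.2 : ℤ) =
      ((∑ j, content w x.1 j + ∑ i, content w i x.2 : ℕ) : ℤ) := by
  induction w with
  | nil => simp [content]
  | cons y w ih =>
    have ih := ih fun z hz => h z (List.mem_cons_of_mem _ hz)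
    have hy := h y List.mem_cons_self
    simp only [content, Matrix.add_apply, Finset.sum_add_distrib, List.map_cons, List.sum_cons]
    have h1 : ∑ j, (Matrix.single y.1 y.2 1 : Matrix (Fin n) (Fin n) ℕ) x.1 j =
        if y.1 = x.1 then 1 else 0 := by simp [Matrix.single_apply, ite_and]
    have h2 : ∑ i, (Matrix.single y.1 y.2 1 : Matrix (Fin n) (Fin n) ℕ) i x.2 =
        if y.2 = x.2 then 1 else 0 := by simp [Matrix.single_apply, ite_and]
    have h3 : kappa x y + 2 * ((Matrix.single y.1 y.2 1 : Matrix (Fin n) (Fin n) ℕ) x.1 x.2 : ℤ) =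
        (((if y.1 = x.1 then 1 else 0) + if y.2 = x.2 then 1 else 0 : ℕ) : ℤ) := by
      rw [Matrix.single_apply, kappa, cmpSign, cmpSign]
      rcases hy with hy | ⟨hy, hy'⟩
      · simp [hy.ne, hy.ne', hy, eq_comm (a := y.2)]
      · rcases hy'.lt_or_eq with hy' | hy'
        · simp [hy, hy', hy'.ne']
        · simp [hy, hy']
    rw [h1, h2]
    push_cast at *
    linarith

/-- The identity of `two_mul_normExp` for sorted words, proved by adding one letter in front.
Comparing the two identities gives `wordExp (word A) = normExp A`. -/
theorem two_mul_wordExp {w : List (Fin n × Fin n)}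
    (h : w.Pairwise fun x y => x.1 < y.1 ∨ x.1 = y.1 ∧ x.2 ≤ y.2) :
    2 * (wordExp w + sqSum (content w)) =
      ((∑ i, (∑ j, content w i j) ^ 2 + ∑ j, (∑ i, content w i j) ^ 2 : ℕ) : ℤ) := by
  induction w with
  | nil => simp [content, wordExp, sqSum]
  | cons x w ih =>
    obtain ⟨hx, hw⟩ := List.pairwise_cons.1 h
    have ih := ih hw
    have hk := sum_kappa_of_le hx
    set A := content w with hA
    have h1 : sqSum (A + Matrix.single x.1 x.2 1) = sqSum A + 2 * A x.1 x.2 + 1 := by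
      simp only [sqSum, Matrix.add_apply, Matrix.single_apply]
      have : ∀ i j, (A i j + if x.1 = i ∧ x.2 = j then 1 else 0) *
          (A i j + if x.1 = i ∧ x.2 = j then 1 else 0) = A i j * A i j +
            if x.1 = i then if x.2 = j then 2 * A i j + 1 else 0 else 0 := by
        intro i j
        by_cases hi : x.1 = i <;> by_cases hj : x.2 = j <;> simp [hi, hj]
        ring
      simp only [this, Finset.sum_add_distrib]
      simp [Finset.sum_ite_irrel]
      ring
    have h2 : ∑ i, (∑ j, (A + Matrix.single x.1 x.2 1 : Matrix (Fin n) (Fin n) ℕ) i j) ^ 2 =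
        ∑ i, (∑ j, A i j) ^ 2 + (2 * ∑ j, A x.1 j + 1) := by
      simp only [Matrix.add_apply, Finset.sum_add_distrib]
      have : ∀ i, (∑ j, A i j + ∑ j, (Matrix.single x.1 x.2 1 : Matrix (Fin n) (Fin n) ℕ) i j) ^ 2 =
          (∑ j, A i j) ^ 2 + if x.1 = i then 2 * ∑ j, A i j + 1 else 0 := by
        intro i
        by_cases hi : x.1 = i <;> simp [Matrix.single_apply, hi]
        ring
      simp only [this, Finset.sum_add_distrib]
      simp
    have h3 : ∑ j, (∑ i, (A + Matrix.single x.1 x.2 1 : Matrix (Fin n) (Fin n) ℕ) i j) ^ 2 =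
        ∑ j, (∑ i, A i j) ^ 2 + (2 * ∑ i, A i x.2 + 1) := by
      simp only [Matrix.add_apply, Finset.sum_add_distrib]
      have : ∀ j, (∑ i, A i j + ∑ i, (Matrix.single x.1 x.2 1 : Matrix (Fin n) (Fin n) ℕ) i j) ^ 2 =
          (∑ i, A i j) ^ 2 + if x.2 = j then 2 * ∑ i, A i j + 1 else 0 := by
        intro i
        by_cases hi : x.2 = i <;> simp [Matrix.single_apply, hi]
        ring
      simp only [this, Finset.sum_add_distrib]
      simp
    rw [content, ← hA, h1, h2, h3, wordExp]
    push_cast at *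
    linarith

theorem wordExp_word (A : Matrix (Fin n) (Fin n) ℕ) : wordExp (word A) = normExp A := by
  have h1 := two_mul_wordExp (word_sorted A)
  rw [content_word, ← two_mul_normExp] at h1
  push_cast at h1
  omega

theorem normWord_word (A : Matrix (Fin n) (Fin n) ℕ) : normWord (word A) = normMonomial A := by
  rw [normWord, wordExp_word, wordProd_word, normMonomial]

/-- The span over `ℤ[q, q⁻¹]` of the normalized monomials below `A`. -/
def monoSpan (A : Matrix (Fin n) (Fin n) ℕ) : Submodule ZqPM (OqM n) :=
  Submodule.span ZqPM (normMonomial '' {B | Below B A})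

/-- Well-founded straightening: sorting a word changes it by words of still lower content, to which
the induction hypothesis applies. -/
theorem wordSpan_le_monoSpan (A : Matrix (Fin n) (Fin n) ℕ) : wordSpan A ≤ monoSpan A := by
  induction A using below_wf.induction with
  | _ A ih =>
    refine Submodule.span_le.2 ?_
    rintro _ ⟨w, hw, rfl⟩
    have h1 : monoSpan (content w) ≤ monoSpan A :=
      Submodule.span_mono (Set.image_mono fun B hB => Below.trans hB hw)
    have h2 := h1 (ih _ hw (normWord_perm (w := w) (w' := word (content w)) ?_))
    · rw [normWord_word] at h2
      have h3 : normMonomial (content w) ∈ monoSpan A := Submodule.subset_span ⟨_, hw, rfl⟩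
      have h4 := add_mem h2 h3
      rw [sub_add_cancel, normWord] at h4
      have := ZqPM_smul_mem h4 (q_zpow_mem_ZqPM (wordExp w))
      rwa [smul_smul, ← zpow_add₀ q_ne_zero, add_neg_cancel, zpow_zero, one_smul] at this
    · exact perm_of_content_eq (content_word _).symm

theorem bar_normMonomial_sub_mem (A : Matrix (Fin n) (Fin n) ℕ) :
    bar (normMonomial A) - normMonomial A ∈ monoSpan A := by
  refine wordSpan_le_monoSpan A ?_
  have := normWord_perm (List.reverse_perm (word A))
  rwa [← bar_normWord, normWord_word, content_perm (List.reverse_perm _), content_word] at this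

end Words

end QMat
end
noncomputable section

namespace QMat

variable {n : ℕ}

/-! ### The bar involution, the transposition, and the reflection in the antidiagonal. -/

section Symmetries

theorem OqM.induction_on {P : OqM n → Prop} (hone : P 1) (hsmul : ∀ (c : K) x, P x → P (c • x))
    (hZ : ∀ i j, P (Z i j)) (hadd : ∀ x y, P x → P y → P (x + y))
    (hmul : ∀ x y, P x → P y → P (x * y)) (x : OqM n) : P x := by
  obtain ⟨a, rfl⟩ := RingQuot.mkAlgHom_surjective K (Rel n) x
  induction a using FreeAlgebra.induction with
  | grade0 c =>
    rw [AlgHom.commutes, Algebra.algebraMap_eq_smul_one]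
    exact hsmul c _ hone
  | grade1 p => exact hZ p.1 p.2
  | mul a b ha hb => rw [map_mul]; exact hmul _ _ ha hb
  | add a b ha hb => rw [map_add]; exact hadd _ _ ha hb

theorem bar_zero : bar (0 : OqM n) = 0 := by
  rw [← zero_smul K (0 : OqM n), bar_smul, map_zero, zero_smul, zero_smul]

theorem bar_sub (x y : OqM n) : bar (x - y) = bar x - bar y := by
  rw [eq_sub_iff_add_eq, ← bar_add, sub_add_cancel]

theorem bar_bar (x : OqM n) : bar (bar x) = x := by
  induction x using OqM.induction_on with
  | hone => rw [bar_one, bar_one]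
  | hsmul c x hx => rw [bar_smul, bar_smul, barK_barK, hx]
  | hZ i j => rw [bar_Z, bar_Z]
  | hadd x y hx hy => rw [bar_add, bar_add, hx, hy]
  | hmul x y hx hy => rw [bar_mul, bar_mul, hx, hy]

theorem bar_sigma (x : OqM n) : bar (sigma n x) = sigma n (bar x) := by
  induction x using OqM.induction_on with
  | hone => rw [map_one, bar_one, map_one]
  | hsmul c x hx => rw [map_smul, bar_smul, bar_smul, map_smul, hx]
  | hZ i j => rw [bar_Z, sigma_Z, bar_Z]
  | hadd x y hx hy => rw [map_add, bar_add, bar_add, map_add, hx, hy]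
  | hmul x y hx hy => rw [map_mul, bar_mul, bar_mul, map_mul, hx, hy]

/-- The anti-automorphism of the `K`-algebra `O_q(M(n))` that reflects the matrix of generators
in its antidiagonal, as a homomorphism to the opposite algebra. -/
def rhoHom (n : ℕ) : OqM n →ₐ[K] (OqM n)ᵐᵒᵖ :=
  RingQuot.liftAlgHom K
    ⟨FreeAlgebra.lift K (fun p : Fin n × Fin n => MulOpposite.op (Z p.2.rev p.1.rev)), by
      intro x y h
      induction h with
      | row i j k h =>
        simp only [freeZ, map_mul, map_smul, FreeAlgebra.lift_ι_apply, ← MulOpposite.op_mul,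
          Z_col _ _ i.rev (Fin.rev_lt_rev.2 h), MulOpposite.op_smul]
      | col i k j h =>
        simp only [freeZ, map_mul, map_smul, FreeAlgebra.lift_ι_apply, ← MulOpposite.op_mul,
          Z_row j.rev _ _ (Fin.rev_lt_rev.2 h), MulOpposite.op_smul]
      | anti i j s t h h' =>
        simp only [freeZ, map_mul, FreeAlgebra.lift_ι_apply, ← MulOpposite.op_mul,
          Z_anti _ _ _ _ (Fin.rev_lt_rev.2 h') (Fin.rev_lt_rev.2 h)]
      | diag i j s t h h' =>
        simp only [freeZ, map_mul, map_add, map_smul, FreeAlgebra.lift_ι_apply,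
          ← MulOpposite.op_mul, ← MulOpposite.op_smul, ← MulOpposite.op_add,
          Z_diag _ _ _ _ (Fin.rev_lt_rev.2 h') (Fin.rev_lt_rev.2 h),
          Z_anti _ _ _ _ (Fin.rev_lt_rev.2 h') (Fin.rev_lt_rev.2 h)]⟩

/-- The anti-automorphism of the `K`-algebra `O_q(M(n))` that reflects the matrix of generators
in its antidiagonal. -/
def rho (x : OqM n) : OqM n := (rhoHom n x).unop

theorem rho_Z (i j : Fin n) : rho (Z i j) = Z j.rev i.rev := by
  refine congrArg MulOpposite.unop ((RingQuot.liftAlgHom_mkAlgHom_apply K _ _ _).trans ?_)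
    (a₂ := MulOpposite.op _)
  rw [freeZ, FreeAlgebra.lift_ι_apply]
  rfl

theorem rho_one : rho (1 : OqM n) = 1 := by rw [rho, map_one, MulOpposite.unop_one]

theorem rho_mul (x y : OqM n) : rho (x * y) = rho y * rho x := by
  rw [rho, map_mul, MulOpposite.unop_mul]; rfl

theorem rho_add (x y : OqM n) : rho (x + y) = rho x + rho y := by
  rw [rho, map_add, MulOpposite.unop_add]; rfl

theorem rho_smul (c : K) (x : OqM n) : rho (c • x) = c • rho x := by
  rw [rho, map_smul, MulOpposite.unop_smul]; rfl

theorem bar_rho (x : OqM n) : bar (rho x) = rho (bar x) := by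
  induction x using OqM.induction_on with
  | hone => rw [rho_one, bar_one, rho_one]
  | hsmul c x hx => rw [rho_smul, bar_smul, bar_smul, rho_smul, hx]
  | hZ i j => rw [bar_Z, rho_Z, bar_Z]
  | hadd x y hx hy => rw [rho_add, bar_add, bar_add, rho_add, hx, hy]
  | hmul x y hx hy => rw [rho_mul, bar_mul, bar_mul, rho_mul, hx, hy]

end Symmetries

/-! ### Interchanging the two orders of a double product. -/

section Exchange

variable {M ι κ : Type*} [Monoid M]

theorem prod_mul_prod_of_commute (f g : κ → M) (l : List κ)
    (h : l.Pairwise fun j j' => Commute (f j') (g j)) :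
    (l.map f).prod * (l.map g).prod = (l.map fun j => f j * g j).prod := by
  induction l with
  | nil => simp
  | cons j l ih =>
    obtain ⟨h1, h2⟩ := List.pairwise_cons.1 h
    rw [List.map_cons, List.map_cons, List.map_cons, List.prod_cons, List.prod_cons,
      List.prod_cons, ← ih h2, mul_assoc, mul_assoc, ← mul_assoc (l.map f).prod]
    rw [(Commute.list_prod_left (l.map f) (g j) ?_).eq, mul_assoc]
    intro x hx
    obtain ⟨j', hj', rfl⟩ := List.mem_map.1 hx
    exact h1 j' hj'

theorem prod_prod_comm_of_commute (f : ι → κ → M) (l : List ι) (m : List κ)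
    (h : l.Pairwise fun i i' => m.Pairwise fun j j' => Commute (f i j') (f i' j)) :
    (l.map fun i => (m.map fun j => f i j).prod).prod =
      (m.map fun j => (l.map fun i => f i j).prod).prod := by
  induction l with
  | nil => simp
  | cons i l ih =>
    obtain ⟨h1, h2⟩ := List.pairwise_cons.1 h
    simp only [List.map_cons, List.prod_cons]
    rw [ih h2, prod_mul_prod_of_commute]
    have h3 : ∀ l' : List ι, (∀ i' ∈ l', m.Pairwise fun j j' => Commute (f i j') (f i' j)) →
        m.Pairwise fun j j' => Commute (f i j') (l'.map fun i' => f i' j).prod := by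
      intro l'
      induction l' with
      | nil => exact fun _ => List.pairwise_of_forall fun _ _ => Commute.one_right _
      | cons i' l' ih' =>
        intro hl
        refine ((hl i' List.mem_cons_self).and
          (ih' fun r hr => hl r (List.mem_cons_of_mem _ hr))).imp fun {j j'} hj => ?_
        rw [List.map_cons, List.prod_cons]
        exact hj.1.mul_right hj.2
    exact h3 l h1

end Exchange

/-! ### Action of the symmetries on normalized monomials. -/

section Monomials

/-- Reading by rows or by columns only exchanges generators at positions (i, j') and (i', j) with i
< i' and j < j', which commute. Hence both symmetries send monomials to monomials. -/
theorem monomial_eq_columns (A : Matrix (Fin n) (Fin n) ℕ) :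
    monomial A = ((List.finRange n).map fun j =>
      ((List.finRange n).map fun i => Z i j ^ A i j).prod).prod := by
  refine prod_prod_comm_of_commute (fun i j => Z i j ^ A i j) _ _ ?_
  have hs : (List.finRange n).Pairwise (· < ·) := List.pairwise_lt_finRange n
  refine hs.imp fun {i i'} h => hs.imp fun {j j'} h' => Commute.pow_pow ?_ _ _
  exact (Z_anti i' j i j' h h').symm

theorem sigma_monomial (A : Matrix (Fin n) (Fin n) ℕ) :
    sigma n (monomial A) = monomial A.transpose := by
  rw [monomial_eq_columns A.transpose, monomial]
  simp only [map_list_prod, List.map_map, Function.comp_def, map_pow, sigma_Z,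
    Matrix.transpose_apply]

theorem normExp_transpose (A : Matrix (Fin n) (Fin n) ℕ) :
    normExp A.transpose = normExp A := by
  have h1 := two_mul_normExp A
  have h2 := two_mul_normExp A.transpose
  have h3 : sqSum A.transpose = sqSum A := Finset.sum_comm
  simp only [Matrix.transpose_apply] at h2
  omega

theorem sigma_normMonomial (A : Matrix (Fin n) (Fin n) ℕ) :
    sigma n (normMonomial A) = normMonomial A.transpose := by
  rw [normMonomial, map_smul, sigma_monomial, normMonomial, normExp_transpose]

/-- The reflection of a matrix in its antidiagonal. -/
def antiTranspose (A : Matrix (Fin n) (Fin n) ℕ) : Matrix (Fin n) (Fin n) ℕ :=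
  fun i j => A j.rev i.rev

theorem antiTranspose_antiTranspose (A : Matrix (Fin n) (Fin n) ℕ) :
    antiTranspose (antiTranspose A) = A := by
  ext i j
  simp [antiTranspose]

theorem rho_list_prod {ι : Type*} (l : List ι) (f : ι → OqM n) :
    rho (l.map f).prod = (l.reverse.map fun i => rho (f i)).prod := by
  induction l with
  | nil => exact rho_one
  | cons a l ih => simp [rho_mul, ih]

theorem rho_pow (x : OqM n) (k : ℕ) : rho (x ^ k) = rho x ^ k := by
  induction k with
  | zero => rw [pow_zero, pow_zero, rho_one]
  | succ k ih => rw [pow_succ, rho_mul, ih, pow_succ']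

theorem rho_monomial (A : Matrix (Fin n) (Fin n) ℕ) :
    rho (monomial A) = monomial (antiTranspose A) := by
  rw [monomial_eq_columns (antiTranspose A), monomial]
  simp only [rho_list_prod, rho_pow, rho_Z, List.finRange_reverse, List.map_map,
    Function.comp_def, Fin.rev_rev]
  rfl

theorem sum_rev {M : Type*} [AddCommMonoid M] (f : Fin n → M) : ∑ i : Fin n, f i.rev = ∑ i, f i :=
  Equiv.sum_comp Fin.revPerm f

theorem normExp_antiTranspose (A : Matrix (Fin n) (Fin n) ℕ) :
    normExp (antiTranspose A) = normExp A := by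
  have h1 := two_mul_normExp A
  have h2 := two_mul_normExp (antiTranspose A)
  have h3 : sqSum (antiTranspose A) = sqSum A := by
    unfold sqSum antiTranspose
    rw [Finset.sum_comm]
    rw [sum_rev fun j => ∑ i : Fin n, A j i.rev * A j i.rev]
    exact Finset.sum_congr rfl fun j _ => sum_rev fun i => A j i * A j i
  have h4 : ∀ i, ∑ j, antiTranspose A i j = ∑ j, A j i.rev := fun i => sum_rev fun j => A j i.rev
  have h5 : ∀ j, ∑ i, antiTranspose A i j = ∑ i, A j.rev i := fun j => sum_rev fun i => A j.rev i
  simp only [h4, h5] at h2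
  rw [sum_rev fun i => (∑ j, A j i) ^ 2, sum_rev fun j => (∑ i, A j i) ^ 2] at h2
  omega

theorem rho_normMonomial (A : Matrix (Fin n) (Fin n) ℕ) :
    rho (normMonomial A) = normMonomial (antiTranspose A) := by
  rw [normMonomial, rho_smul, rho_monomial, normMonomial, normExp_antiTranspose]

end Monomials

/-! ### Existence and uniqueness of the dual canonical basis. -/

section Bases

/-- The linear combination of normalized monomials with the given coefficients. -/
def comb : (Matrix (Fin n) (Fin n) ℕ →₀ K) →ₗ[K] OqM n :=
  Finsupp.linearCombination K normMonomial

theorem comb_single (A : Matrix (Fin n) (Fin n) ℕ) (c : K) :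
    comb (Finsupp.single A c) = c • normMonomial A := Finsupp.linearCombination_single _ _ _

theorem linearIndependent_normMonomial :
    LinearIndependent K (normMonomial : Matrix (Fin n) (Fin n) ℕ → OqM n) :=
  (linearIndependent_monomial n).units_smul
    fun A => Units.mk0 (q ^ (-(normExp A : ℤ))) (zpow_ne_zero _ q_ne_zero)

theorem comb_injective : Function.Injective (comb (n := n)) := linearIndependent_normMonomial

theorem exists_comb_of_mem_span {R : Subring K} {S : Set (Matrix (Fin n) (Fin n) ℕ)} {x : OqM n}
    (hx : x ∈ Submodule.span R (normMonomial '' S)) :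
    ∃ f, comb f = x ∧ (∀ B, f B ∈ R) ∧ ∀ B, f B ≠ 0 → B ∈ S := by
  induction hx using Submodule.span_induction with
  | mem x hx =>
    obtain ⟨B, hB, rfl⟩ := hx
    refine ⟨Finsupp.single B 1, by rw [comb_single, one_smul], fun C => ?_, fun C hC => ?_⟩
    · rw [Finsupp.single_apply]
      split_ifs
      · exact one_mem _
      · exact zero_mem _
    · rw [Finsupp.single_apply] at hC
      split_ifs at hC with h
      · exact h ▸ hB
      · exact absurd rfl hC
  | zero => exact ⟨0, map_zero _, fun _ => zero_mem _, fun _ h => absurd rfl h⟩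
  | add x y _ _ hx hy =>
    obtain ⟨f, hf, hf1, hf2⟩ := hx
    obtain ⟨g, hg, hg1, hg2⟩ := hy
    refine ⟨f + g, by rw [map_add, hf, hg], fun B => add_mem (hf1 B) (hg1 B), fun B hB => ?_⟩
    by_cases h : f B = 0
    · exact hg2 B fun h' => hB (by rw [Finsupp.add_apply, h, h', add_zero])
    · exact hf2 B h
  | smul c x _ hx =>
    obtain ⟨f, hf, hf1, hf2⟩ := hx
    refine ⟨(c : K) • f, by rw [map_smul, hf]; rfl, fun B => mul_mem c.2 (hf1 B), fun B hB => ?_⟩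
    exact hf2 B fun h => hB (by rw [Finsupp.smul_apply, h, smul_zero])

theorem comb_mem_span {R : Subring K} {S : Set (Matrix (Fin n) (Fin n) ℕ)}
    {f : Matrix (Fin n) (Fin n) ℕ →₀ K} (h : ∀ B, f B ∈ R) (h' : ∀ B, f B ≠ 0 → B ∈ S) :
    comb f ∈ Submodule.span R (normMonomial '' S) := by
  rw [comb, Finsupp.linearCombination_apply]
  refine sum_mem fun B hB => ?_
  exact Submodule.smul_mem _ (⟨f B, h B⟩ : R)
    (Submodule.subset_span ⟨B, h' B (Finsupp.mem_support_iff.1 hB), rfl⟩)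

theorem lattice_eq : lattice n = Submodule.span Zq (normMonomial '' Set.univ) := by
  rw [Set.image_univ, lattice]

theorem mem_scale_lattice {x : OqM n} :
    x ∈ scale (-1) (lattice n) ↔ ∃ f, comb f = x ∧ ∀ B, f B ∈ qIntPoly := by
  rw [mem_scale, lattice_eq]
  constructor
  · intro hx
    obtain ⟨f, hf, hf', -⟩ := exists_comb_of_mem_span hx
    refine ⟨q • f, ?_, fun B => ?_⟩
    · rw [map_smul, hf, smul_smul, zpow_neg_one, mul_inv_cancel₀ q_ne_zero, one_smul]
    · rw [mem_qIntPoly, Finsupp.smul_apply, smul_eq_mul, inv_mul_cancel_left₀ q_ne_zero]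
      exact hf' B
  · rintro ⟨f, rfl, hf⟩
    rw [← map_smul]
    refine comb_mem_span (fun B => ?_) fun B _ => Set.mem_univ B
    rw [Finsupp.smul_apply, zpow_neg_one, smul_eq_mul]
    exact mem_qIntPoly.1 (hf B)

/-- A functional that reads off the coefficient of a normalized monomial. -/
theorem exists_coefficient (A : Matrix (Fin n) (Fin n) ℕ) :
    ∃ φ : OqM n →ₗ[K] K, ∀ f, φ (comb f) = f A := by
  obtain ⟨g, hg⟩ := LinearMap.exists_leftInverse_of_injective (comb (n := n))
    (LinearMap.ker_eq_bot.2 comb_injective)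
  exact ⟨Finsupp.lapply A ∘ₗ g, fun f => congrArg (fun h => h A) (LinearMap.congr_fun hg f)⟩

theorem bar_comb (f : Matrix (Fin n) (Fin n) ℕ →₀ K) :
    bar (comb f) = ∑ B ∈ f.support, barK (f B) • bar (normMonomial B) := by
  rw [comb, Finsupp.linearCombination_apply, Finsupp.sum]
  generalize f.support = s
  induction s using Finset.cons_induction with
  | empty => rw [Finset.sum_empty, Finset.sum_empty]; exact bar_zero
  | cons a s ha ih => rw [Finset.sum_cons, bar_add, bar_smul, ih, Finset.sum_cons]

/-- An element whose coefficients lie in `qℤ[q]`, and whose image under the bar involution has the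
same property, is zero. -/
theorem eq_zero_of_mem_scale {x : OqM n} (hx : x ∈ scale (-1) (lattice n))
    (hb : bar x ∈ scale (-1) (lattice n)) : x = 0 := by
  obtain ⟨f, rfl, hf⟩ := mem_scale_lattice.1 hx
  obtain ⟨g, hg, hg'⟩ := mem_scale_lattice.1 hb
  by_contra hne
  have hs : f.support.Nonempty := by
    rw [Finset.nonempty_iff_ne_empty, Ne, Finsupp.support_eq_empty]
    rintro rfl
    exact hne (map_zero _)
  -- At a lexicographically maximal A no other term of the bar image contributes, so the coefficient
  -- there is barK (f A).
  obtain ⟨A, hA, hmax⟩ := Finset.exists_max_image f.support lexKey hs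
  obtain ⟨φ, hφ⟩ := exists_coefficient A
  have h1 : ∀ B ∈ f.support, φ (bar (normMonomial B)) = if B = A then 1 else 0 := by
    intro B hB
    obtain ⟨u, hu, -, hu'⟩ := exists_comb_of_mem_span (bar_normMonomial_sub_mem B)
    have e : bar (normMonomial B) = comb (u + Finsupp.single B 1) := by
      rw [map_add, hu, comb_single, one_smul, sub_add_cancel]
    rw [e, hφ, Finsupp.add_apply, Finsupp.single_apply, add_eq_right]
    by_contra h
    exact absurd (lexLT_iff.1 (hu' A h).1) (not_lt.2 (hmax B hB))
  have h2 : φ (bar (comb f)) = barK (f A) := by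
    rw [bar_comb, map_sum, Finset.sum_eq_single A]
    · rw [map_smul, h1 A hA, if_pos rfl, smul_eq_mul, mul_one]
    · intro B hB hBA
      rw [map_smul, h1 B hB, if_neg hBA, smul_zero]
    · intro h
      exact absurd hA h
  rw [← hg, hφ] at h2
  exact Finsupp.mem_support_iff.1 hA (eq_zero_of_mem_qIntPoly (hf A) (h2 ▸ hg' A))

theorem monoSpan_mono {A B : Matrix (Fin n) (Fin n) ℕ} (h : Below B A) : monoSpan B ≤ monoSpan A :=
  Submodule.span_mono (Set.image_mono fun _ hC => Below.trans hC h)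

theorem bar_mem_monoSpan {A : Matrix (Fin n) (Fin n) ℕ} {x : OqM n} (hx : x ∈ monoSpan A) :
    bar x ∈ monoSpan A := by
  obtain ⟨f, rfl, hf, hf'⟩ := exists_comb_of_mem_span hx
  rw [bar_comb]
  refine sum_mem fun B hB => ZqPM_smul_mem ?_ (barK_mem_ZqPM (hf B))
  have hB' := hf' B (Finsupp.mem_support_iff.1 hB)
  have h1 := monoSpan_mono hB' (bar_normMonomial_sub_mem B)
  have h2 : normMonomial B ∈ monoSpan A := Submodule.subset_span ⟨B, hB', rfl⟩
  have := add_mem h1 h2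
  rwa [sub_add_cancel] at this

theorem eq_zero_of_smul_normMonomial_mem {A : Matrix (Fin n) (Fin n) ℕ} {c : K}
    (h : c • normMonomial A ∈ monoSpan A) : c = 0 := by
  obtain ⟨f, hf, -, hf'⟩ := exists_comb_of_mem_span h
  rw [← comb_single] at hf
  have := comb_injective hf
  by_contra hc
  refine Below.irrefl A (hf' A ?_)
  rw [this, Finsupp.single_eq_same]
  exact hc

theorem qIntPoly_subset_ZqPM {c : K} (h : c ∈ qIntPoly) : c ∈ ZqPM := by
  obtain ⟨f, hf, -⟩ := exists_laurent_of_mem_qIntPoly h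
  exact ⟨f, hf⟩

theorem qIntPoly_add {c d : K} (hc : c ∈ qIntPoly) (hd : d ∈ qIntPoly) : c + d ∈ qIntPoly := by
  rw [mem_qIntPoly] at *
  rw [mul_add]
  exact add_mem hc hd

/-- The Kazhdan-Lusztig recursion. The coefficient of d at its highest matrix B is anti-invariant,
hence of the form g - barK g with g in qℤ[q]. Removing the contribution of g leaves an
anti-invariant element supported below B. -/
theorem exists_eq_sub_bar (A : Matrix (Fin n) (Fin n) ℕ) :
    ∀ d ∈ monoSpan A, bar d = -d → ∃ h, (∀ B, h B ∈ qIntPoly) ∧ (∀ B, h B ≠ 0 → Below B A) ∧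
      d = comb h - bar (comb h) := by
  induction A using below_wf.induction with
  | _ A ih =>
    intro d hd hbar
    obtain ⟨f, rfl, hf, hf'⟩ := exists_comb_of_mem_span hd
    by_cases hf0 : f = 0
    · refine ⟨0, fun _ => qIntPoly_zero, fun _ h => absurd rfl h, ?_⟩
      rw [hf0, map_zero, zero_sub, bar_zero, neg_zero]
    obtain ⟨B, hB, hmax⟩ := Finset.exists_max_image f.support lexKey
      (Finsupp.support_nonempty_iff.2 hf0)
    have hBA : Below B A := hf' B (Finsupp.mem_support_iff.1 hB)
    set d₁ := comb (f.erase B) with hd₁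
    have hd : comb f = f B • normMonomial B + d₁ := by
      rw [hd₁, ← comb_single, ← map_add, Finsupp.single_add_erase]
    have hd₁B : d₁ ∈ monoSpan B := by
      refine comb_mem_span (fun C => ?_) fun C hC => ?_
      · by_cases hCB : C = B
        · rw [hCB, Finsupp.erase_same]; exact zero_mem _
        · rw [Finsupp.erase_ne hCB]; exact hf C
      · have hCB : C ≠ B := by rintro rfl; exact hC Finsupp.erase_same
        rw [Finsupp.erase_ne hCB] at hC
        have h1 := hf' C hC
        refine ⟨lexLT_iff.2 (lt_of_le_of_ne (hmax C (Finsupp.mem_support_iff.2 hC)) fun h =>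
          hCB (lexKey_injective h)), fun i => ?_, fun j => ?_⟩
        · rw [h1.2.1 i, hBA.2.1 i]
        · rw [h1.2.2 j, hBA.2.2 j]
    obtain ⟨u, hu, hu'⟩ : ∃ u ∈ monoSpan B, bar (normMonomial B) = normMonomial B + u :=
      ⟨_, bar_normMonomial_sub_mem B, by rw [add_sub_cancel]⟩
    have hanti : barK (f B) = -f B := by
      rw [← add_eq_zero_iff_eq_neg]
      refine eq_zero_of_smul_normMonomial_mem (A := B) ?_
      have e : (barK (f B) + f B) • normMonomial B = -(barK (f B) • u + bar d₁ + d₁) := by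
        rw [hd, bar_add, bar_smul, hu', smul_add, ← sub_eq_zero] at hbar
        rw [add_smul, ← sub_eq_zero, ← hbar]
        abel
      rw [e]
      exact neg_mem (add_mem (add_mem (ZqPM_smul_mem hu (barK_mem_ZqPM (hf B)))
        (bar_mem_monoSpan hd₁B)) hd₁B)
    obtain ⟨g, hg, hg'⟩ := exists_sub_barK (hf B) hanti
    -- The right side shows anti-invariance of the remainder, the left side its membership in
    -- `monoSpan B`.
    have e : d₁ + barK g • u = comb f - (g • normMonomial B - bar (g • normMonomial B)) := by
      have hg'' : f B + barK g = g := by rw [hg']; ring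
      rw [hd, bar_smul, hu', smul_add]
      nth_rw 2 [← hg'']
      rw [add_smul]
      abel
    obtain ⟨h, h1, h2, h3⟩ := ih B hBA (d₁ + barK g • u)
      (add_mem hd₁B (ZqPM_smul_mem hu (barK_mem_ZqPM (qIntPoly_subset_ZqPM hg)))) (by
        rw [e]
        rw [bar_sub, bar_sub, bar_bar, hbar]
        abel)
    refine ⟨h + Finsupp.single B g, fun C => qIntPoly_add (h1 C) ?_, fun C hC => ?_, ?_⟩
    · rw [Finsupp.single_apply]
      split_ifs
      · exact hg
      · exact qIntPoly_zero
    · by_cases hCB : C = B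
      · exact hCB ▸ hBA
      · rw [Finsupp.add_apply, Finsupp.single_eq_of_ne hCB, add_zero] at hC
        exact (h2 C hC).trans hBA
    · rw [map_add, bar_add, comb_single, ← sub_eq_zero]
      rw [← sub_eq_zero, e] at h3
      rw [← h3]
      abel

/-- Writing the anti-invariant element bar Z(A) - Z(A) as h - bar h makes Z(A) + h bar-invariant. -/
theorem exists_isDualCanonicalBasis :
    ∃ b : Matrix (Fin n) (Fin n) ℕ → OqM n, IsDualCanonicalBasis b := by
  have key : ∀ A : Matrix (Fin n) (Fin n) ℕ, ∃ h : Matrix (Fin n) (Fin n) ℕ →₀ K,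
      (∀ B, h B ∈ qIntPoly) ∧ (∀ B, h B ≠ 0 → Below B A) ∧
        bar (normMonomial A + comb h) = normMonomial A + comb h := by
    intro A
    obtain ⟨h, h1, h2, h3⟩ := exists_eq_sub_bar A _ (bar_normMonomial_sub_mem A) (by
      rw [bar_sub, bar_bar]
      abel)
    refine ⟨h, h1, h2, ?_⟩
    rw [bar_add, ← sub_eq_zero]
    rw [← sub_eq_zero] at h3
    rw [← h3]
    abel
  choose h h1 h2 h3 using key
  exact ⟨fun A => normMonomial A + comb (h A), h3, fun A => ⟨h A, h1 A, h2 A, rfl⟩⟩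

theorem IsDualCanonicalBasis.sub_normMonomial_mem {b : Matrix (Fin n) (Fin n) ℕ → OqM n}
    (hb : IsDualCanonicalBasis b) (A : Matrix (Fin n) (Fin n) ℕ) :
    b A - normMonomial A ∈ scale (-1) (lattice n) := by
  obtain ⟨h, h1, -, h2⟩ := hb.triangular A
  rw [h2, add_sub_cancel_left]
  exact mem_scale_lattice.2 ⟨h, rfl, h1⟩

/-- The working form of uniqueness: a bar-invariant element is determined by its class modulo qL. -/
theorem eq_of_sub_mem {x y z : OqM n} (hx : bar x = x) (hy : bar y = y)
    (hxz : x - z ∈ scale (-1) (lattice n)) (hyz : y - z ∈ scale (-1) (lattice n)) : x = y := by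
  have h : x - y ∈ scale (-1) (lattice n) := by
    have := sub_mem hxz hyz
    rwa [sub_sub_sub_cancel_right] at this
  exact sub_eq_zero.1 (eq_zero_of_mem_scale h (by rwa [bar_sub, hx, hy]))

theorem IsDualCanonicalBasis.unique {b b' : Matrix (Fin n) (Fin n) ℕ → OqM n}
    (hb : IsDualCanonicalBasis b) (hb' : IsDualCanonicalBasis b') : b = b' :=
  funext fun A => eq_of_sub_mem (hb.bar_eq A) (hb'.bar_eq A) (hb.sub_normMonomial_mem A) (hb'.sub_normMonomial_mem A)

end Bases

end QMat
end
noncomputable section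

namespace QMat

variable {n : ℕ}

/-! ### The minors given by permutations, and their bar-invariance. -/

section Laplace

/-- The permutation that maps `0` to `p` and acts as `s` on the remaining elements. -/
def extendPerm {m : ℕ} (p : Fin (m + 1)) (s : Equiv.Perm (Fin m)) : Equiv.Perm (Fin (m + 1)) :=
  ((finSuccEquiv' 0).trans s.optionCongr).trans (finSuccEquiv' p).symm

theorem extendPerm_zero {m : ℕ} (p : Fin (m + 1)) (s : Equiv.Perm (Fin m)) :
    extendPerm p s 0 = p := by
  simp [extendPerm]

theorem extendPerm_succ {m : ℕ} (p : Fin (m + 1)) (s : Equiv.Perm (Fin m)) (i : Fin m) :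
    extendPerm p s i.succ = p.succAbove (s i) := by
  have h : finSuccEquiv' (0 : Fin (m + 1)) i.succ = some i := by
    rw [← Fin.succAbove_zero_apply, finSuccEquiv'_succAbove]
  simp [extendPerm, h]

theorem extendPerm_bijective (m : ℕ) : Function.Bijective
    fun x : Fin (m + 1) × Equiv.Perm (Fin m) => extendPerm x.1 x.2 := by
  rw [Fintype.bijective_iff_injective_and_card]
  refine ⟨?_, by simp [Fintype.card_perm, Nat.factorial_succ]⟩
  rintro ⟨p, s⟩ ⟨p', s'⟩ h
  have h0 : p = p' := by
    have := DFunLike.congr_fun h 0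
    simpa [extendPerm_zero] using this
  subst h0
  refine Prod.ext rfl (Equiv.ext fun i => ?_)
  have := DFunLike.congr_fun h i.succ
  simpa [extendPerm_succ] using this

theorem permLength_eq_sum {m : ℕ} (s : Equiv.Perm (Fin m)) :
    permLength s = ∑ i, ∑ j, if i < j ∧ s j < s i then 1 else 0 := by
  rw [permLength, Finset.card_filter, Fintype.sum_prod_type]

/-- The index 0 is inverted with exactly those successors whose images lie below p, and there are p
of them; `succAbove` preserves the other inversions. -/
theorem permLength_extendPerm {m : ℕ} (p : Fin (m + 1)) (s : Equiv.Perm (Fin m)) :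
    permLength (extendPerm p s) = p + permLength s := by
  rw [permLength_eq_sum, permLength_eq_sum, Fin.sum_univ_succ]
  congr 1
  · simp only [extendPerm_zero, Fin.sum_univ_succ, extendPerm_succ, lt_irrefl, false_and, if_false,
      zero_add, Fin.succ_pos, true_and, Fin.succAbove_lt_iff_castSucc_lt]
    rw [Equiv.sum_comp s fun k => if k.castSucc < p then 1 else 0, Finset.sum_boole, Nat.cast_id]
    have := Fin.card_Iio p
    rw [← this]
    refine Finset.card_bij (fun k _ => k.castSucc) ?_ ?_ ?_
    · intro k hk
      simpa using hk
    · intro k _ k' _ h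
      exact Fin.castSucc_injective _ h
    · intro k hk
      rw [Finset.mem_Iio] at hk
      exact ⟨k.castPred (Fin.ne_last_of_lt hk), by simpa using hk, by simp⟩
  · refine Finset.sum_congr rfl fun i _ => ?_
    rw [Fin.sum_univ_succ]
    simp [extendPerm_succ]

theorem quantumMinor_succ {m : ℕ} (r c : Fin (m + 1) ↪o Fin n) :
    quantumMinor r c = ∑ p : Fin (m + 1), (-q ^ 2) ^ (p : ℕ) • (Z (r 0) (c p) *
      quantumMinor ((Fin.succOrderEmb m).trans r) ((Fin.succAboveOrderEmb p).trans c)) := by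
  rw [quantumMinor, ← (extendPerm_bijective m).sum_comp, Fintype.sum_prod_type]
  refine Finset.sum_congr rfl fun p _ => ?_
  rw [quantumMinor, Finset.mul_sum, Finset.smul_sum]
  refine Finset.sum_congr rfl fun s _ => ?_
  rw [permLength_extendPerm, pow_add, mul_smul_comm, smul_smul, List.finRange_succ,
    List.map_cons, List.prod_cons, extendPerm_zero, List.map_map]
  congr 4

theorem posIn_map {m : ℕ} (c : Fin m ↪o Fin n) (p : Fin m) :
    posIn (Finset.univ.map c.toEmbedding) (c p) = p := by
  have := Fin.card_Iio p
  rw [← this, posIn, Finset.filter_map, Finset.card_map]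
  congr 1
  ext k
  simp

theorem quantumMinor_eq_qminor {m : ℕ} (r c : Fin m ↪o Fin n) :
    quantumMinor r c = qminor ((List.finRange m).map r) (Finset.univ.map c.toEmbedding) := by
  induction m with
  | zero => simp [quantumMinor, minor, permLength]
  | succ m ih =>
    rw [quantumMinor_succ, List.finRange_succ, List.map_cons, qminor, minor, Finset.sum_map]
    refine Finset.sum_congr rfl fun p _ => ?_
    have h1 : (Finset.univ.map c.toEmbedding).erase (c p) =
        Finset.univ.map ((Fin.succAboveOrderEmb p).trans c).toEmbedding := by
      ext k
      simp only [Finset.mem_erase, Finset.mem_map, Finset.mem_univ, true_and]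
      constructor
      · rintro ⟨hk, a, rfl⟩
        obtain ⟨b, hb⟩ := Fin.exists_succAbove_eq (x := a) (y := p) (fun h => hk (by rw [h]; rfl))
        exact ⟨b, by rw [← hb]; rfl⟩
      · rintro ⟨b, rfl⟩
        exact ⟨fun h => Fin.succAbove_ne p b (c.injective h), p.succAbove b, rfl⟩
    rw [ih, List.map_map]
    change _ = (-q ^ 2) ^ posIn _ (c p) • (Z (r 0) (c p) * minor _ _ _ (Finset.erase _ (c p)))
    rw [posIn_map, h1]
    rfl

theorem detq_eq_qminor {t : ℕ} (ht : t ≤ n) :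
    detq t ht = qminor (rowRange n t 0) (colsFrom n (n - t)) := by
  rw [detq, quantumMinor_eq_qminor]
  congr 1
  · refine List.ext_getElem ?_ fun i h1 h2 => ?_
    · simp [rowRange, ht]
    · simp [rowRange]
  · ext j
    simp only [Finset.mem_map, Finset.mem_univ, true_and, colsFrom, Finset.mem_filter]
    constructor
    · rintro ⟨i, rfl⟩
      exact Nat.le_add_right _ _
    · intro h
      exact ⟨⟨j - (n - t), by omega⟩, Fin.ext (Nat.add_sub_cancel' h)⟩

theorem bar_sum {ι : Type*} (s : Finset ι) (f : ι → OqM n) :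
    bar (∑ i ∈ s, f i) = ∑ i ∈ s, bar (f i) := by
  induction s using Finset.cons_induction with
  | empty => exact bar_zero
  | cons a s ha ih => rw [Finset.sum_cons, bar_add, ih, Finset.sum_cons]

/-- Bar reverses each product in the expansion and inverts its coefficient; `sum_inv_smul_minor_mul`
identifies the result with the same minor. -/
theorem bar_qminor (rs : List (Fin n)) (h : rs.Pairwise (· < ·)) :
    ∀ I, bar (qminor rs I) = qminor rs I := by
  induction rs with
  | nil =>
    intro I
    simp only [qminor, minor]
    split_ifs
    · exact bar_one
    · exact bar_zero
  | cons i rs ih =>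
    intro I
    obtain ⟨h1, h2⟩ := List.pairwise_cons.1 h
    have hexp : qminor (i :: rs) I = ∑ j ∈ I, (-q ^ 2) ^ posIn I j •
      (Z i j * qminor rs (I.erase j)) := rfl
    conv_rhs => rw [qminor, ← sum_inv_smul_minor_mul isQuantumMatrix_Z q_sq_ne_zero h1 I]
    rw [hexp, bar_sum]
    refine Finset.sum_congr rfl fun j _ => ?_
    rw [bar_smul, bar_mul, bar_Z, ih h2, map_pow, map_neg, map_pow, barK_q, ← inv_pow, inv_pow q,
      ← inv_neg, inv_pow]

theorem bar_detq {t : ℕ} (ht : t ≤ n) : bar (detq t ht) = detq t ht := by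
  rw [detq_eq_qminor, bar_qminor _ (pairwise_rowRange t 0)]

end Laplace

/-! ### The multiplication rule and the product formula. -/

section Product

theorem rho_mem_lattice {x : OqM n} (hx : x ∈ lattice n) : rho x ∈ lattice n := by
  induction hx using Submodule.span_induction with
  | mem x hx =>
    obtain ⟨A, rfl⟩ := hx
    rw [rho_normMonomial]
    exact normMonomial_mem _
  | zero => rw [← zero_smul K (0 : OqM n), rho_smul, zero_smul]; exact zero_mem _
  | add x y _ _ hx hy => rw [rho_add]; exact add_mem hx hy
  | smul c x _ hx => exact (rho_smul (c : K) x) ▸ Submodule.smul_mem _ c hx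

theorem rho_mem_scale {e : ℤ} {x : OqM n} (hx : x ∈ scale e (lattice n)) :
    rho x ∈ scale e (lattice n) := by
  rw [mem_scale, ← rho_smul]
  exact rho_mem_lattice hx

theorem sigma_mem_lattice {x : OqM n} (hx : x ∈ lattice n) : sigma n x ∈ lattice n := by
  induction hx using Submodule.span_induction with
  | mem x hx =>
    obtain ⟨A, rfl⟩ := hx
    rw [sigma_normMonomial]
    exact normMonomial_mem _
  | zero => rw [map_zero]; exact zero_mem _
  | add x y _ _ hx hy => rw [map_add]; exact add_mem hx hy
  | smul c x _ hx => exact (map_smul (sigma n) (c : K) x) ▸ Submodule.smul_mem _ c hx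

theorem sigma_mem_scale {e : ℤ} {x : OqM n} (hx : x ∈ scale e (lattice n)) :
    sigma n x ∈ scale e (lattice n) := by
  rw [mem_scale, ← map_smul]
  exact sigma_mem_lattice hx

theorem rho_sub (x y : OqM n) : rho (x - y) = rho x - rho y := by
  rw [eq_sub_iff_add_eq, ← rho_add, sub_add_cancel]

variable {b : Matrix (Fin n) (Fin n) ℕ → OqM n}

/-- Since ρ commutes with bar and permutes the normalized monomials, the image is bar-invariant and
congruent to the right monomial. -/
theorem IsDualCanonicalBasis.rho_eq (hb : IsDualCanonicalBasis b)
    (A : Matrix (Fin n) (Fin n) ℕ) : rho (b A) = b (antiTranspose A) := by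
  refine eq_of_sub_mem (by rw [bar_rho, hb.bar_eq]) (hb.bar_eq _) ?_ (hb.sub_normMonomial_mem _)
  rw [← rho_normMonomial, ← rho_sub]
  exact rho_mem_scale (hb.sub_normMonomial_mem A)

theorem IsDualCanonicalBasis.sigma_eq (hb : IsDualCanonicalBasis b)
    (A : Matrix (Fin n) (Fin n) ℕ) : sigma n (b A) = b A.transpose := by
  refine eq_of_sub_mem (by rw [bar_sigma, hb.bar_eq]) (hb.bar_eq _) ?_ (hb.sub_normMonomial_mem _)
  rw [← sigma_normMonomial, ← map_sub]
  exact sigma_mem_scale (hb.sub_normMonomial_mem A)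

theorem antiTranspose_partialDiag {t : ℕ} (ht : t ≤ n) :
    antiTranspose (partialDiag n t 0) = partialDiag n t 0 := by
  ext i j
  unfold antiTranspose partialDiag
  congr 1
  simp only [Fin.val_rev, eq_iff_iff]
  omega

theorem normMonomial_zero : normMonomial (0 : Matrix (Fin n) (Fin n) ℕ) = 1 := by
  simp [normMonomial, monomial, normExp]

theorem detq_sub_mem {t : ℕ} (ht : t ≤ n) :
    detq t ht - normMonomial (partialDiag n t 0) ∈ scale (-1) (lattice n) := by
  have := qminor_mul_normMonomial ht (0 : Matrix (Fin n) (Fin n) ℕ)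
  rw [normMonomial_zero, mul_one, zero_add, ← detq_eq_qminor ht] at this
  simpa [topSum, rightSum] using this

theorem rho_detq {t : ℕ} (ht : t ≤ n) : rho (detq t ht) = detq t ht := by
  refine eq_of_sub_mem (by rw [bar_rho, bar_detq]) (bar_detq ht) ?_ (detq_sub_mem ht)
  have := rho_mem_scale (detq_sub_mem ht)
  rwa [rho_sub, rho_normMonomial, antiTranspose_partialDiag ht] at this

theorem SameSums.topSum_eq {A B : Matrix (Fin n) (Fin n) ℕ} (h : SameSums B A) (t : ℕ) :
    topSum t B = topSum t A := by
  refine Finset.sum_congr rfl fun i _ => ?_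
  split_ifs
  · exact h.1 i
  · rfl

theorem SameSums.rightSum_eq {A B : Matrix (Fin n) (Fin n) ℕ} (h : SameSums B A) (t : ℕ) :
    rightSum t B = rightSum t A := by
  rw [rightSum, rightSum, Finset.sum_comm]
  conv_rhs => rw [Finset.sum_comm]
  refine Finset.sum_congr rfl fun i _ => ?_
  split_ifs
  · exact h.2 i
  · rfl

theorem topSum_antiTranspose (t : ℕ) (A : Matrix (Fin n) (Fin n) ℕ) :
    topSum t (antiTranspose A) = rightSum t A := by
  unfold topSum rightSum antiTranspose
  rw [Finset.sum_comm]
  rw [← sum_rev]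
  refine Finset.sum_congr rfl fun j _ => ?_
  rw [← sum_rev]
  refine Finset.sum_congr rfl fun i _ => ?_
  have : (i.rev : ℕ) < t ↔ n - t ≤ (i : ℕ) := by rw [Fin.val_rev]; omega
  simp only [this, Fin.rev_rev]

theorem rightSum_antiTranspose (t : ℕ) (A : Matrix (Fin n) (Fin n) ℕ) :
    rightSum t (antiTranspose A) = topSum t A := by
  rw [← topSum_antiTranspose, antiTranspose_antiTranspose]

theorem scale_neg_one_le : scale (-1) (lattice n) ≤ lattice n := fun x hx => by
  have := q_pow_smul_mem (mem_scale.1 hx) 1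
  rwa [smul_smul, pow_one, zpow_neg_one, mul_inv_cancel₀ q_ne_zero, one_smul] at this

/-- All B in the expansion of b(A) have the row and column sums of A, so a single power of q suits
every term, and coefficients in qℤ[q] push the lower terms into qL. -/
theorem IsDualCanonicalBasis.detq_mul_sub_mem (hb : IsDualCanonicalBasis b) {t : ℕ} (ht : t ≤ n)
    (A : Matrix (Fin n) (Fin n) ℕ) :
    q ^ (topSum t A - rightSum t A : ℤ) • (detq t ht * b A) -
      normMonomial (A + partialDiag n t 0) ∈ scale (-1) (lattice n) := by
  obtain ⟨h, h1, h2, h3⟩ := hb.triangular A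
  rw [h3, mul_add, smul_add, add_sub_right_comm, detq_eq_qminor]
  refine add_mem (qminor_mul_normMonomial ht A) ?_
  rw [Finsupp.sum, Finset.mul_sum, Finset.smul_sum]
  refine sum_mem fun B hB => ?_
  have hs := (h2 B (Finsupp.mem_support_iff.1 hB)).2
  rw [mul_smul_comm, smul_comm, mem_scale, smul_smul, zpow_neg_one]
  refine Zq_smul_mem ?_ (mem_qIntPoly.1 (h1 B))
  have := add_mem (scale_neg_one_le (qminor_mul_normMonomial ht B))
    (normMonomial_mem (B + partialDiag n t 0))
  rwa [sub_add_cancel, hs.topSum_eq, hs.rightSum_eq] at this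

/-- The bar image has the minor on the right and the inverse power of q. It is the ρ-image of the
product for the reflected matrix, whose top and right sums are interchanged, so it satisfies the
same congruence. -/
theorem IsDualCanonicalBasis.detq_mul (hb : IsDualCanonicalBasis b) {t : ℕ} (ht : t ≤ n)
    (A : Matrix (Fin n) (Fin n) ℕ) :
    q ^ (topSum t A - rightSum t A : ℤ) • (detq t ht * b A) = b (A + partialDiag n t 0) := by
  set x := q ^ (topSum t A - rightSum t A : ℤ) • (detq t ht * b A) with hx
  set z := normMonomial (A + partialDiag n t 0) with hz
  have h1 : x - z ∈ scale (-1) (lattice n) := hb.detq_mul_sub_mem ht A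
  have h2 : bar x - z ∈ scale (-1) (lattice n) := by
    have h := rho_mem_scale (hb.detq_mul_sub_mem ht (antiTranspose A))
    rw [rho_sub, rho_smul, rho_mul, hb.rho_eq, rho_detq, antiTranspose_antiTranspose,
      rho_normMonomial, topSum_antiTranspose, rightSum_antiTranspose] at h
    rw [hx, bar_smul, bar_mul, bar_detq, hb.bar_eq, barK_zpow, neg_sub]
    convert h using 3
    -- The matrix E_t is symmetric about the antidiagonal, so reflecting the sum of reflected A and
    -- E_t gives back A + E_t.
    conv_lhs => rw [← antiTranspose_antiTranspose A, ← antiTranspose_partialDiag ht]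
    rfl
  have h3 := hb.sub_normMonomial_mem (A + partialDiag n t 0)
  have h4 : x - b (A + partialDiag n t 0) ∈ scale (-1) (lattice n) := by
    have := sub_mem h1 h3
    rwa [sub_sub_sub_cancel_right] at this
  refine sub_eq_zero.1 (eq_zero_of_mem_scale h4 ?_)
  rw [bar_sub, hb.bar_eq]
  have := sub_mem h2 h3
  rwa [sub_sub_sub_cancel_right] at this

theorem QEquiv.trans {x y z : OqM n} (h : QEquiv x y) (h' : QEquiv y z) : QEquiv x z := by
  obtain ⟨m, rfl⟩ := h
  obtain ⟨m', rfl⟩ := h'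
  exact ⟨m' + m, by rw [smul_smul, zpow_add₀ q_ne_zero]⟩

theorem QEquiv.mul_left {x y : OqM n} (h : QEquiv x y) (z : OqM n) : QEquiv (z * x) (z * y) := by
  obtain ⟨m, rfl⟩ := h
  exact ⟨m, mul_smul_comm _ _ _⟩

theorem QEquiv.map_sigma {x y : OqM n} (h : QEquiv x y) : QEquiv (sigma n x) (sigma n y) := by
  obtain ⟨m, rfl⟩ := h
  exact ⟨m, map_smul _ _ _⟩

theorem QEquiv.refl (x : OqM n) : QEquiv x x := ⟨0, by rw [zpow_zero, one_smul]⟩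

theorem IsDualCanonicalBasis.qEquiv_detq_mul (hb : IsDualCanonicalBasis b) {t : ℕ} (ht : t ≤ n)
    (A : Matrix (Fin n) (Fin n) ℕ) : QEquiv (b (A + partialDiag n t 0)) (detq t ht * b A) :=
  ⟨-(topSum t A - rightSum t A : ℤ), by
    rw [← hb.detq_mul ht, smul_smul, ← zpow_add₀ q_ne_zero, neg_add_cancel, zpow_zero, one_smul]⟩

theorem IsDualCanonicalBasis.qEquiv_sigma_detq_mul (hb : IsDualCanonicalBasis b) {t : ℕ}
    (ht : t ≤ n) (A : Matrix (Fin n) (Fin n) ℕ) :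
    QEquiv (b (A + (partialDiag n t 0).transpose)) (sigma n (detq t ht) * b A) := by
  have := (hb.qEquiv_detq_mul ht A.transpose).map_sigma
  rwa [map_mul, hb.sigma_eq, hb.sigma_eq, Matrix.transpose_add, Matrix.transpose_transpose] at this

theorem qEquiv_pow_mul {E : Matrix (Fin n) (Fin n) ℕ} {x : OqM n}
    (h : ∀ A, QEquiv (b (A + E)) (x * b A)) (k : ℕ) (A : Matrix (Fin n) (Fin n) ℕ) :
    QEquiv (b (A + k • E)) (x ^ k * b A) := by
  induction k with
  | zero => simpa using QEquiv.refl _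
  | succ k ih =>
    rw [succ_nsmul, ← add_assoc, pow_succ', mul_assoc]
    exact (h _).trans (ih.mul_left x)

theorem qEquiv_list_prod_mul {ι : Type*} (E : ι → Matrix (Fin n) (Fin n) ℕ) (x : ι → OqM n)
    (h : ∀ t A, QEquiv (b (A + E t)) (x t * b A)) (l : List ι) (A : Matrix (Fin n) (Fin n) ℕ) :
    QEquiv (b (A + (l.map E).sum)) ((l.map x).prod * b A) := by
  induction l with
  | nil => simpa using QEquiv.refl _
  | cons t l ih =>
    rw [List.map_cons, List.sum_cons, List.map_cons, List.prod_cons, mul_assoc, add_left_comm,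
      add_comm (E t)]
    exact (h t _).trans (ih.mul_left (x t))

theorem sum_map_apply {ι : Type*} (l : List ι) (E : ι → Matrix (Fin n) (Fin n) ℕ) (i j : Fin n) :
    (l.map E).sum i j = (l.map fun t => E t i j).sum := by
  induction l with
  | nil => rfl
  | cons t l ih => rw [List.map_cons, List.sum_cons, Matrix.add_apply, ih, List.map_cons,
      List.sum_cons]

/-- A position (i, j) with i < j lies on E_t exactly for t = n - (j - i), which is between 1 and n -
1, and then n - t + 1 = j - i + 1. Below the diagonal the transposes do the same; no E_t with t < n
meets the diagonal. -/
theorem toeplitzLike_eq (a : Fin n → ℕ) (b c : ℕ → ℕ) {l : List {t : ℕ // 1 ≤ t ∧ t ≤ n - 1}}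
    (hl : l.Nodup) (hl' : ∀ t, t ∈ l) :
    toeplitzLike a b c = Matrix.diagonal a + (l.map fun t =>
      c (n - t.1 + 1) • (partialDiag n t.1 0).transpose +
        b (n - t.1 + 1) • partialDiag n t.1 0).sum := by
  ext i j
  rw [Matrix.add_apply, sum_map_apply, ← List.sum_toFinset _ hl, toeplitzLike]
  simp only [Matrix.add_apply, Matrix.smul_apply, Matrix.transpose_apply, partialDiag, smul_eq_mul]
  rcases lt_trichotomy i j with h | h | h
  · have hij : (i : ℕ) < j := h
    rw [if_neg h.ne, if_pos h, Matrix.diagonal_apply_ne _ h.ne, zero_add, Finset.sum_eq_single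
      (⟨n - (j - i), by omega⟩ : {t : ℕ // 1 ≤ t ∧ t ≤ n - 1})]
    · rw [if_neg (by simp only; omega), if_pos (by simp only; omega), mul_zero, zero_add, mul_one]
      congr 1
      simp only
      omega
    · intro t _ ht
      have h1 : t.1 ≠ n - (j - i) := fun e => ht (Subtype.ext e)
      have h2 := t.2
      rw [if_neg (by omega), if_neg (by omega), mul_zero, mul_zero, add_zero]
    · intro hn
      exact absurd (List.mem_toFinset.2 (hl' _)) hn
  · subst h
    rw [if_pos rfl, Matrix.diagonal_apply_eq, Finset.sum_eq_zero, add_zero]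
    intro t _
    have h2 := t.2
    rw [if_neg (by omega), mul_zero, mul_zero, add_zero]
  · have hij : (j : ℕ) < i := h
    rw [if_neg h.ne', if_neg h.not_gt, Matrix.diagonal_apply_ne _ h.ne', zero_add,
      Finset.sum_eq_single (⟨n - (i - j), by omega⟩ : {t : ℕ // 1 ≤ t ∧ t ≤ n - 1})]
    · rw [if_pos (by simp only; omega), if_neg (by simp only; omega), mul_zero, add_zero, mul_one]
      congr 1
      simp only
      omega
    · intro t _ ht
      have h1 : t.1 ≠ n - (i - j) := fun e => ht (Subtype.ext e)
      have h2 := t.2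
      rw [if_neg (by omega), if_neg (by omega), mul_zero, mul_zero, add_zero]
    · intro hn
      exact absurd (List.mem_toFinset.2 (hl' _)) hn

end Product

end QMat
end
theorem corollary5p3 (n : ℕ) :
    (∃! B : Matrix (Fin n) (Fin n) ℕ → QMat.OqM n, QMat.IsDualCanonicalBasis B) ∧
    ∀ B : Matrix (Fin n) (Fin n) ℕ → QMat.OqM n, QMat.IsDualCanonicalBasis B →
      ∀ (a : Fin n → ℕ) (b c : ℕ → ℕ) (l : List {t : ℕ // 1 ≤ t ∧ t ≤ n - 1}),
        l.Nodup → (∀ t, t ∈ l) →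
        QMat.QEquiv (B (QMat.toeplitzLike a b c))
          ((l.map fun t =>
              QMat.detq t.1 (t.2.2.trans (Nat.sub_le n 1)) ^ b (n - t.1 + 1) *
                QMat.sigma n (QMat.detq t.1 (t.2.2.trans (Nat.sub_le n 1))) ^
                  c (n - t.1 + 1)).prod *
            B (Matrix.diagonal a)) := by
  refine ⟨?_, fun B hB a b c l hl hl' => ?_⟩
  · obtain ⟨B, hB⟩ := QMat.exists_isDualCanonicalBasis (n := n)
    exact ⟨B, hB, fun B' hB' => hB'.unique hB⟩
  · rw [QMat.toeplitzLike_eq a b c hl hl']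
    refine QMat.qEquiv_list_prod_mul _ _ (fun t A => ?_) l _
    have ht := t.2.2.trans (Nat.sub_le n 1)
    -- The copies of E_t are peeled off first, then those of its transpose, which leaves the power
    -- of det_q(t) to the left of the power of its σ-image.
    rw [← add_assoc, mul_assoc]
    exact (QMat.qEquiv_pow_mul (hB.qEquiv_detq_mul ht) _ _).trans
      ((QMat.qEquiv_pow_mul (hB.qEquiv_sigma_detq_mul ht) _ _).mul_left _)
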